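/- Let $0<q<1$. Let $\mathcal A(SU_q(2))$ be the $*$-algebra generated by $a,c$ with $uu^*=u^*u=1$ for $u=\begin{pmatrix}a&-qc^*\\c&a^*\end{pmatrix}$, and let $(\Lambda_2^\bullet,\mathrm d)$ be the exterior algebra of Woronowicz' three-dimensional left covariant $*$-calculus on it, with invariant one-forms $\omega_z=a^*\mathrm da+c^*\mathrm dc$, $\omega_-=c^*\mathrm da^*-qa^*\mathrm dc^*$, $\omega_+=a\,\mathrm dc-qc\,\mathrm da$, where $\omega_\pm^*=-\omega_\mp$, $\omega_z^*=-\omega_z$, $\omega_j\wedge\omega_j=0$, $\omega_+\wedge\omega_-=-q^2\omega_-\wedge\omega_+$, $\omega_z\wedge\omega_\mp=-q^{\pm4}\omega_\mp\wedge\omega_z$. Let $\alpha,\beta,\gamma$ be real with $(1+q^{-2})\gamma=\alpha=q^{-6}\beta\neq0$. Give $\Lambda_2^\bullet$ the right-module Hermitian structure $(\ ,\ )$ for which the monomials $1,\ \omega_i,\ \omega_i\wedge\omega_j,\ \tau_2=\omega_-\wedge\omega_+\wedge\omega_z$ are orthogonal, $(1,1)=(\tau_2,\tau_2)=1$, $(\omega_+,\omega_+)=\alpha$,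 $(\omega_-,\omega_-)=\beta$, $(\omega_z,\omega_z)=\gamma$, and, with $\lambda=1+q^2$, $$(\omega_-\wedge\omega_+,\omega_-\wedge\omega_+)=\tfrac{2\alpha\beta}{\lambda},\quad(\omega_-\wedge\omega_z,\omega_-\wedge\omega_z)=\tfrac{2q^{-2}\beta\gamma}{\lambda},\quad(\omega_+\wedge\omega_z,\omega_+\wedge\omega_z)=\tfrac{2q^{6}\alpha\gamma}{\lambda}.$$ For a calculus of dimension $n$ with Hermitian structure and volume form $\tau$, the Hodge operator $\ast_H:\Lambda^k\to\Lambda^{n-k}$ is the linear map with $\tau\,(\ast_H\xi,\eta)=\xi^*\wedge\eta$ for $\xi\in\Lambda^k$, $\eta\in\Lambda^{n-k}$. A connection $\nabla=\mathrm d+\mathfrak A$ on a free module $\mathcal A^N$, with $\mathfrak A$ a matrix of one-forms, has curvature $F=\nabla^2$, a matrix of two-forms, and solves the Yang-Mills equations if $[\nabla,\ast_HF]=0$ (graded commutator, $\ast_H$ applied entrywise). Let $\mathcal A(GL_q(1,\mathbb H))$, the algebra of $\mathbb R^4_q\smallsetminus\{0\}$, be the $*$-algebra generated by $x_1,\dots,x_4$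 and central $r^{\pm1}$, with $x_ix_j=qx_jx_i$ for $i<j$, $i+j\neq5$, $x_2x_3=x_3x_2$, $x_1x_4-x_4x_1=(q^{-1}-q)x_2x_3$, $(qx_1x_4+q^2x_2x_3)r^{-2}=1$, $x_1^*=qx_4$, $x_2^*=x_3$, $r^*=r$, and put $Q=\begin{pmatrix}x_1&-qx_3\\x_2&qx_4\end{pmatrix}$. Let $\mathcal A_1=\mathbb C[r,r^{-1}]$, $r=r^*$, with its one-dimensional calculus $\Lambda_1=\mathcal A_1\oplus\mathcal A_1\,\mathrm dr$ ($r\,\mathrm dr=\mathrm dr\,r$, $\mathrm dr^{-1}=-r^{-2}\mathrm dr$, $(\mathrm dr)^*=\mathrm dr$), $(1,1)=(\mathrm dr,\mathrm dr)=1$ and volume form $\mathrm dr$. The warped product of $\Lambda_1$ and $\Lambda_2$ with $\rho_k=r^k$ is the graded tensor product $\Lambda_1\otimes\Lambda_2$, a calculus over $\mathcal A_1\otimes\mathcal A(SU_q(2))$, with the Hermitian structure $(\xi_1\otimes\xi_2,\eta_1\otimes\eta_2)=r^{-2k}(\xi_1,\eta_1)\otimes(\xi_2,\eta_2)$ for $\xi_2,\eta_2\in\Lambda_2^k$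 (different $k$ being orthogonal), and the volume form $\tau=r^3\,\mathrm dr\otimes\tau_2$. Then: 1. On $SU_q(2)$ the Hodge operator exists and is unique, and $\nabla=\mathrm d+\mathfrak A$ with $$\mathfrak A=\tfrac12\begin{pmatrix}\omega_z&\omega_-\\\omega_+&-q^2\omega_z\end{pmatrix}$$ solves the Yang-Mills equations. 2. There are an injective $*$-algebra morphism $i:\mathcal A(SU_q(2))\to\mathcal A(GL_q(1,\mathbb H))$ with $i(u)=r^{-1}Q$ and a $*$-isomorphism $\Phi:\mathcal A(GL_q(1,\mathbb H))\to\mathcal A_1\otimes\mathcal A(SU_q(2))$ with $\Phi(r^{\pm1})=r^{\pm1}\otimes1$, $\Phi(Q)=r\otimes u$; the algebra morphism $i^*:\Lambda_2\to\Lambda_1\otimes\Lambda_2$, $i^*\omega=1\otimes\omega$, extends $\Phi\circ i$ and commutes with the differentials. 3. Identifying $\mathcal A(GL_q(1,\mathbb H))$ with $\mathcal A_1\otimes\mathcal A(SU_q(2))$ by $\Phi$, $$i^*(\mathfrak A)=\tfrac12r^{-1}\begin{pmatrix}qx_4\,\mathrm d(r^{-1}x_1)+x_3\,\mathrm d(r^{-1}x_2)&x_3\,\mathrm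 d(r^{-1}qx_4)-q^2x_4\,\mathrm d(r^{-1}x_3)\\x_1\,\mathrm d(r^{-1}x_2)-qx_2\,\mathrm d(r^{-1}x_1)&-q^2\{qx_4\,\mathrm d(r^{-1}x_1)+x_3\,\mathrm d(r^{-1}x_2)\}\end{pmatrix}.$$ 4. The Hodge operator $\ast_H$ of the warped product exists and is unique, and the quantum meron $\nabla=\mathrm d+i^*(\mathfrak A)$ solves the Yang-Mills equations on $\mathbb R^4_q\smallsetminus\{0\}$. Its curvature $F$ is not an eigenvector of $\ast_H$, that is $\ast_HF\neq zF$ for all $z\in\mathbb C$; in particular the quantum meron is neither self-dual nor anti-self-dual. -/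

import Mathlib

open scoped TensorProduct Matrix

set_option linter.unusedSimpArgs false
set_option linter.unusedTactic false
set_option linter.unreachableTactic false
set_option linter.unnecessarySeqFocus false

noncomputable section

namespace QuantumMeron

/-! ### Star algebras by generators and relations -/

section Presented

variable {X : Type}

/-- The unital complex algebra generated by `X` with the relations `rel`. -/
abbrev Presented (rel : FreeAlgebra ℂ X → FreeAlgebra ℂ X → Prop) : Type := RingQuot rel

/-- The class of a noncommutative polynomial in the presented algebra. -/
abbrev Presented.mk (rel : FreeAlgebra ℂ X → FreeAlgebra ℂ X → Prop) :
    FreeAlgebra ℂ X →ₐ[ℂ] Presented rel := RingQuot.mkAlgHom ℂ rel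

/-- The generator `x` of the presented algebra. -/
abbrev Presented.gen (rel : FreeAlgebra ℂ X → FreeAlgebra ℂ X → Prop) (x : X) : Presented rel :=
  Presented.mk rel (FreeAlgebra.ι ℂ x)

/-- The algebra morphism out of a presented algebra given by images of the generators which
satisfy the relations. -/
def Presented.lift {rel : FreeAlgebra ℂ X → FreeAlgebra ℂ X → Prop} {B : Type} [Ring B]
    [Algebra ℂ B] (f : X → B)
    (h : ∀ x y, rel x y → FreeAlgebra.lift ℂ f x = FreeAlgebra.lift ℂ f y) :
    Presented rel →ₐ[ℂ] B :=
  RingQuot.liftAlgHom ℂ ⟨FreeAlgebra.lift ℂ f, fun x y hxy => h x y hxy⟩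

theorem Presented.lift_mk {rel : FreeAlgebra ℂ X → FreeAlgebra ℂ X → Prop} {B : Type} [Ring B]
    [Algebra ℂ B] (f : X → B)
    (h : ∀ x y, rel x y → FreeAlgebra.lift ℂ f x = FreeAlgebra.lift ℂ f y)
    (p : FreeAlgebra ℂ X) :
    Presented.lift f h (Presented.mk rel p) = FreeAlgebra.lift ℂ f p :=
  RingQuot.liftAlgHom_mkAlgHom_apply ℂ _ _ _

/-- The opposite of the complex conjugate of an algebra: algebra morphisms into it are the
conjugate-linear anti-multiplicative maps. -/
def ConjOp (B : Type) : Type := Bᵐᵒᵖ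

instance (B : Type) [Ring B] : Ring (ConjOp B) := inferInstanceAs (Ring Bᵐᵒᵖ)

instance (B : Type) [Ring B] [Algebra ℂ B] : Algebra ℂ (ConjOp B) :=
  RingHom.toAlgebra' ((algebraMap ℂ Bᵐᵒᵖ).comp (starRingEnd ℂ))
    (fun c x => Algebra.commutes (A := Bᵐᵒᵖ) (starRingEnd ℂ c) x)

def ConjOp.op {B : Type} (b : B) : ConjOp B := MulOpposite.op b

def ConjOp.unop {B : Type} (b : ConjOp B) : B := MulOpposite.unop b

theorem ConjOp.algebraMap_unop (B : Type) [Ring B] [Algebra ℂ B] (c : ℂ) :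
    (algebraMap ℂ (ConjOp B) c).unop = algebraMap ℂ B (starRingEnd ℂ c) := rfl

theorem ConjOp.unop_mul {B : Type} [Ring B] (x y : ConjOp B) :
    (x * y).unop = y.unop * x.unop := rfl

theorem ConjOp.unop_add {B : Type} [Ring B] (x y : ConjOp B) :
    (x + y).unop = x.unop + y.unop := rfl

theorem ConjOp.unop_sub {B : Type} [Ring B] (x y : ConjOp B) :
    (x - y).unop = x.unop - y.unop := rfl

theorem ConjOp.unop_one {B : Type} [Ring B] : (1 : ConjOp B).unop = 1 := rfl

theorem ConjOp.unop_op {B : Type} (b : B) : (ConjOp.op b).unop = b := rfl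

theorem ConjOp.unop_pow {B : Type} [Ring B] (x : ConjOp B) (k : ℕ) :
    (x ^ k).unop = x.unop ^ k := MulOpposite.unop_pow _ _

theorem ConjOp.unop_smul {B : Type} [Ring B] [Algebra ℂ B] (z : ℂ) (x : ConjOp B) :
    (z • x).unop = starRingEnd ℂ z • x.unop := by
  rw [Algebra.smul_def, ConjOp.unop_mul, ConjOp.algebraMap_unop, ← Algebra.commutes,
    ← Algebra.smul_def]

theorem ConjOp.ext {B : Type} {x y : ConjOp B} (h : x.unop = y.unop) : x = y :=
  MulOpposite.unop_injective h

/-- The star structure of a presented algebra in which the generator `x` has adjoint `s x`. -/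
abbrev Presented.starRing {rel : FreeAlgebra ℂ X → FreeAlgebra ℂ X → Prop}
    (s : X → Presented rel)
    (h : ∀ x y, rel x y → FreeAlgebra.lift ℂ (fun x => ConjOp.op (s x)) x =
      FreeAlgebra.lift ℂ (fun x => ConjOp.op (s x)) y)
    (hs : ∀ x, (Presented.lift (fun x => ConjOp.op (s x)) h (s x)).unop = Presented.gen rel x) :
    StarRing (Presented rel) where
  star b := (Presented.lift (fun x => ConjOp.op (s x)) h b).unop
  star_involutive b := by
    obtain ⟨p, rfl⟩ := RingQuot.mkAlgHom_surjective ℂ rel b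
    induction p using FreeAlgebra.induction with
    | grade0 c =>
      simp only [AlgHom.commutes, ConjOp.algebraMap_unop, Complex.conj_conj]
    | grade1 x =>
      refine Eq.trans (congrArg (fun y => (Presented.lift _ h (ConjOp.unop y)).unop) ?_) (hs x)
      exact (Presented.lift_mk _ h _).trans (FreeAlgebra.lift_ι_apply _ _)
    | mul x y hx hy => simp only [map_mul, ConjOp.unop_mul, hx, hy]
    | add x y hx hy => simp only [map_add, ConjOp.unop_add, hx, hy]
  star_mul x y := by
    simp only [map_mul]; rfl
  star_add x y := by
    simp only [map_add]; rfl

end Presented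

/-! ### The quantum group `SU_q(2)` -/

section SUq

/-- The generators `a, a*, c, c*`. -/
inductive SUGen : Type
  | a | a' | c | c'

/-- The relations `u u* = 1 = u* u` for `u = (a, -q c*; c, a*)`. -/
inductive SURel (q : ℂ) : FreeAlgebra ℂ SUGen → FreeAlgebra ℂ SUGen → Prop
  | uu11 : SURel q (.ι ℂ .a * .ι ℂ .a' + q ^ 2 • (.ι ℂ .c' * .ι ℂ .c)) 1
  | uu12 : SURel q (.ι ℂ .a * .ι ℂ .c') (q • (.ι ℂ .c' * .ι ℂ .a))
  | uu21 : SURel q (.ι ℂ .c * .ι ℂ .a') (q • (.ι ℂ .a' * .ι ℂ .c))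
  | uu22 : SURel q (.ι ℂ .c * .ι ℂ .c' + .ι ℂ .a' * .ι ℂ .a) 1
  | u'u11 : SURel q (.ι ℂ .a' * .ι ℂ .a + .ι ℂ .c' * .ι ℂ .c) 1
  | u'u12 : SURel q (.ι ℂ .c' * .ι ℂ .a') (q • (.ι ℂ .a' * .ι ℂ .c'))
  | u'u21 : SURel q (.ι ℂ .a * .ι ℂ .c) (q • (.ι ℂ .c * .ι ℂ .a))
  | u'u22 : SURel q (q ^ 2 • (.ι ℂ .c * .ι ℂ .c') + .ι ℂ .a * .ι ℂ .a') 1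

variable (q : Set.Ioo (0 : ℝ) 1)

/-- The deformation parameter as a complex number. -/
def qc : ℂ := ((q : ℝ) : ℂ)

theorem qc_ne_zero : qc q ≠ 0 := Complex.ofReal_ne_zero.mpr q.2.1.ne'

/-- The polynomial algebra of `SU_q(2)`. -/
def SUq : Type := Presented (SURel (qc q))

instance : Ring (SUq q) := inferInstanceAs (Ring (RingQuot (SURel (qc q))))
instance : Algebra ℂ (SUq q) := inferInstanceAs (Algebra ℂ (RingQuot (SURel (qc q))))

namespace SUq

def a : SUq q := Presented.gen (SURel (qc q)) .a
def a' : SUq q := Presented.gen (SURel (qc q)) .a'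
def c : SUq q := Presented.gen (SURel (qc q)) .c
def c' : SUq q := Presented.gen (SURel (qc q)) .c'

/-- Images of the generators as a function on `SUGen`. -/
def vals {B : Type} (A A' C C' : B) : SUGen → B
  | .a => A | .a' => A' | .c => C | .c' => C'

theorem vals_rel {t : ℂ} {B : Type} [Ring B] [Algebra ℂ B] {A A' C C' : B}
    (h1 : A * A' + t ^ 2 • (C' * C) = 1) (h2 : A * C' = t • (C' * A))
    (h3 : C * A' = t • (A' * C)) (h4 : C * C' = C' * C)
    (h5 : A' * A + C' * C = 1) (h6 : C' * A' = t • (A' * C'))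
    (h7 : A * C = t • (C * A)) (x y : FreeAlgebra ℂ SUGen) (h : SURel t x y) :
    FreeAlgebra.lift ℂ (vals A A' C C') x = FreeAlgebra.lift ℂ (vals A A' C C') y := by
  cases h <;> simp only [map_add, map_mul, map_smul, map_one, FreeAlgebra.lift_ι_apply, vals]
  · exact h1
  · exact h2
  · exact h3
  · rw [h4, add_comm]; exact h5
  · exact h5
  · exact h6
  · exact h7
  · rw [h4, add_comm]; exact h1

variable {q} in
/-- The morphism out of `A(SU_q(2))` with given values on the generators. -/
def lift {B : Type} [Ring B] [Algebra ℂ B] (A A' C C' : B)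
    (h1 : A * A' + qc q ^ 2 • (C' * C) = 1) (h2 : A * C' = qc q • (C' * A))
    (h3 : C * A' = qc q • (A' * C)) (h4 : C * C' = C' * C)
    (h5 : A' * A + C' * C = 1) (h6 : C' * A' = qc q • (A' * C'))
    (h7 : A * C = qc q • (C * A)) : SUq q →ₐ[ℂ] B :=
  Presented.lift (rel := SURel (qc q)) (vals A A' C C') (vals_rel h1 h2 h3 h4 h5 h6 h7)

section relations

theorem rel1 : a q * a' q + qc q ^ 2 • (c' q * c q) = 1 := by
  have := RingQuot.mkAlgHom_rel ℂ (SURel.uu11 (q := qc q))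
  simp only [map_add, map_mul, map_smul, map_one] at this
  exact this

theorem rel2 : a q * c' q = qc q • (c' q * a q) := by
  have := RingQuot.mkAlgHom_rel ℂ (SURel.uu12 (q := qc q))
  simp only [map_add, map_mul, map_smul, map_one] at this
  exact this

theorem rel3 : c q * a' q = qc q • (a' q * c q) := by
  have := RingQuot.mkAlgHom_rel ℂ (SURel.uu21 (q := qc q))
  simp only [map_add, map_mul, map_smul, map_one] at this
  exact this

theorem rel5 : a' q * a q + c' q * c q = 1 := by
  have := RingQuot.mkAlgHom_rel ℂ (SURel.u'u11 (q := qc q))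
  simp only [map_add, map_mul, map_smul, map_one] at this
  exact this

theorem rel4 : c q * c' q = c' q * c q := by
  have := RingQuot.mkAlgHom_rel ℂ (SURel.uu22 (q := qc q))
  have h : c q * c' q + a' q * a q = 1 := by
    simp only [map_add, map_mul, map_smul, map_one] at this
    exact this
  have h5 := rel5 q
  rw [add_comm, ← h5] at h
  exact add_left_cancel h

theorem rel6 : c' q * a' q = qc q • (a' q * c' q) := by
  have := RingQuot.mkAlgHom_rel ℂ (SURel.u'u12 (q := qc q))
  simp only [map_add, map_mul, map_smul, map_one] at this
  exact this

theorem rel7 : a q * c q = qc q • (c q * a q) := by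
  have := RingQuot.mkAlgHom_rel ℂ (SURel.u'u21 (q := qc q))
  simp only [map_add, map_mul, map_smul, map_one] at this
  exact this

end relations

theorem conj_rel (x y : FreeAlgebra ℂ SUGen) (h : SURel (qc q) x y) :
    FreeAlgebra.lift ℂ (fun x => ConjOp.op (vals (a' q) (a q) (c' q) (c q) x)) x =
      FreeAlgebra.lift ℂ (fun x => ConjOp.op (vals (a' q) (a q) (c' q) (c q) x)) y := by
  have hq : (starRingEnd ℂ) (qc q) = qc q := Complex.conj_ofReal _
  have hv : (fun x => ConjOp.op (vals (a' q) (a q) (c' q) (c q) x)) =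
      vals (ConjOp.op (a' q)) (ConjOp.op (a q)) (ConjOp.op (c' q)) (ConjOp.op (c q)) := by
    funext x; cases x <;> rfl
  rw [hv]
  refine vals_rel ?_ ?_ ?_ ?_ ?_ ?_ ?_ x y h <;> apply ConjOp.ext <;>
    simp only [ConjOp.unop_add, ConjOp.unop_mul, ConjOp.unop_smul, map_pow, hq]
  · exact rel1 q
  · exact rel3 q
  · exact rel2 q
  · exact rel4 q
  · exact rel5 q
  · exact rel7 q
  · exact rel6 q

/-- The star structure: `a* = a'` and `c* = c'`. -/
instance : StarRing (SUq q) :=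
  Presented.starRing (rel := SURel (qc q)) (vals (a' q) (a q) (c' q) (c q)) (conj_rel q)
    (by
      intro x
      cases x <;> exact congrArg ConjOp.unop
        ((Presented.lift_mk _ _ _).trans (FreeAlgebra.lift_ι_apply _ _)))

instance : StarModule ℂ (SUq q) where
  star_smul z x := by
    refine Eq.trans (congrArg ConjOp.unop (map_smul (Presented.lift _ (conj_rel q)) z x)) ?_
    exact ConjOp.unop_smul z _

end SUq

end SUq

/-! ### Exterior algebras generated by one-forms -/

section Ext

/-- Structure constants of an exterior algebra over `A` with basic one-forms `ω_0, …, ω_{n-1}`: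
the bimodule relations are `x ω_i = ω_i κ^{w i}(x)`, and the exchange relations are
`ω_i ∧ ω_i = 0` and `ω_i ∧ ω_j = cf i j • ω_j ∧ ω_i` for `j < i`. -/
structure ExtData (A : Type) [Ring A] [Algebra ℂ A] (n : ℕ) where
  κ : A →ₐ[ℂ] A
  w : Fin n → ℕ
  cf : Fin n → Fin n → ℂ

variable {A : Type} [Ring A] [Algebra ℂ A] {n : ℕ}

/-- `κ^{w(T)}`, so that `x ω_T = ω_T κ^{w(T)}(x)`. -/
def ExtData.tw (D : ExtData A n) (T : Finset (Fin n)) : A →ₐ[ℂ] A := D.κ ^ (∑ i ∈ T, D.w i)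

/-- The scalar with `ω_S ∧ ω_T = sgn S T • ω_{S ∪ T}` for disjoint `S` and `T`. -/
def ExtData.sgn (D : ExtData A n) (S T : Finset (Fin n)) : ℂ :=
  ∏ i ∈ S, ∏ j ∈ T, if j < i then D.cf i j else 1

/-- The exterior algebra: the free right `A`-module on the monomials
`ω_S = ω_{i_1} ∧ … ∧ ω_{i_k}`, `S = {i_1 < … < i_k}`. The function `f` stands for the form
`∑_S ω_S f(S)`. -/
@[ext] structure Ext (D : ExtData A n) : Type where
  coef : Finset (Fin n) → A

namespace Ext

variable {D : ExtData A n}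

def equiv (D : ExtData A n) : Ext D ≃ (Finset (Fin n) → A) where
  toFun := coef
  invFun := mk
  left_inv _ := rfl
  right_inv _ := rfl

instance : AddCommGroup (Ext D) := (equiv D).addCommGroup
instance : Module ℂ (Ext D) := (equiv D).module ℂ

@[simp] theorem coef_zero (S : Finset (Fin n)) : (0 : Ext D).coef S = 0 := rfl
@[simp] theorem coef_add (f g : Ext D) (S : Finset (Fin n)) :
    (f + g).coef S = f.coef S + g.coef S := rfl
@[simp] theorem coef_smul (z : ℂ) (f : Ext D) (S : Finset (Fin n)) :
    (z • f).coef S = z • f.coef S := rfl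

instance : One (Ext D) := ⟨⟨fun S => if S = ∅ then 1 else 0⟩⟩

/-- `(ω_S x) ∧ (ω_R y) = (ω_S ∧ ω_R) κ^{w(R)}(x) y`. -/
instance : Mul (Ext D) :=
  ⟨fun f g => ⟨fun T => ∑ S ∈ T.powerset,
    D.sgn S (T \ S) • (D.tw (T \ S) (f.coef S) * g.coef (T \ S))⟩⟩

theorem coef_one (S : Finset (Fin n)) : (1 : Ext D).coef S = if S = ∅ then 1 else 0 := rfl

theorem coef_mul (f g : Ext D) (T : Finset (Fin n)) : (f * g).coef T = ∑ S ∈ T.powerset,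
    D.sgn S (T \ S) • (D.tw (T \ S) (f.coef S) * g.coef (T \ S)) := rfl

theorem tw_empty : D.tw ∅ = 1 := by simp [ExtData.tw]

theorem tw_union {S T : Finset (Fin n)} (h : Disjoint S T) (x : A) :
    D.tw (S ∪ T) x = D.tw S (D.tw T x) := by
  rw [ExtData.tw, Finset.sum_union h, pow_add]; rfl

theorem sgn_empty_left (T : Finset (Fin n)) : D.sgn ∅ T = 1 := by simp [ExtData.sgn]

theorem sgn_empty_right (T : Finset (Fin n)) : D.sgn T ∅ = 1 := by simp [ExtData.sgn]

theorem sgn_union_left {S T : Finset (Fin n)} (h : Disjoint S T) (R : Finset (Fin n)) :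
    D.sgn (S ∪ T) R = D.sgn S R * D.sgn T R := by
  rw [ExtData.sgn, Finset.prod_union h]; rfl

theorem sgn_union_right {S T : Finset (Fin n)} (h : Disjoint S T) (R : Finset (Fin n)) :
    D.sgn R (S ∪ T) = D.sgn R S * D.sgn R T := by
  simp only [ExtData.sgn, Finset.prod_union h, Finset.prod_mul_distrib]

theorem mul_assoc' (f g h : Ext D) : f * g * h = f * (g * h) := by
  ext T
  simp only [coef_mul, map_sum, Finset.sum_mul, Finset.mul_sum, Finset.smul_sum, map_smul, map_mul,
    smul_mul_assoc, mul_smul_comm, smul_smul]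
  rw [Finset.sum_sigma', Finset.sum_sigma']
  refine Finset.sum_bij' (fun p _ => ⟨p.2, p.1 \ p.2⟩) (fun p _ => ⟨p.1 ∪ p.2, p.1⟩) ?_ ?_ ?_ ?_ ?_
  · rintro ⟨S, U⟩ hp
    simp only [Finset.mem_sigma, Finset.mem_powerset] at hp ⊢
    exact ⟨hp.2.trans hp.1, Finset.sdiff_subset_sdiff hp.1 subset_rfl⟩
  · rintro ⟨S, U⟩ hp
    simp only [Finset.mem_sigma, Finset.mem_powerset] at hp ⊢
    exact ⟨Finset.union_subset hp.1 (hp.2.trans Finset.sdiff_subset), Finset.subset_union_left⟩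
  · rintro ⟨S, U⟩ hp
    simp only [Finset.mem_sigma, Finset.mem_powerset] at hp
    simp [Finset.union_sdiff_of_subset hp.2]
  · rintro ⟨S, U⟩ hp
    simp only [Finset.mem_sigma, Finset.mem_powerset] at hp
    have : Disjoint S U := (Finset.disjoint_of_subset_left hp.2 Finset.sdiff_disjoint).symm
    simp [Finset.union_sdiff_cancel_left this]
  · rintro ⟨S, U⟩ hp
    simp only [Finset.mem_sigma, Finset.mem_powerset] at hp
    have e1 : (T \ U) \ (S \ U) = T \ S := by
      ext i; have := @hp.2 i; simp only [Finset.mem_sdiff]; tauto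
    have e2 : T \ U = (T \ S) ∪ (S \ U) := by
      ext i; have := @hp.2 i; have := @hp.1 i
      simp only [Finset.mem_sdiff, Finset.mem_union]; tauto
    have d2 : Disjoint (T \ S) (S \ U) :=
      Finset.disjoint_of_subset_right Finset.sdiff_subset Finset.sdiff_disjoint
    have e3 : S = U ∪ (S \ U) := (Finset.union_sdiff_of_subset hp.2).symm
    have c1 : D.sgn S (T \ S) = D.sgn U (T \ S) * D.sgn (S \ U) (T \ S) := by
      conv_lhs => rw [e3]
      rw [sgn_union_left Finset.disjoint_sdiff, ← e3]
    have c2 : D.sgn U (T \ U) = D.sgn U (T \ S) * D.sgn U (S \ U) := by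
      rw [e2, sgn_union_right d2]
    have c3 : D.tw (T \ U) (f.coef U) = D.tw (T \ S) (D.tw (S \ U) (f.coef U)) := by
      rw [e2, tw_union d2]
    simp only [e1, c1, c2, c3, mul_assoc]
    congr 1
    ring

theorem one_mul' (f : Ext D) : 1 * f = f := by
  ext T
  rw [coef_mul, Finset.sum_eq_single ∅]
  · simp [coef_one, sgn_empty_left]
  · intro S _ hS; simp [coef_one, hS]
  · simp

theorem mul_one' (f : Ext D) : f * 1 = f := by
  ext T
  rw [coef_mul, Finset.sum_eq_single T]
  · simp [coef_one, sgn_empty_right, tw_empty]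
  · intro S hS h
    have : T \ S ≠ ∅ := fun e =>
      h (subset_antisymm (Finset.mem_powerset.1 hS) (Finset.sdiff_eq_empty_iff_subset.1 e))
    simp [coef_one, this]
  · simp

instance : Ring (Ext D) where
  __ := (inferInstance : AddCommGroup (Ext D))
  mul_assoc := mul_assoc'
  one_mul := one_mul'
  mul_one := mul_one'
  zero_mul f := by ext T; simp [coef_mul]
  mul_zero f := by ext T; simp [coef_mul]
  left_distrib f g h := by
    ext T; simp only [coef_mul, coef_add, mul_add, smul_add, Finset.sum_add_distrib]
  right_distrib f g h := by
    ext T; simp only [coef_mul, coef_add, map_add, add_mul, smul_add, Finset.sum_add_distrib]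

instance : Algebra ℂ (Ext D) :=
  Algebra.ofModule
    (fun z f g => by
      ext T; simp only [coef_mul, coef_smul, map_smul, smul_mul_assoc, Finset.smul_sum, smul_smul,
        mul_comm])
    (fun z f g => by
      ext T; simp only [coef_mul, coef_smul, mul_smul_comm, Finset.smul_sum, smul_smul,
        mul_comm])

/-- The form `ω_S x`. -/
def monomial (S : Finset (Fin n)) (x : A) : Ext D := ⟨fun T => if T = S then x else 0⟩

/-- The basic one-form `ω_i`. -/
def ω (i : Fin n) : Ext D := monomial {i} 1

/-- The inclusion of functions as forms of degree zero. -/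
def incl : A →ₗ[ℂ] Ext D where
  toFun x := monomial ∅ x
  map_add' x y := by ext T; by_cases h : T = ∅ <;> simp [monomial, h]
  map_smul' z x := by ext T; by_cases h : T = ∅ <;> simp [monomial, h]

/-- The forms of degree `k`. -/
def gr (D : ExtData A n) (k : ℕ) : Submodule ℂ (Ext D) where
  carrier := {f | ∀ S : Finset (Fin n), S.card ≠ k → f.coef S = 0}
  zero_mem' _ _ := rfl
  add_mem' hf hg S hS := by simp [hf S hS, hg S hS]
  smul_mem' z f hf S hS := by simp [hf S hS]

instance : SetLike.GradedMonoid (gr D) where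
  one_mem S hS := by
    have : S ≠ ∅ := fun h => hS (by simp [h])
    simp [coef_one, this]
  mul_mem k l f g hf hg T hT := by
    rw [coef_mul]
    refine Finset.sum_eq_zero fun S hS => ?_
    have hc := Finset.card_sdiff_add_card_eq_card (Finset.mem_powerset.1 hS)
    by_cases h : S.card = k
    · rw [hg (T \ S) (by omega), mul_zero, smul_zero]
    · rw [hf S h, map_zero, zero_mul, smul_zero]

/-- The homogeneous component of degree `k`. -/
def comp (k : ℕ) : Ext D →+ gr D k where
  toFun f := ⟨⟨fun S => if S.card = k then f.coef S else 0⟩, fun S hS => by simp [hS]⟩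
  map_zero' := by ext S; simp
  map_add' f g := by
    ext S; by_cases h : S.card = k <;> simp [h]

theorem coef_comp (k : ℕ) (f : Ext D) (S : Finset (Fin n)) :
    (comp k f : Ext D).coef S = if S.card = k then f.coef S else 0 := rfl

theorem coef_sum {ι : Type} (s : Finset ι) (f : ι → Ext D) (S : Finset (Fin n)) :
    (∑ k ∈ s, f k).coef S = ∑ k ∈ s, (f k).coef S :=
  map_sum (⟨⟨fun f => f.coef S, rfl⟩, fun _ _ => rfl⟩ : Ext D →+ A) f s

instance : DirectSum.Decomposition (gr D) :=
  DirectSum.Decomposition.ofAddHom (gr D)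
    (∑ k ∈ Finset.range (n + 1), (DirectSum.of (fun k => gr D k) k).comp (comp k))
    (by
      ext f S
      have hS : S.card < n + 1 := Nat.lt_succ_of_le (by simpa using Finset.card_le_univ S)
      simp only [AddMonoidHom.comp_apply, AddMonoidHom.finsetSum_apply, map_sum,
        DirectSum.coeAddMonoidHom_of, coef_sum, coef_comp, AddMonoidHom.id_apply]
      rw [Finset.sum_ite_eq, if_pos (Finset.mem_range.2 hS)])
    (by
      ext j g : 2
      have h0 : ∀ k, k ≠ j → comp k (g : Ext D) = 0 := by
        intro k hk
        ext S
        rw [coef_comp]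
        split_ifs with h
        · exact g.2 S (h ▸ hk)
        · rfl
      have h1 : comp j (g : Ext D) = g := by
        ext S
        rw [coef_comp]
        split_ifs with h
        · rfl
        · exact (g.2 S h).symm
      simp only [AddMonoidHom.comp_apply, AddMonoidHom.finsetSum_apply,
        DirectSum.coeAddMonoidHom_of, AddMonoidHom.id_apply]
      rw [Finset.sum_eq_single j, h1]
      · intro k _ hk; rw [h0 k hk, map_zero]
      · intro hj
        have : comp j (g : Ext D) = 0 := by
          ext S
          rw [coef_comp, if_neg]
          · rfl
          · intro h
            have : S.card ≤ n := by simpa using Finset.card_le_univ S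
            exact hj (Finset.mem_range.2 (by omega))
        have hg : g = 0 := h1.symm.trans this
        rw [hg]
        simp)

instance : GradedAlgebra (gr D) where

end Ext

end Ext

/-! ### Differential calculi with a Hermitian structure, Hodge duality, Yang-Mills equations -/

section Calculus

/-- The operations of a differential `*`-calculus `(Ω, d)` of dimension `dim` over a `*`-algebra
`A`, graded by `gr`, with a Hermitian structure on forms (for which distinct degrees are
orthogonal) and a volume form. -/
structure HermCalculus (A Ω : Type) [Ring A] [Algebra ℂ A] [Ring Ω] [Algebra ℂ Ω]
    (gr : ℕ → Submodule ℂ Ω) where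
  /-- the dimension -/
  dim : ℕ
  /-- the inclusion of functions as forms of degree zero -/
  incl : A →ₗ[ℂ] Ω
  /-- the exterior differential -/
  d : Ω →ₗ[ℂ] Ω
  /-- the graded involution -/
  conj : Ω →ₗ⋆[ℂ] Ω
  /-- the Hermitian structure, conjugate-linear in the first argument -/
  herm : Ω →ₗ⋆[ℂ] Ω →ₗ[ℂ] A
  /-- the volume form -/
  vol : Ω

variable {A Ω : Type} [Ring A] [Algebra ℂ A] [Ring Ω] [Algebra ℂ Ω] {gr : ℕ → Submodule ℂ Ω}

namespace HermCalculus

variable (C : HermCalculus A Ω gr)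

/-- `s` is the Hodge duality operator: it maps `k`-forms to `(dim - k)`-forms and
`τ (s α, β) = α* ∧ β`. -/
structure IsHodge (s : Ω →ₗ[ℂ] Ω) : Prop where
  map_mem : ∀ k ≤ C.dim, ∀ α ∈ gr k, s α ∈ gr (C.dim - k)
  vol_mul : ∀ k ≤ C.dim, ∀ α ∈ gr k, ∀ β ∈ gr (C.dim - k),
    C.vol * C.incl (C.herm (s α) β) = C.conj α * β

/-- The connection `∇ = d + α` on the free module `A^N`, acting on `A^N ⊗ Ω = Ω^N`. -/
def connection {N : ℕ} (α : Matrix (Fin N) (Fin N) Ω) (η : Fin N → Ω) : Fin N → Ω :=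
  (fun i => C.d (η i)) + α *ᵥ η

/-- The matrix `F` of two-forms is the curvature `∇²` of the connection `∇ = d + α`. -/
structure IsCurvature {N : ℕ} (α F : Matrix (Fin N) (Fin N) Ω) : Prop where
  mem : ∀ i j, F i j ∈ gr 2
  sq : ∀ η, C.connection α (C.connection α η) = F *ᵥ η

/-- The graded commutator `[∇, G]` for a matrix `G` of `k`-forms, as an operator on `Ω^N`. -/
def covDeriv {N : ℕ} (α : Matrix (Fin N) (Fin N) Ω) (k : ℕ) (G : Matrix (Fin N) (Fin N) Ω)
    (η : Fin N → Ω) : Fin N → Ω :=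
  C.connection α (G *ᵥ η) - (-1 : ℂ) ^ k • (G *ᵥ C.connection α η)

/-- The connection `∇ = d + α` has a curvature `F`, and solves the Yang-Mills equation
`[∇, ⋆F] = 0` with respect to the operator `s` on forms, applied entrywise. -/
def SolvesYangMills {N : ℕ} (s : Ω →ₗ[ℂ] Ω) (α : Matrix (Fin N) (Fin N) Ω) : Prop :=
  ∃ F, C.IsCurvature α F ∧ ∀ η, C.covDeriv α (C.dim - 2) (F.map s) η = 0

end HermCalculus

end Calculus

/-! ### Warped products -/

section Warped

open DirectSum

variable {A₁ Ω₁ A₂ Ω₂ : Type} [Ring A₁] [Algebra ℂ A₁] [Ring Ω₁] [Algebra ℂ Ω₁]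
  [Ring A₂] [Algebra ℂ A₂] [Ring Ω₂] [Algebra ℂ Ω₂]
  {G₁ : ℕ → Submodule ℂ Ω₁} {G₂ : ℕ → Submodule ℂ Ω₂} [GradedAlgebra G₁] [GradedAlgebra G₂]

/-- The grading of the tensor product of two graded algebras. -/
def prodGr (G₁ : ℕ → Submodule ℂ Ω₁) (G₂ : ℕ → Submodule ℂ Ω₂) [GradedAlgebra G₁]
    [GradedAlgebra G₂] (m : ℕ) : Submodule ℂ (G₁ ᵍ⊗[ℂ] G₂) :=
  Submodule.span ℂ {ξ | ∃ i j, i + j = m ∧ ∃ ξ₁ ∈ G₁ i, ∃ ξ₂ ∈ G₂ j, ξ = ξ₁ ᵍ⊗ₜ[ℂ] ξ₂}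

/-- The grading operator `ξ ↦ (-1)^{deg ξ} ξ` on forms of degree at most `N`. -/
def gradeSign (G₁ : ℕ → Submodule ℂ Ω₁) [GradedAlgebra G₁] (N : ℕ) : Ω₁ →ₗ[ℂ] Ω₁ :=
  ∑ k ∈ Finset.range (N + 1), (-1 : ℂ) ^ k • GradedAlgebra.proj G₁ k

/-- The sesquilinear map `(x, y) ↦ h (f x) (f y)`. -/
def sesqComp {M N B : Type} [AddCommGroup M] [Module ℂ M] [AddCommGroup N] [Module ℂ N]
    [AddCommGroup B] [Module ℂ B] (h : N →ₗ⋆[ℂ] N →ₗ[ℂ] B) (f : M →ₗ[ℂ] N) :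
    M →ₗ⋆[ℂ] M →ₗ[ℂ] B :=
  LinearMap.mk₂'ₛₗ (starRingEnd ℂ) (RingHom.id ℂ) (fun x y => h (f x) (f y))
    (fun x x' y => by simp) (fun z x y => by simp) (fun x y y' => by simp) (fun z x y => by simp)

/-- The sesquilinear map `(x, y) ↦ g (h x y)`. -/
def sesqPost {N B B' : Type} [AddCommGroup N] [Module ℂ N] [AddCommGroup B] [Module ℂ B]
    [AddCommGroup B'] [Module ℂ B'] (h : N →ₗ⋆[ℂ] N →ₗ[ℂ] B) (g : B →ₗ[ℂ] B') :
    N →ₗ⋆[ℂ] N →ₗ[ℂ] B' :=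
  LinearMap.mk₂'ₛₗ (starRingEnd ℂ) (RingHom.id ℂ) (fun x y => g (h x y))
    (fun x x' y => by simp) (fun z x y => by simp) (fun x y y' => by simp) (fun z x y => by simp)

/-- The warped product of two calculi with Hermitian structures, with warping elements `ρ k`.
The forms are the graded tensor product,
`d (ξ₁ ⊗ ξ₂) = d ξ₁ ⊗ ξ₂ + (-1)^{deg ξ₁} ξ₁ ⊗ d ξ₂`, `(ξ₁ ⊗ ξ₂)* = ξ₁* ⊗ ξ₂*`,
`(ξ₁ ⊗ ξ₂, η₁ ⊗ η₂) = ρ_k^{-2} (ξ₁, η₁) ⊗ (ξ₂, η₂)` for `ξ₂`, `η₂` of degree `k`, and the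
volume form is `τ₁ ρ_{n₂} ⊗ τ₂`. -/
def warpedProduct (C₁ : HermCalculus A₁ Ω₁ G₁) (C₂ : HermCalculus A₂ Ω₂ G₂) (ρ : ℕ → A₁ˣ) :
    HermCalculus (A₁ ⊗[ℂ] A₂) (G₁ ᵍ⊗[ℂ] G₂) (prodGr G₁ G₂) where
  dim := C₁.dim + C₂.dim
  incl := (GradedTensorProduct.of ℂ G₁ G₂).toLinearMap ∘ₗ TensorProduct.map C₁.incl C₂.incl
  d := (GradedTensorProduct.of ℂ G₁ G₂).toLinearMap ∘ₗ
    (TensorProduct.map C₁.d LinearMap.id + TensorProduct.map (gradeSign G₁ C₁.dim) C₂.d) ∘ₗ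
      (GradedTensorProduct.of ℂ G₁ G₂).symm.toLinearMap
  conj := (GradedTensorProduct.of ℂ G₁ G₂).toLinearMap.comp
    ((TensorProduct.map C₁.conj C₂.conj).comp (GradedTensorProduct.of ℂ G₁ G₂).symm.toLinearMap)
  herm := ∑ k ∈ Finset.range (C₂.dim + 1), sesqComp
    (TensorProduct.map₂
      (sesqPost C₁.herm (LinearMap.mulLeft ℂ ((((ρ k)⁻¹ : A₁ˣ) : A₁) ^ 2)))
      (sesqComp C₂.herm (GradedAlgebra.proj G₂ k)))
    (GradedTensorProduct.of ℂ G₁ G₂).symm.toLinearMap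
  vol := (C₁.vol * C₁.incl (ρ C₂.dim)) ᵍ⊗ₜ[ℂ] C₂.vol

end Warped

/-! ### The calculi on the exterior algebras -/

section ExtCalculus

variable {A : Type} [Ring A] [Algebra ℂ A] [StarRing A] [StarModule ℂ A] {n : ℕ}

open Ext

/-- The adjoint of the monomial `ω_S = ω_{i_1} ∧ … ∧ ω_{i_k}`, that is
`(-1)^{k(k-1)/2} ω_{i_k}* ∧ … ∧ ω_{i_1}*`, where `ω_i* = s i`. -/
def Ext.conjMonomial {D : ExtData A n} (s : Fin n → Ext D) (S : Finset (Fin n)) : Ext D :=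
  (-1 : ℂ) ^ (S.card * (S.card - 1) / 2) • (((S.sort (· ≤ ·)).map s).reverse).prod

/-- The calculus on an exterior algebra determined by the differential `d₀` of functions, the
differentials `m i` of the basic one-forms `ω_i` (basic forms of higher degree being closed),
the adjoints `s i` of the `ω_i`, and the numbers `g S = (ω_S, ω_S)` (distinct monomials `ω_S`
being orthogonal); the volume form is `ω_0 ∧ … ∧ ω_{n-1}`. -/
def extCalculus (D : ExtData A n) (d₀ : A →ₗ[ℂ] Ext D) (m s : Fin n → Ext D)
    (g : Finset (Fin n) → ℂ) : HermCalculus A (Ext D) (gr D) where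
  dim := n
  incl := incl
  d :=
    { toFun := fun f => ∑ i, m i * incl (f.coef {i}) +
        ∑ S : Finset (Fin n), (-1 : ℂ) ^ S.card • (monomial S 1 * d₀ (f.coef S))
      map_add' := fun f h => by
        simp only [coef_add, map_add, mul_add, smul_add, Finset.sum_add_distrib]; abel
      map_smul' := fun z f => by
        simp only [coef_smul, map_smul, mul_smul_comm, smul_add, Finset.smul_sum, smul_smul,
          mul_comm, RingHom.id_apply] }
  conj :=
    { toFun := fun f => ∑ S : Finset (Fin n), incl (star (f.coef S)) * conjMonomial s S
      map_add' := fun f h => by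
        simp only [coef_add, star_add, map_add, add_mul, Finset.sum_add_distrib]
      map_smul' := fun z f => by
        simp only [coef_smul, star_smul, map_smul, smul_mul_assoc, Finset.smul_sum]; rfl }
  herm := LinearMap.mk₂'ₛₗ (starRingEnd ℂ) (RingHom.id ℂ)
    (fun f h => ∑ S : Finset (Fin n), g S • (star (f.coef S) * h.coef S))
    (fun f f' h => by
      simp only [coef_add, star_add, add_mul, smul_add, Finset.sum_add_distrib])
    (fun z f h => by
      simp only [coef_smul, star_smul, smul_mul_assoc, Finset.smul_sum, smul_smul,
        mul_comm]; rfl)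
    (fun f h h' => by simp only [coef_add, mul_add, smul_add, Finset.sum_add_distrib])
    (fun z f h => by
      simp only [coef_smul, mul_smul_comm, Finset.smul_sum, smul_smul, mul_comm,
        RingHom.id_apply])
  vol := monomial Finset.univ 1

end ExtCalculus

/-! ### The three-dimensional calculus on `SU_q(2)` -/

section SUqCalculus

variable (q : Set.Ioo (0 : ℝ) 1)

namespace SUq

open Ext

/-- The automorphism `a ↦ t a`, `c ↦ t c`, `a* ↦ t⁻¹ a*`, `c* ↦ t⁻¹ c*`. For `t = q^{-1/2}` this
is the action of `K` on `A(SU_q(2))`. -/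
def scale (t : ℂˣ) : SUq q →ₐ[ℂ] SUq q :=
  lift ((t : ℂ) • a q) (((t⁻¹ : ℂˣ) : ℂ) • a' q) ((t : ℂ) • c q) (((t⁻¹ : ℂˣ) : ℂ) • c' q)
    (by simpa [smul_smul] using rel1 q)
    (by simpa [smul_smul] using rel2 q)
    (by simpa [smul_smul] using rel3 q)
    (by simpa [smul_smul] using rel4 q)
    (by simpa [smul_smul] using rel5 q)
    (by rw [smul_mul_smul_comm, rel6, smul_mul_smul_comm, smul_comm])
    (by rw [smul_mul_smul_comm, rel7, smul_mul_smul_comm, smul_comm])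

theorem nf1 : a q * a' q = 1 - qc q ^ 2 • (c' q * c q) := eq_sub_of_add_eq (rel1 q)

theorem nf5 : a' q * a q = 1 - c' q * c q := eq_sub_of_add_eq (rel5 q)

/-- The deformation parameter as a unit. -/
def qu : ℂˣ := Units.mk0 (qc q) (qc_ne_zero q)

/-- The action of `X_+`: the linear map with `X_+(x y) = X_+(x) K²(y) + x X_+(y)` and
`X_+(a) = -q c*`, `X_+(c) = a*`, `X_+(a*) = X_+(c*) = 0`, where `K²` is `scale q⁻¹`.
It is the upper right entry of `x ↦ (x, X_+(x); 0, K²(x))`. -/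
def XplusHom : SUq q →ₐ[ℂ] Matrix (Fin 2) (Fin 2) (SUq q) :=
  lift !![a q, -(qc q • c' q); 0, (qc q)⁻¹ • a q] !![a' q, 0; 0, qc q • a' q]
    !![c q, a' q; 0, (qc q)⁻¹ • c q] !![c' q, 0; 0, qc q • c' q]
    (by
      have hq := qc_ne_zero q
      ext i j; fin_cases i <;> fin_cases j <;>
        simp [smul_smul, mul_smul_comm, smul_mul_assoc, rel2, rel3, rel4, rel6, rel7, nf1, nf5, smul_sub] <;>
        match_scalars <;> field_simp <;> ring)
    (by
      have hq := qc_ne_zero q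
      ext i j; fin_cases i <;> fin_cases j <;>
        simp [smul_smul, mul_smul_comm, smul_mul_assoc, rel2, rel3, rel4, rel6, rel7, nf1, nf5, smul_sub] <;>
        match_scalars <;> field_simp <;> ring)
    (by
      have hq := qc_ne_zero q
      ext i j; fin_cases i <;> fin_cases j <;>
        simp [smul_smul, mul_smul_comm, smul_mul_assoc, rel2, rel3, rel4, rel6, rel7, nf1, nf5, smul_sub] <;>
        match_scalars <;> field_simp <;> ring)
    (by
      have hq := qc_ne_zero q
      ext i j; fin_cases i <;> fin_cases j <;>
        simp [smul_smul, mul_smul_comm, smul_mul_assoc, rel2, rel3, rel4, rel6, rel7, nf1, nf5, smul_sub] <;>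
        match_scalars <;> field_simp <;> ring)
    (by
      have hq := qc_ne_zero q
      ext i j; fin_cases i <;> fin_cases j <;>
        simp [smul_smul, mul_smul_comm, smul_mul_assoc, rel2, rel3, rel4, rel6, rel7, nf1, nf5, smul_sub] <;>
        match_scalars <;> field_simp <;> ring)
    (by
      have hq := qc_ne_zero q
      ext i j; fin_cases i <;> fin_cases j <;>
        simp [smul_smul, mul_smul_comm, smul_mul_assoc, rel2, rel3, rel4, rel6, rel7, nf1, nf5, smul_sub] <;>
        match_scalars <;> field_simp <;> ring)
    (by
      have hq := qc_ne_zero q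
      ext i j; fin_cases i <;> fin_cases j <;>
        simp [smul_smul, mul_smul_comm, smul_mul_assoc, rel2, rel3, rel4, rel6, rel7, nf1, nf5, smul_sub] <;>
        match_scalars <;> field_simp <;> ring)

def Xplus : SUq q →ₗ[ℂ] SUq q :=
  (Matrix.entryLinearMap ℂ (SUq q) 0 1) ∘ₗ (XplusHom q).toLinearMap

/-- The action of `X_-`: the linear map with `X_-(x y) = X_-(x) K²(y) + x X_-(y)` and
`X_-(a) = X_-(c) = 0`, `X_-(a*) = c`, `X_-(c*) = -q⁻¹ a`. -/
def XminusHom : SUq q →ₐ[ℂ] Matrix (Fin 2) (Fin 2) (SUq q) :=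
  lift !![a q, 0; 0, (qc q)⁻¹ • a q] !![a' q, c q; 0, qc q • a' q]
    !![c q, 0; 0, (qc q)⁻¹ • c q] !![c' q, -((qc q)⁻¹ • a q); 0, qc q • c' q]
    (by
      have hq := qc_ne_zero q
      ext i j; fin_cases i <;> fin_cases j <;>
        simp [smul_smul, mul_smul_comm, smul_mul_assoc, rel2, rel3, rel4, rel6, rel7, nf1, nf5, smul_sub] <;>
        match_scalars <;> field_simp <;> ring)
    (by
      have hq := qc_ne_zero q
      ext i j; fin_cases i <;> fin_cases j <;>
        simp [smul_smul, mul_smul_comm, smul_mul_assoc, rel2, rel3, rel4, rel6, rel7, nf1, nf5, smul_sub] <;>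
        match_scalars <;> field_simp <;> ring)
    (by
      have hq := qc_ne_zero q
      ext i j; fin_cases i <;> fin_cases j <;>
        simp [smul_smul, mul_smul_comm, smul_mul_assoc, rel2, rel3, rel4, rel6, rel7, nf1, nf5, smul_sub] <;>
        match_scalars <;> field_simp <;> ring)
    (by
      have hq := qc_ne_zero q
      ext i j; fin_cases i <;> fin_cases j <;>
        simp [smul_smul, mul_smul_comm, smul_mul_assoc, rel2, rel3, rel4, rel6, rel7, nf1, nf5, smul_sub] <;>
        match_scalars <;> field_simp <;> ring)
    (by
      have hq := qc_ne_zero q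
      ext i j; fin_cases i <;> fin_cases j <;>
        simp [smul_smul, mul_smul_comm, smul_mul_assoc, rel2, rel3, rel4, rel6, rel7, nf1, nf5, smul_sub] <;>
        match_scalars <;> field_simp <;> ring)
    (by
      have hq := qc_ne_zero q
      ext i j; fin_cases i <;> fin_cases j <;>
        simp [smul_smul, mul_smul_comm, smul_mul_assoc, rel2, rel3, rel4, rel6, rel7, nf1, nf5, smul_sub] <;>
        match_scalars <;> field_simp <;> ring)
    (by
      have hq := qc_ne_zero q
      ext i j; fin_cases i <;> fin_cases j <;>
        simp [smul_smul, mul_smul_comm, smul_mul_assoc, rel2, rel3, rel4, rel6, rel7, nf1, nf5, smul_sub] <;>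
        match_scalars <;> field_simp <;> ring)

def Xminus : SUq q →ₗ[ℂ] SUq q :=
  (Matrix.entryLinearMap ℂ (SUq q) 0 1) ∘ₗ (XminusHom q).toLinearMap

/-- The action of `X_z = (1 - q⁻²)⁻¹ (1 - K⁴)`. -/
def Xz : SUq q →ₗ[ℂ] SUq q :=
  (1 - (qc q)⁻¹ ^ 2)⁻¹ • (LinearMap.id - (scale q ((qu q)⁻¹ ^ 2)).toLinearMap)

/-- The exterior algebra, with `ω_0 = ω_-`, `ω_1 = ω_+`, `ω_2 = ω_z`: the bimodule relations are
`x ω_∓ = ω_∓ κ(x)`, `x ω_z = ω_z κ²(x)` with `κ = K⁻²`, and the exchange relations are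
`ω_+ ω_- = -q² ω_- ω_+`, `ω_z ω_- = -q⁴ ω_- ω_z`, `ω_z ω_+ = -q⁻⁴ ω_+ ω_z`. -/
def extData : ExtData (SUq q) 3 where
  κ := scale q (qu q)
  w := ![1, 1, 2]
  cf := !![0, 1, 1; -(qc q) ^ 2, 0, 1; -(qc q) ^ 4, -(qc q)⁻¹ ^ 4, 0]

/-- The differential forms of Woronowicz' three-dimensional calculus. -/
abbrev Forms : Type := Ext (extData q)

abbrev ωm : Forms q := ω 0
abbrev ωp : Forms q := ω 1
abbrev ωz : Forms q := ω 2

/-- The differential of a function, `d x = ∑_j X_j(x) ω_j`. -/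
def d₀ : SUq q →ₗ[ℂ] Forms q :=
  LinearMap.mulRight ℂ (ωm q) ∘ₗ incl ∘ₗ Xminus q +
  LinearMap.mulRight ℂ (ωp q) ∘ₗ incl ∘ₗ Xplus q +
  LinearMap.mulRight ℂ (ωz q) ∘ₗ incl ∘ₗ Xz q

/-- The Maurer-Cartan equations. -/
def mc : Fin 3 → Forms q :=
  ![((qc q) ^ 2 * (1 + (qc q) ^ 2)) • (ωm q * ωz q),
    -((1 + (qc q)⁻¹ ^ 2) • (ωp q * ωz q)),
    -(ωm q * ωp q)]

/-- The numbers `(ω_S, ω_S)`: `α`, `β`, `γ` for `ω_+`, `ω_-`, `ω_z`, then `1` for `1` and for the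
volume form, and for two-forms `(ω_a ∧ ω_b, ω_a ∧ ω_b) = λ⁻¹ ⟨W (ω_a ⊗ ω_b), W (ω_a ⊗ ω_b)⟩`, where
`λ = 1 + q²`, `W = 1 - σ` is the antisymmetrizer of the braiding `σ`,
`⟨ω_a ⊗ ω_b, ω_c ⊗ ω_d⟩ = -(ω_a, ω_d) (ω_b, ω_c)`, and
`W (ω_- ⊗ ω_+) = q² ω_- ⊗ ω_+ - q⁻² ω_+ ⊗ ω_-`, `W (ω_- ⊗ ω_z) = q² ω_- ⊗ ω_z - q⁻⁴ ω_z ⊗ ω_-`,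
`W (ω_+ ⊗ ω_z) = ω_+ ⊗ ω_z - q⁶ ω_z ⊗ ω_+`. -/
def gram (α β γ : ℝ) (S : Finset (Fin 3)) : ℂ :=
  if S = {0} then β
  else if S = {1} then α
  else if S = {2} then γ
  else if S = {0, 1} then 2 * α * β / (1 + (qc q) ^ 2)
  else if S = {0, 2} then 2 * (qc q)⁻¹ ^ 2 * β * γ / (1 + (qc q) ^ 2)
  else if S = {1, 2} then 2 * (qc q) ^ 6 * α * γ / (1 + (qc q) ^ 2)
  else 1

/-- The three-dimensional `*`-calculus on `SU_q(2)`, with `ω_-* = -ω_+`, `ω_z* = -ω_z`, the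
Hermitian structure given by `α`, `β`, `γ`, and the volume form `ω_- ∧ ω_+ ∧ ω_z`. -/
def calculus (α β γ : ℝ) : HermCalculus (SUq q) (Forms q) (gr (extData q)) :=
  extCalculus (extData q) (d₀ q) (mc q) ![-ωp q, -ωm q, -ωz q] (gram q α β γ)

/-- The gauge potential `ε ∑_j X_j ⊗ ω_j` in the spin `1/2` representation. -/
def potential (ε : ℂ) : Matrix (Fin 2) (Fin 2) (Forms q) :=
  ε • !![ωz q, ωm q; ωp q, -((qc q) ^ 2 • ωz q)]

end SUq

end SUqCalculus

/-! ### The radial calculus -/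

section Radial

open LaurentPolynomial

/-- The radial `*`-algebra, generated by `r = r*` and `r⁻¹`. -/
abbrev Radial : Type := LaurentPolynomial ℂ

instance : StarRing Radial where
  star p := AddMonoidAlgebra.mapRingHom ℤ (starRingEnd ℂ) p
  star_involutive p := by ext k; simp
  star_mul p p' := by rw [map_mul, mul_comm]
  star_add p p' := map_add _ p p'

instance : StarModule ℂ Radial where
  star_smul z p := by
    ext k
    change (AddMonoidAlgebra.mapRingHom ℤ (starRingEnd ℂ) (z • p)).coeff k =
      (starRingEnd ℂ z • AddMonoidAlgebra.mapRingHom ℤ (starRingEnd ℂ) p).coeff k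
    simp

namespace Radial

/-- The radial coordinate as an invertible element. -/
def r : Radialˣ where
  val := T 1
  inv := T (-1)
  val_inv := by rw [← T_add]; simp
  inv_val := by rw [← T_add]; simp

/-- The derivation `d/dr`. -/
def deriv : Radial →ₗ[ℂ] Radial where
  toFun p := p.coeff.sum fun k z => AddMonoidAlgebra.single (k - 1) (z * k)
  map_add' p p' := by
    rw [AddMonoidAlgebra.coeff_add, Finsupp.sum_add_index'] <;> simp [add_mul]
  map_smul' z p := by
    rw [AddMonoidAlgebra.coeff_smul, Finsupp.sum_smul_index', RingHom.id_apply, Finsupp.smul_sum]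
    · refine Finsupp.sum_congr fun k _ => ?_
      rw [AddMonoidAlgebra.smul_single, smul_eq_mul, smul_eq_mul, mul_assoc]
    · simp

/-- The exterior algebra generated by `dr`, with `r dr = dr r`. -/
def extData : ExtData Radial 1 where
  κ := AlgHom.id ℂ Radial
  w := 0
  cf := 0

abbrev Forms : Type := Ext extData

/-- The one-form `dr`. -/
abbrev dr : Forms := Ext.ω 0

/-- The one-dimensional `*`-calculus, with `dr` real and of length one. -/
def calculus : HermCalculus Radial Forms (Ext.gr extData) :=
  extCalculus extData (LinearMap.mulLeft ℂ dr ∘ₗ Ext.incl ∘ₗ deriv) 0 ![dr] 1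

end Radial

end Radial

/-! ### The algebra of `ℝ⁴_q ∖ {0}` -/

section GLq

/-- The generators `x_1, …, x_4`, `r`, `r⁻¹`. -/
inductive GLGen : Type
  | x1 | x2 | x3 | x4 | r | ri

/-- The relations of `ℝ⁴_q` (namely `x_i x_j = q x_j x_i` for `i < j` and `i + j ≠ 5`,
`x_2 x_3 = x_3 x_2`, and `x_1 x_4 - x_4 x_1 = (q⁻¹ - q) x_2 x_3`), the centrality of `r` and `r⁻¹`,
`r r⁻¹ = r⁻¹ r = 1`, and `(q x_1 x_4 + q² x_2 x_3) r⁻² = 1`. -/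
inductive GLRel (q : ℂ) : FreeAlgebra ℂ GLGen → FreeAlgebra ℂ GLGen → Prop
  | x12 : GLRel q (.ι ℂ .x1 * .ι ℂ .x2) (q • (.ι ℂ .x2 * .ι ℂ .x1))
  | x13 : GLRel q (.ι ℂ .x1 * .ι ℂ .x3) (q • (.ι ℂ .x3 * .ι ℂ .x1))
  | x24 : GLRel q (.ι ℂ .x2 * .ι ℂ .x4) (q • (.ι ℂ .x4 * .ι ℂ .x2))
  | x34 : GLRel q (.ι ℂ .x3 * .ι ℂ .x4) (q • (.ι ℂ .x4 * .ι ℂ .x3))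
  | x23 : GLRel q (.ι ℂ .x2 * .ι ℂ .x3) (.ι ℂ .x3 * .ι ℂ .x2)
  | x14 : GLRel q (.ι ℂ .x1 * .ι ℂ .x4 - .ι ℂ .x4 * .ι ℂ .x1)
      ((q⁻¹ - q) • (.ι ℂ .x2 * .ι ℂ .x3))
  | r_comm (x : GLGen) : GLRel q (.ι ℂ .r * .ι ℂ x) (.ι ℂ x * .ι ℂ .r)
  | ri_comm (x : GLGen) : GLRel q (.ι ℂ .ri * .ι ℂ x) (.ι ℂ x * .ι ℂ .ri)
  | r_ri : GLRel q (.ι ℂ .r * .ι ℂ .ri) 1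
  | det : GLRel q ((q • (.ι ℂ .x1 * .ι ℂ .x4) + q ^ 2 • (.ι ℂ .x2 * .ι ℂ .x3)) *
      .ι ℂ .ri ^ 2) 1

variable (q : Set.Ioo (0 : ℝ) 1)

/-- The algebra of `ℝ⁴_q ∖ {0}`, that is the algebra of `GL_q(1, ℍ)`. -/
def GLq : Type := Presented (GLRel (qc q))

instance : Ring (GLq q) := inferInstanceAs (Ring (RingQuot (GLRel (qc q))))
instance : Algebra ℂ (GLq q) := inferInstanceAs (Algebra ℂ (RingQuot (GLRel (qc q))))

namespace GLq

/-- The generators as elements of the algebra. -/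
def gen (x : GLGen) : GLq q := Presented.gen (GLRel (qc q)) x

abbrev x1 : GLq q := gen q .x1
abbrev x2 : GLq q := gen q .x2
abbrev x3 : GLq q := gen q .x3
abbrev x4 : GLq q := gen q .x4
abbrev r : GLq q := gen q .r
abbrev ri : GLq q := gen q .ri

/-- The adjoints of the generators: `x_1* = q x_4`, `x_2* = x_3`, `r* = r`. -/
def adj : GLGen → GLq q
  | .x1 => qc q • x4 q
  | .x2 => x3 q
  | .x3 => x2 q
  | .x4 => (qc q)⁻¹ • x1 q
  | .r => r q
  | .ri => ri q

variable {q} in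
theorem mk_rel {x y : FreeAlgebra ℂ GLGen} (h : GLRel (qc q) x y) :
    FreeAlgebra.lift ℂ (gen q) x = FreeAlgebra.lift ℂ (gen q) y := by
  have e : (FreeAlgebra.lift ℂ (gen q) : FreeAlgebra ℂ GLGen →ₐ[ℂ] GLq q) =
      Presented.mk (GLRel (qc q)) := FreeAlgebra.hom_ext (by
    funext x; exact FreeAlgebra.lift_ι_apply _ _)
  rw [e]
  exact RingQuot.mkAlgHom_rel ℂ h

theorem r_comm (x : GLGen) : gen q .r * gen q x = gen q x * gen q .r := by
  simpa only [map_mul, FreeAlgebra.lift_ι_apply] using mk_rel (q := q) (.r_comm x)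

theorem ri_comm (x : GLGen) : gen q .ri * gen q x = gen q x * gen q .ri := by
  simpa only [map_mul, FreeAlgebra.lift_ι_apply] using mk_rel (q := q) (.ri_comm x)

theorem conj_rel (x y : FreeAlgebra ℂ GLGen) (h : GLRel (qc q) x y) :
    FreeAlgebra.lift ℂ (fun x => ConjOp.op (adj q x)) x =
      FreeAlgebra.lift ℂ (fun x => ConjOp.op (adj q x)) y := by
  have hq : (starRingEnd ℂ) (qc q) = qc q := Complex.conj_ofReal _
  have hq0 := qc_ne_zero q
  have e12 := mk_rel (q := q) .x12
  have e13 := mk_rel (q := q) .x13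
  have e24 := mk_rel (q := q) .x24
  have e34 := mk_rel (q := q) .x34
  have e := mk_rel h
  cases h <;> apply ConjOp.ext <;>
    simp only [map_add, map_sub, map_mul, map_smul, map_one, map_pow, FreeAlgebra.lift_ι_apply,
      ConjOp.unop_add, ConjOp.unop_sub, ConjOp.unop_mul, ConjOp.unop_smul, ConjOp.unop_pow,
      ConjOp.unop_one, ConjOp.unop_op, hq, map_inv₀, adj] at e e12 e13 e24 e34 ⊢
  · rw [mul_smul_comm, e34, smul_mul_assoc]
  · rw [mul_smul_comm, e24, smul_mul_assoc]
  · rw [smul_mul_assoc, e13, mul_smul_comm, smul_comm]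
  · rw [smul_mul_assoc, e12, mul_smul_comm, smul_comm]
  · exact e
  · rw [smul_mul_smul_comm, smul_mul_smul_comm, inv_mul_cancel₀ hq0, mul_inv_cancel₀ hq0, one_smul,
      one_smul, e]
  · rename_i x
    cases x <;> simp only [smul_mul_assoc, mul_smul_comm, r_comm]
  · rename_i x
    cases x <;> simp only [smul_mul_assoc, mul_smul_comm, ri_comm]
  · rw [ri_comm, e]
  · have hc (x y : GLGen) : Commute (gen q .ri ^ 2) (gen q x * gen q y) :=
      ((show Commute (gen q .ri) (gen q x) from ri_comm q x).mul_right (ri_comm q y)).pow_left 2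
    rw [smul_mul_smul_comm, inv_mul_cancel₀ hq0, one_smul,
      (((hc _ _).smul_right (qc q)).add_right ((hc _ _).smul_right (qc q ^ 2))).eq, e]

/-- The adjoint as an algebra morphism into the conjugate opposite algebra. -/
def conjHom : GLq q →ₐ[ℂ] ConjOp (GLq q) :=
  Presented.lift (fun x => ConjOp.op (adj q x)) (conj_rel q)

theorem conjHom_gen (x : GLGen) : conjHom q (gen q x) = ConjOp.op (adj q x) :=
  (Presented.lift_mk _ _ _).trans (FreeAlgebra.lift_ι_apply _ _)

/-- The star structure. -/
instance : StarRing (GLq q) :=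
  Presented.starRing (rel := GLRel (qc q)) (adj q) (conj_rel q)
    (by
      have hq : (starRingEnd ℂ) (qc q) = qc q := Complex.conj_ofReal _
      have hq0 := qc_ne_zero q
      intro x
      change (conjHom q (adj q x)).unop = gen q x
      cases x <;> simp only [adj, map_smul, conjHom_gen, ConjOp.unop_smul, ConjOp.unop_op, map_inv₀,
        hq, smul_smul, mul_inv_cancel₀ hq0, inv_mul_cancel₀ hq0, one_smul])

instance : StarModule ℂ (GLq q) where
  star_smul z x := by
    refine Eq.trans (congrArg ConjOp.unop (map_smul (Presented.lift _ (conj_rel q)) z x)) ?_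
    exact ConjOp.unop_smul z _

end GLq

end GLq

/-! ### The warped product of the radial calculus and the calculus on `SU_q(2)` -/

section Product

variable (q : Set.Ioo (0 : ℝ) 1)

/-- The differential forms on `ℝ⁴_q ∖ {0}`. -/
abbrev ProdForms : Type := Ext.gr Radial.extData ᵍ⊗[ℂ] Ext.gr (SUq.extData q)

/-- The calculus on `ℝ⁴_q ∖ {0}`: the warped product with `ρ_k = r^k`. -/
def prodCalculus (α β γ : ℝ) : HermCalculus (Radial ⊗[ℂ] SUq q) (ProdForms q)
    (prodGr (Ext.gr Radial.extData) (Ext.gr (SUq.extData q))) :=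
  warpedProduct Radial.calculus (SUq.calculus q α β γ) fun k => Radial.r ^ k

/-- The pull-back of forms from `SU_q(2)`, `ω ↦ 1 ⊗ ω`. -/
def pullback : SUq.Forms q →ₐ[ℂ] ProdForms q :=
  GradedTensorProduct.includeRight (Ext.gr Radial.extData) (Ext.gr (SUq.extData q))

end Product

end QuantumMeron

namespace QuantumMeron

/-! ### Products of monomials in exterior algebras -/

namespace Ext

variable {A : Type} [Ring A] [Algebra ℂ A] {n : ℕ} {D : ExtData A n}

/-! Let `M` be the matrix of one-forms with rows `(ω_z, ω_-)` and `(ω_+, -q² ω_z)`. Its entries are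
those of the pure gauge potential `u* du`, and the Maurer-Cartan equations say `dM + M² = 0`. Hence
`A = M/2` satisfies `dA + 2A² = 0`, and its curvature is `F = dA + A² = -A²`, so that `dA = 2F`
(`map_d_potential`, `potential_mul_potential`). On two-forms the Hodge operator sends `ω_- ω_+`,
`ω_- ω_z`, `ω_+ ω_z` to multiples of `ω_z`, `ω_-`, `ω_+`, with factors inverse to `γ`, `β`, `α`. The
relations between `α`, `β`, `γ` are what makes these factors fit together into `⋆F = (2γ)⁻¹ A`
(`map_hodge_curvature`). Since `A` has degree one, `[∇, A] = dA + 2A²`, so the Yang-Mills equation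
on `SU_q(2)` is the Maurer-Cartan equation once more.

On the warped product the pulled back connection has the pulled back curvature. The duality there
satisfies `⋆(1 ⊗ ξ) = r⁻¹ dr ∧ (1 ⊗ ⋆ξ)` for two-forms `ξ` (`hodge_pullback`): the factor `r³` of
the volume form and the factor `r⁻²` of the metric on one-forms combine to `r⁻¹`. With `θ = r⁻¹ dr`
this gives `⋆F = (2γ)⁻¹ θA`. As `θ` is closed and anticommutes with `A`, one gets `[∇, θA] = -θ(dA +
2A²) = 0`. Every term of `⋆F` contains `dr`, no term of `F` does, and `⋆F ≠ 0`; so `F` is not an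
eigenvector (`map_hodge_ne_smul`).

Existence and uniqueness of both Hodge operators come from one notion, `Frame`: a homogeneous
orthogonal basis of the right module of forms with invertible squared lengths, together with a
density for top forms. Pairing with basis elements determines the coordinates of `⋆ξ`, which proves
uniqueness and dictates the formula for existence. The monomials `ω_S` form a frame on an exterior
algebra (`extFrame`), and frames of two factors give a frame of the warped product (`Frame.warped`).

The curvature computation needs `d² = 0` and graded Leibniz rules. The differential is defined on
coefficients, so these rules have to be proved. They reduce to compatibility of the Maurer-Cartan
forms with the exchange relations (`mc_mul_ω`) and with the bimodule relations (`mc_mul_tw`), and to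
`d² = 0` on functions (`d_d₀`). The last two are multiplicative in the function and are therefore
checked on `a`, `a*`, `c`, `c*`.

Finally, since `r` is central, the relations of `r⁻¹ Q` in `GL_q(1, ℍ)` are those of `u`, and
conversely `r ⊗ u` satisfies those of `Q`. This yields mutually inverse morphisms. The coordinate
formula for the meron follows by writing `ω_z`, `ω_∓` as `a* da + c* dc` and so on, and substituting
`u = r⁻¹ Q`. -/

theorem coef_monomial (S T : Finset (Fin n)) (x : A) :
    (monomial S x : Ext D).coef T = if T = S then x else 0 := rfl

@[simp] theorem monomial_zero (S : Finset (Fin n)) : (monomial S 0 : Ext D) = 0 := by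
  ext T; simp [coef_monomial]

theorem sum_monomial_coef (f : Ext D) : ∑ S, monomial S (f.coef S) = f := by
  ext T; simp [coef_sum, coef_monomial]

/-- In the sum over `S' ⊆ R` defining the product, only `S' = S` with `R \ S = T` can contribute,
which forces `R = S ∪ T` and disjointness. -/
theorem monomial_mul_monomial (S T : Finset (Fin n)) (x y : A) :
    (monomial S x * monomial T y : Ext D) =
      if Disjoint S T then D.sgn S T • monomial (S ∪ T) (D.tw T x * y) else 0 := by
  ext R
  rw [coef_mul]
  by_cases hST : Disjoint S T
  · rw [if_pos hST, coef_smul, coef_monomial]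
    have hT : (S ∪ T) \ S = T := Finset.union_sdiff_cancel_left hST
    by_cases hR : R = S ∪ T
    · rw [if_pos hR, hR, Finset.sum_eq_single S]
      · simp [coef_monomial, hT]
      · intro S' _ h; simp [coef_monomial, h]
      · intro h; exact absurd (Finset.mem_powerset.2 Finset.subset_union_left) h
    · rw [if_neg hR, smul_zero]
      refine Finset.sum_eq_zero fun S' hS' => ?_
      by_cases h : S' = S
      · have : R \ S' ≠ T := fun e => hR (by
          rw [← e, ← h, Finset.union_sdiff_of_subset (Finset.mem_powerset.1 hS')])
        simp [coef_monomial, this]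
      · simp [coef_monomial, h]
  · rw [if_neg hST]
    refine Finset.sum_eq_zero fun S' hS' => ?_
    by_cases h : S' = S
    · have : R \ S' ≠ T := fun e => hST (by rw [← e, ← h]; exact Finset.disjoint_sdiff)
      simp [coef_monomial, this]
    · simp [coef_monomial, h]

theorem monomial_mul_incl (S : Finset (Fin n)) (x y : A) :
    (monomial S x * incl y : Ext D) = monomial S (x * y) :=
  (monomial_mul_monomial S ∅ x y).trans (by simp [sgn_empty_right, tw_empty])

theorem monomial_eq (S : Finset (Fin n)) (x : A) :
    (monomial S x : Ext D) = monomial S 1 * incl x := by rw [monomial_mul_incl, one_mul]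

theorem sum_monomial_mul_incl (f : Ext D) : ∑ S, monomial S 1 * incl (f.coef S) = f := by
  simp only [← monomial_eq, sum_monomial_coef]

theorem incl_mul_incl (x y : A) : (incl x * incl y : Ext D) = incl (x * y) :=
  monomial_mul_incl ∅ x y

theorem incl_one : (incl 1 : Ext D) = 1 := rfl

theorem incl_mul_ω (i : Fin n) (x : A) :
    (incl x * ω i : Ext D) = ω i * incl (D.tw {i} x) := by
  refine (monomial_mul_monomial ∅ {i} x 1).trans ?_
  rw [ω, monomial_mul_incl]; simp [sgn_empty_left]

theorem ω_mul_self (i : Fin n) : (ω i * ω i : Ext D) = 0 :=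
  (monomial_mul_monomial {i} {i} 1 1).trans (by simp)

theorem ω_mul_monomial {i : Fin n} {S : Finset (Fin n)} (h : ∀ j ∈ S, i < j) (x : A) :
    (ω i * monomial S x : Ext D) = monomial (insert i S) x := by
  have hi : i ∉ S := fun hi => lt_irrefl i (h i hi)
  refine (monomial_mul_monomial {i} S 1 x).trans ?_
  have hs : D.sgn {i} S = 1 := by
    simp only [ExtData.sgn, Finset.prod_singleton]
    exact Finset.prod_eq_one fun j hj => if_neg (h j hj).not_gt
  simp [hi, hs, Finset.singleton_union]

theorem ω_mul_ω {i j : Fin n} (h : i < j) : (ω i * ω j : Ext D) = monomial {i, j} 1 :=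
  ω_mul_monomial (by simpa using h) 1

theorem ω_mul_ω_comm {i j : Fin n} (h : j < i) :
    (ω i * ω j : Ext D) = D.cf i j • (ω j * ω i) := by
  refine (monomial_mul_monomial {i} {j} 1 1).trans ?_
  rw [ω_mul_ω h, if_pos (by simpa using h.ne'), map_one, one_mul]
  simp [ExtData.sgn, h, Finset.pair_comm]

/-- The forms are generated by functions under multiplication by the basic one-forms. -/
theorem induction {P : Ext D → Prop} (h0 : ∀ x, P (incl x)) (ha : ∀ f g, P f → P g → P (f + g))
    (hω : ∀ i f, P f → P (ω i * f)) (f : Ext D) : P f := by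
  have hm : ∀ (S : Finset (Fin n)) (x : A), P (monomial S x) := by
    intro S x
    -- Splitting off the least index writes `ω_S` as `ω_i` times a shorter monomial without a sign.
    induction S using Finset.induction_on_min with
    | empty => exact h0 x
    | insert i S hi ih =>
      rw [← ω_mul_monomial hi]
      exact hω i _ ih
  rw [← sum_monomial_coef f]
  exact Finset.sum_induction _ P ha (by simpa using h0 0) fun S _ => hm S _

theorem monomial_mem (S : Finset (Fin n)) (x : A) : monomial S x ∈ gr D S.card := by
  intro T hT
  rw [coef_monomial, if_neg]
  rintro rfl; exact hT rfl

theorem incl_mem (x : A) : incl x ∈ gr D 0 := monomial_mem ∅ x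

theorem ω_mem (i : Fin n) : ω i ∈ gr D 1 := monomial_mem {i} 1

theorem gr_eq_bot {k : ℕ} (hk : n < k) : gr D k = ⊥ := by
  rw [eq_bot_iff]
  intro f hf
  refine (Submodule.mem_bot ℂ).2 (Ext.ext (funext fun S => ?_))
  refine hf S (Nat.ne_of_lt (lt_of_le_of_lt ?_ hk))
  simpa using Finset.card_le_univ S

theorem eq_monomial_univ {f : Ext D} (hf : f ∈ gr D n) :
    f = monomial Finset.univ (f.coef Finset.univ) := by
  ext S
  rw [coef_monomial]
  split_ifs with h
  · rw [h]
  · refine hf S fun e => h ?_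
    exact Finset.eq_univ_of_card S (by simpa using e)

/-- The coefficient of `ω_S` as a linear map. -/
def coefₗ (S : Finset (Fin n)) : Ext D →ₗ[ℂ] A where
  toFun f := f.coef S
  map_add' _ _ := rfl
  map_smul' _ _ := rfl

@[simp] theorem coefₗ_apply (S : Finset (Fin n)) (f : Ext D) : coefₗ S f = f.coef S := rfl

end Ext

/-! ### The differential of the calculus on an exterior algebra -/

section Differential

open Ext

variable {A : Type} [Ring A] [Algebra ℂ A] [StarRing A] [StarModule ℂ A] {n : ℕ}
  {D : ExtData A n} {d₀ : A →ₗ[ℂ] Ext D} {m s : Fin n → Ext D} {g : Finset (Fin n) → ℂ}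

theorem extCalculus_d_monomial (S : Finset (Fin n)) (y : A) :
    (extCalculus D d₀ m s g).d (monomial S y) =
      (∑ i, if {i} = S then m i * incl y else 0) +
        (-1 : ℂ) ^ S.card • (monomial S 1 * d₀ y) := by
  change ∑ i, m i * incl ((monomial S y : Ext D).coef {i}) + ∑ T : Finset (Fin n),
    (-1 : ℂ) ^ T.card • (monomial T 1 * d₀ ((monomial S y : Ext D).coef T)) = _
  congr 1
  · refine Finset.sum_congr rfl fun i _ => ?_
    rw [coef_monomial]
    split_ifs <;> simp
  · rw [Finset.sum_eq_single S]
    · simp [coef_monomial]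
    · intro T _ h; simp [coef_monomial, h]
    · simp

theorem extCalculus_d_incl (x : A) : (extCalculus D d₀ m s g).d (incl x) = d₀ x := by
  refine (extCalculus_d_monomial ∅ x).trans ?_
  have : (monomial ∅ 1 : Ext D) = 1 := rfl
  simp [this]

theorem extCalculus_d_monomial_of_two_le {S : Finset (Fin n)} (hS : 2 ≤ S.card) (y : A) :
    (extCalculus D d₀ m s g).d (monomial S y) = (-1 : ℂ) ^ S.card • (monomial S 1 * d₀ y) := by
  rw [extCalculus_d_monomial, add_eq_right]
  refine Finset.sum_eq_zero fun i _ => if_neg ?_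
  rintro rfl; simp at hS

theorem extCalculus_d_ω_incl (j : Fin n) (y : A) :
    (extCalculus D d₀ m s g).d (ω j * incl y) = m j * incl y - ω j * d₀ y := by
  rw [ω, ← monomial_eq, extCalculus_d_monomial]
  simp [Finset.singleton_inj, sub_eq_add_neg]

/-- Only basic one-forms have a nonzero differential, so the rule depends on the degree of the
monomial in `f`. It is the definition in degree zero. In degree one it says that `ω_j ω_i` is
closed, which is `hm`. In higher degree the extra term with `m j` vanishes by `hm'`. -/
theorem extCalculus_d_ω_mul (hm : ∀ i j, m j * ω i = ω j * m i)
    (hm' : ∀ j S, 2 ≤ S.card → m j * monomial S 1 = 0) (j : Fin n) (f : Ext D) :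
    (extCalculus D d₀ m s g).d (ω j * f) = m j * f - ω j * (extCalculus D d₀ m s g).d f := by
  rw [← sum_monomial_coef f]
  simp only [Finset.mul_sum, map_sum, ← Finset.sum_sub_distrib]
  refine Finset.sum_congr rfl fun S _ => ?_
  generalize f.coef S = y
  rcases S.eq_empty_or_nonempty with rfl | hne
  · change (extCalculus D d₀ m s g).d (ω j * incl y) = m j * incl y - ω j *
      (extCalculus D d₀ m s g).d (incl y)
    rw [extCalculus_d_ω_incl, extCalculus_d_incl]
  · have hd : (extCalculus D d₀ m s g).d (ω j * monomial S y) =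
        -((-1 : ℂ) ^ S.card • (ω j * monomial S 1 * d₀ y)) := by
      rw [monomial_eq S y, ← mul_assoc, ω, monomial_mul_monomial]
      by_cases hjS : j ∈ S
      · simp [hjS]
      · have hc : ({j} ∪ S).card = S.card + 1 := by
          rw [Finset.singleton_union, Finset.card_insert_of_notMem hjS]
        rw [if_pos (by simpa using hjS), map_one, one_mul, smul_mul_assoc, ← monomial_eq, map_smul,
          extCalculus_d_monomial_of_two_le (by rw [hc]; have := hne.card_pos; omega), hc]
        simp [smul_smul, pow_succ, mul_comm]
    rw [hd]
    by_cases h2 : 2 ≤ S.card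
    · rw [extCalculus_d_monomial_of_two_le h2, monomial_eq S y, ← mul_assoc (m j), hm' j S h2,
        zero_mul, zero_sub, mul_smul_comm, mul_assoc]
    · obtain ⟨i, rfl⟩ := Finset.card_eq_one.1 (le_antisymm (by omega) hne.card_pos)
      have e : (monomial {i} y : Ext D) = ω i * incl y := monomial_eq _ _
      rw [e, extCalculus_d_ω_incl, ← mul_assoc (m j), hm]
      simp [mul_sub, mul_assoc, ω]

/-- Induction on `f`, for all functions `x` at once, because moving `x` past `ω_j` turns it into its
twist. The hypothesis `hω` says that `d` gives the same value on both sides of the bimodule relation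
`x ω_j = ω_j κ^{w j}(x)`. -/
theorem extCalculus_d_incl_mul (hm : ∀ i j, m j * ω i = ω j * m i)
    (hm' : ∀ j S, 2 ≤ S.card → m j * monomial S 1 = 0)
    (hd₀ : ∀ x y, d₀ (x * y) = d₀ x * incl y + incl x * d₀ y)
    (hω : ∀ j x, m j * incl (D.tw {j} x) - ω j * d₀ (D.tw {j} x) =
      d₀ x * ω j + incl x * m j) (x : A) (f : Ext D) :
    (extCalculus D d₀ m s g).d (incl x * f) =
      d₀ x * f + incl x * (extCalculus D d₀ m s g).d f := by
  induction f using Ext.induction generalizing x with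
  | h0 y => rw [incl_mul_incl, extCalculus_d_incl, extCalculus_d_incl, hd₀]
  | ha f g hf hg => rw [mul_add, map_add, map_add, hf, hg]; noncomm_ring
  | hω j f ih =>
    rw [← mul_assoc, incl_mul_ω, mul_assoc, extCalculus_d_ω_mul hm hm', ih,
      extCalculus_d_ω_mul hm hm', mul_add, ← mul_assoc, ← mul_assoc, ← mul_assoc (ω j) (incl _),
      ← incl_mul_ω, ← sub_sub, ← sub_mul, hω]
    noncomm_ring

/-- In `d(d(ω_j f)) = d(m_j f) - d(ω_j df)` both terms produce `m_j df`; these cancel and leave `ω_j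
d(df)`, so induction applies. -/
theorem extCalculus_d_d (hm : ∀ i j, m j * ω i = ω j * m i)
    (hm' : ∀ j S, 2 ≤ S.card → m j * monomial S 1 = 0)
    (hmd : ∀ j f, (extCalculus D d₀ m s g).d (m j * f) = m j * (extCalculus D d₀ m s g).d f)
    (h0 : ∀ x, (extCalculus D d₀ m s g).d (d₀ x) = 0) (f : Ext D) :
    (extCalculus D d₀ m s g).d ((extCalculus D d₀ m s g).d f) = 0 := by
  induction f using Ext.induction with
  | h0 y => rw [extCalculus_d_incl, h0]
  | ha f g hf hg => rw [map_add, map_add, hf, hg, add_zero]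
  | hω j f ih =>
    rw [extCalculus_d_ω_mul hm hm', map_sub, hmd, extCalculus_d_ω_mul hm hm', ih]
    simp

theorem extCalculus_d_mem (hm : ∀ i, m i ∈ gr D 2) (h0 : ∀ x, d₀ x ∈ gr D 1) {k : ℕ}
    {f : Ext D} (hf : f ∈ gr D k) : (extCalculus D d₀ m s g).d f ∈ gr D (k + 1) := by
  rw [← sum_monomial_coef f, map_sum]
  refine Submodule.sum_mem _ fun S _ => ?_
  by_cases hS : S.card = k
  · rw [extCalculus_d_monomial]
    refine Submodule.add_mem _ (Submodule.sum_mem _ fun i _ => ?_)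
      (Submodule.smul_mem _ _ (hS ▸ SetLike.mul_mem_graded (monomial_mem S 1) (h0 _)))
    split_ifs with h
    · subst h hS
      rw [Finset.card_singleton]
      exact SetLike.mul_mem_graded (i := 2) (j := 0) (hm i) (incl_mem _)
    · exact Submodule.zero_mem _
  · rw [hf S hS]; simp

end Differential

end QuantumMeron

namespace QuantumMeron

/-! ### Orthogonal frames and the Hodge operator -/

section Frames

variable {A Ω : Type} [Ring A] [Algebra ℂ A] [StarRing A] [Ring Ω] [Algebra ℂ Ω]
  {gr : ℕ → Submodule ℂ Ω}

/-- A homogeneous orthogonal basis of the right module of forms, together with the densities of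
forms of top degree with respect to the volume form. -/
structure Frame (C : HermCalculus A Ω gr) (ι : Type) [Fintype ι] [DecidableEq ι] where
  deg : ι → ℕ
  e : ι → Ω
  coord : ι → Ω →ₗ[ℂ] A
  /-- the squared lengths of the basis elements -/
  wt : ι → Aˣ
  /-- the density of a form with respect to the volume form -/
  dens : Ω →ₗ[ℂ] A
  deg_le : ∀ i, deg i ≤ C.dim
  e_mem : ∀ i, e i ∈ gr (deg i)
  mul_mem : ∀ {k l ξ η}, ξ ∈ gr k → η ∈ gr l → ξ * η ∈ gr (k + l)
  incl_mem : ∀ x, C.incl x ∈ gr 0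
  incl_mul : ∀ x y, C.incl (x * y) = C.incl x * C.incl y
  conj_mem : ∀ {k ξ}, ξ ∈ gr k → C.conj ξ ∈ gr k
  sum_e : ∀ ξ, ∑ i, e i * C.incl (coord i ξ) = ξ
  coord_e : ∀ i j x, coord i (e j * C.incl x) = if i = j then x else 0
  coord_eq_zero : ∀ {k ξ i}, ξ ∈ gr k → deg i ≠ k → coord i ξ = 0
  herm_eq : ∀ ξ η, C.herm ξ η = ∑ i, star (coord i ξ) * wt i * coord i η
  dens_mul : ∀ ξ x, dens (ξ * C.incl x) = dens ξ * x
  dens_vol : dens C.vol = 1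
  vol_mul_dens : ∀ {ξ}, ξ ∈ gr C.dim → C.vol * C.incl (dens ξ) = ξ
  dens_eq_zero : ∀ {k ξ}, ξ ∈ gr k → k ≠ C.dim → dens ξ = 0

namespace Frame

variable {C : HermCalculus A Ω gr} {ι : Type} [Fintype ι] [DecidableEq ι]

theorem eq_zero_of_dim_lt (F : Frame C ι) {k : ℕ} (hk : C.dim < k) {ξ : Ω} (hξ : ξ ∈ gr k) : ξ = 0 := by
  rw [← F.sum_e ξ]
  refine Finset.sum_eq_zero fun i _ => ?_
  rw [F.coord_eq_zero hξ (lt_of_le_of_lt (F.deg_le i) hk).ne, map_zero, mul_zero]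

variable (F : Frame C ι)

theorem ext_coord {ξ η : Ω} (h : ∀ i, F.coord i ξ = F.coord i η) : ξ = η := by
  rw [← F.sum_e ξ, ← F.sum_e η]
  simp only [h]

/-- A frame does not include `incl 1 = 1`. Still, `incl 1` is a right unit on forms, since every
form is a sum of terms ending in some `incl x`. -/
theorem herm_e (ξ : Ω) (j : ι) : C.herm ξ (F.e j) = star (F.coord j ξ) * F.wt j := by
  have h1 : C.incl 1 * C.incl 1 = C.incl 1 := by rw [← F.incl_mul, mul_one]
  have he : F.e j * C.incl 1 = F.e j := by
    conv_rhs => rw [← F.sum_e (F.e j)]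
    conv_lhs => rw [← F.sum_e (F.e j)]
    simp only [Finset.sum_mul, mul_assoc, ← F.incl_mul, mul_one]
  rw [← he, F.herm_eq]
  simp [F.coord_e]

/-- Taking densities in `τ (⋆ξ, e_j) = ξ* ∧ e_j` determines the adjoint of the `j`-th coordinate of
`⋆ξ` times the squared length of `e_j`, which is invertible. Coordinates of the wrong degree vanish.
-/
theorem hodge_unique (F : Frame C ι) {s s' : Ω →ₗ[ℂ] Ω} (hs : C.IsHodge s) (hs' : C.IsHodge s') : s' = s := by
  refine LinearMap.ext fun ξ => ?_
  rw [← F.sum_e ξ, map_sum, map_sum]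
  refine Finset.sum_congr rfl fun i _ => ?_
  have hi := F.mul_mem (F.e_mem i) (F.incl_mem (F.coord i ξ))
  rw [add_zero] at hi
  refine F.ext_coord fun j => ?_
  by_cases hj : F.deg j = C.dim - F.deg i
  · have h := (hs'.vol_mul _ (F.deg_le i) _ hi (F.e j) (hj ▸ F.e_mem j)).trans
      (hs.vol_mul _ (F.deg_le i) _ hi (F.e j) (hj ▸ F.e_mem j)).symm
    have h := congrArg F.dens h
    rw [F.dens_mul, F.dens_mul, F.dens_vol, one_mul, one_mul, F.herm_e,
      F.herm_e, Units.mul_left_inj] at h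
    exact star_injective h
  · rw [F.coord_eq_zero (hs'.map_mem _ (F.deg_le i) _ hi) hj,
      F.coord_eq_zero (hs.map_mem _ (F.deg_le i) _ hi) hj]

variable [StarModule ℂ A]

/-- The Hodge operator, `⋆ξ = ∑_j e_j (dens (ξ* ∧ e_j) (e_j, e_j)⁻¹)*`. -/
def hodge : Ω →ₗ[ℂ] Ω where
  toFun ξ := ∑ j, F.e j * C.incl (star (F.dens (C.conj ξ * F.e j) * ((F.wt j)⁻¹ : Aˣ)))
  map_add' ξ η := by
    simp only [map_add, add_mul, star_add, mul_add, Finset.sum_add_distrib]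
  map_smul' z ξ := by
    simp only [map_smulₛₗ, smul_mul_assoc, map_smul, star_smul, mul_smul_comm, Finset.smul_sum,
      RingHom.id_apply, starRingEnd_apply, star_star]

theorem hodge_apply (ξ : Ω) :
    F.hodge ξ = ∑ j, F.e j * C.incl (star (F.dens (C.conj ξ * F.e j) * ((F.wt j)⁻¹ : Aˣ))) := rfl

theorem coord_hodge (ξ : Ω) (i : ι) :
    F.coord i (F.hodge ξ) = star (F.dens (C.conj ξ * F.e i) * ((F.wt i)⁻¹ : Aˣ)) := by
  simp [hodge_apply, F.coord_e]

theorem isHodge_hodge : C.IsHodge F.hodge where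
  map_mem k hk ξ hξ := by
    refine Submodule.sum_mem _ fun j _ => ?_
    by_cases h : F.deg j = C.dim - k
    · rw [← h, ← add_zero (F.deg j)]
      exact F.mul_mem (F.e_mem j) (F.incl_mem _)
    · rw [F.dens_eq_zero (F.mul_mem (F.conj_mem hξ) (F.e_mem j)) (by omega)]
      simp
  vol_mul k hk ξ hξ η hη := by
    have hm : C.conj ξ * η ∈ gr C.dim := by
      have := F.mul_mem (F.conj_mem hξ) hη
      rwa [Nat.add_sub_cancel' hk] at this
    rw [← F.vol_mul_dens hm, F.herm_eq]
    congr 2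
    -- Both sides are right linear in `η`, so expanding `η` in the frame reduces the identity to the
    -- basis elements used to define the operator.
    conv_rhs => rw [← F.sum_e η, Finset.mul_sum, map_sum]
    refine Finset.sum_congr rfl fun j _ => ?_
    rw [← mul_assoc, F.dens_mul, F.coord_hodge, star_star, Units.inv_mul_cancel_right]

end Frame

end Frames

/-! ### The frame of the calculus on an exterior algebra -/

section ExtFrame

open Ext

theorem Ext.conjMonomial_mem {A : Type} [Ring A] [Algebra ℂ A] {n : ℕ} {D : ExtData A n} {s : Fin n → Ext D} (hs : ∀ i, s i ∈ gr D 1)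
    (S : Finset (Fin n)) : conjMonomial s S ∈ gr D S.card := by
  refine Submodule.smul_mem _ _ ?_
  have h : ∀ l : List (Fin n), ((l.map s).reverse).prod ∈ gr D l.length := by
    intro l
    induction l with
    | nil => exact SetLike.one_mem_graded (gr D)
    | cons i l ih =>
      rw [List.map_cons, List.reverse_cons, List.prod_append, List.prod_singleton,
        List.length_cons]
      exact SetLike.mul_mem_graded ih (hs i)
  simpa using h (S.sort (· ≤ ·))

variable {A : Type} [Ring A] [Algebra ℂ A] [StarRing A] [StarModule ℂ A] {n : ℕ}

/-- The frame of the monomials `ω_S`. -/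
def extFrame (D : ExtData A n) (d₀ : A →ₗ[ℂ] Ext D) (m : Fin n → Ext D) {s : Fin n → Ext D}
    {g : Finset (Fin n) → ℂ} (hs : ∀ i, s i ∈ gr D 1) (hg : ∀ S, g S ≠ 0) :
    Frame (extCalculus D d₀ m s g) (Finset (Fin n)) where
  deg := Finset.card
  e S := monomial S 1
  coord := coefₗ
  wt S := Units.map (algebraMap ℂ A).toMonoidHom (Units.mk0 (g S) (hg S))
  dens := coefₗ Finset.univ
  deg_le S := by simpa [extCalculus] using Finset.card_le_univ S
  e_mem S := monomial_mem S 1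
  mul_mem {k l ξ η} hξ hη := SetLike.mul_mem_graded (A := gr D) hξ hη
  incl_mem := incl_mem
  incl_mul x y := (incl_mul_incl x y).symm
  conj_mem {k ξ} hξ := by
    change ∑ S, incl (star (ξ.coef S)) * conjMonomial s S ∈ gr D k
    refine Submodule.sum_mem _ fun S _ => ?_
    by_cases hS : S.card = k
    · subst hS
      have := SetLike.mul_mem_graded (incl_mem (D := D) (star (ξ.coef S))) (conjMonomial_mem hs S)
      rwa [zero_add] at this
    · rw [hξ S hS]; simp
  sum_e ξ := sum_monomial_mul_incl ξ
  coord_e S T x := by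
    change (monomial T 1 * incl x : Ext D).coef S = _
    rw [monomial_mul_incl, one_mul, coef_monomial]
  coord_eq_zero hξ hS := hξ _ hS
  herm_eq ξ η := by
    change ∑ S : Finset (Fin n), g S • (star (ξ.coef S) * η.coef S) = _
    refine Finset.sum_congr rfl fun S _ => ?_
    simp [Algebra.smul_def, Algebra.commutes, mul_assoc]
  dens_mul ξ x := by
    conv_lhs => rw [← sum_monomial_coef ξ, Finset.sum_mul, map_sum]
    change ∑ S, (monomial S (ξ.coef S) * incl x : Ext D).coef Finset.univ = _
    simp [monomial_mul_incl, coef_monomial]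
  dens_vol := by
    change (monomial Finset.univ 1 : Ext D).coef Finset.univ = 1
    simp [coef_monomial]
  vol_mul_dens {ξ} hξ := by
    change (monomial Finset.univ 1 * incl (ξ.coef Finset.univ) : Ext D) = ξ
    rw [← monomial_eq]
    exact (eq_monomial_univ hξ).symm
  dens_eq_zero {k ξ} hξ hk := hξ _ (by simpa [extCalculus] using Ne.symm hk)

end ExtFrame

end QuantumMeron

namespace QuantumMeron

/-! ### Warped products of framed calculi -/

section WarpedFrame

open GradedTensorProduct

/-! ### Products and induction principles in the graded tensor product -/

section Tmul

variable {Ω₁ Ω₂ : Type} [Ring Ω₁] [Algebra ℂ Ω₁] [Ring Ω₂] [Algebra ℂ Ω₂]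
  {G₁ : ℕ → Submodule ℂ Ω₁} {G₂ : ℕ → Submodule ℂ Ω₂} [GradedAlgebra G₁] [GradedAlgebra G₂]

theorem tmul_mul_tmul {j i : ℕ} (a : Ω₁) {b : Ω₂} (hb : b ∈ G₂ j) {a' : Ω₁} (ha : a' ∈ G₁ i)
    (b' : Ω₂) : (a ᵍ⊗ₜ[ℂ] b * a' ᵍ⊗ₜ[ℂ] b' : G₁ ᵍ⊗[ℂ] G₂) =
      (-1 : ℂ) ^ (j * i) • ((a * a') ᵍ⊗ₜ[ℂ] (b * b')) := by
  refine (tmul_coe_mul_coe_tmul G₁ G₂ a ⟨b, hb⟩ ⟨a', ha⟩ b').trans ?_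
  rcases Nat.even_or_odd (j * i) with h | h
  · rw [h.neg_one_pow, one_smul, h.neg_one_pow, one_smul]
  · rw [h.neg_one_pow, h.neg_one_pow, neg_one_smul, Units.neg_smul, one_smul]

/-- The sign depends on the degrees of the two inner factors. If one of them has degree zero there
is no sign, and the other need not be homogeneous. -/
theorem tmul_mul_tmul_of_left {a : Ω₁} {b : Ω₂} (hb : b ∈ G₂ 0) (a' : Ω₁) (b' : Ω₂) :
    (a ᵍ⊗ₜ[ℂ] b * a' ᵍ⊗ₜ[ℂ] b' : G₁ ᵍ⊗[ℂ] G₂) = (a * a') ᵍ⊗ₜ[ℂ] (b * b') := by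
  induction a' using DirectSum.Decomposition.inductionOn G₁ with
  | zero => simp [tmul]
  | homogeneous x => rw [tmul_mul_tmul a hb x.2]; simp
  | add x y hx hy =>
    simp only [tmul, TensorProduct.add_tmul, map_add, mul_add] at hx hy ⊢
    rw [hx, hy]

theorem tmul_mul_tmul_of_right (a : Ω₁) (b : Ω₂) {a' : Ω₁} (ha : a' ∈ G₁ 0) (b' : Ω₂) :
    (a ᵍ⊗ₜ[ℂ] b * a' ᵍ⊗ₜ[ℂ] b' : G₁ ᵍ⊗[ℂ] G₂) = (a * a') ᵍ⊗ₜ[ℂ] (b * b') := by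
  induction b using DirectSum.Decomposition.inductionOn G₂ with
  | zero => simp [tmul]
  | homogeneous x => rw [tmul_mul_tmul a x.2 ha]; simp
  | add x y hx hy =>
    simp only [tmul, TensorProduct.tmul_add, map_add, add_mul] at hx hy ⊢
    rw [hx, hy]

theorem tmul_induction {P : G₁ ᵍ⊗[ℂ] G₂ → Prop} (h : ∀ a b, P (a ᵍ⊗ₜ[ℂ] b))
    (ha : ∀ x y, P x → P y → P (x + y)) (x : G₁ ᵍ⊗[ℂ] G₂) : P x :=
  TensorProduct.induction_on (motive := fun x => P (of ℂ G₁ G₂ x)) ((of ℂ G₁ G₂).symm x)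
    (by simpa [tmul] using h 0 0) h fun x y hx hy => by rw [map_add]; exact ha _ _ hx hy

/-- A version of `tmul_induction` with homogeneous left factors. -/
theorem tmul_induction_homogeneous {P : G₁ ᵍ⊗[ℂ] G₂ → Prop}
    (h : ∀ i, ∀ a ∈ G₁ i, ∀ b, P (a ᵍ⊗ₜ[ℂ] b))
    (ha : ∀ x y, P x → P y → P (x + y)) (x : G₁ ᵍ⊗[ℂ] G₂) : P x := by
  refine tmul_induction (fun a b => ?_) ha x
  induction a using DirectSum.Decomposition.inductionOn G₁ with
  | zero => exact h 0 0 (Submodule.zero_mem _) b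
  | homogeneous x => exact h _ _ x.2 b
  | add x y hx hy =>
    have := ha _ _ hx hy
    rwa [← map_add, ← TensorProduct.add_tmul] at this

theorem tmul_mem_prodGr {i j : ℕ} {a : Ω₁} {b : Ω₂} (ha : a ∈ G₁ i) (hb : b ∈ G₂ j) :
    a ᵍ⊗ₜ[ℂ] b ∈ prodGr G₁ G₂ (i + j) :=
  Submodule.subset_span ⟨i, j, rfl, a, ha, b, hb, rfl⟩

theorem prodGr_induction {m : ℕ} {P : G₁ ᵍ⊗[ℂ] G₂ → Prop}
    (h : ∀ i j, i + j = m → ∀ a ∈ G₁ i, ∀ b ∈ G₂ j, P (a ᵍ⊗ₜ[ℂ] b)) (h0 : P 0)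
    (ha : ∀ x y, P x → P y → P (x + y)) (hs : ∀ (z : ℂ) x, P x → P (z • x))
    {x : G₁ ᵍ⊗[ℂ] G₂} (hx : x ∈ prodGr G₁ G₂ m) : P x := by
  refine Submodule.span_induction ?_ h0 (fun x y _ _ => ha x y) (fun z x _ => hs z x) hx
  rintro _ ⟨i, j, hij, a, ha, b, hb, rfl⟩
  exact h i j hij a ha b hb

theorem prodGr_mul_mem {k l : ℕ} {x y : G₁ ᵍ⊗[ℂ] G₂} (hx : x ∈ prodGr G₁ G₂ k)
    (hy : y ∈ prodGr G₁ G₂ l) : x * y ∈ prodGr G₁ G₂ (k + l) := by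
  refine prodGr_induction (P := fun x => x * y ∈ prodGr G₁ G₂ (k + l)) ?_ ?_ ?_ ?_ hx
  · intro i j hij a ha b hb
    refine prodGr_induction (P := fun y => a ᵍ⊗ₜ[ℂ] b * y ∈ prodGr G₁ G₂ (k + l)) ?_ ?_ ?_ ?_ hy
    · intro i' j' hij' a' ha' b' hb'
      rw [tmul_mul_tmul a hb ha']
      have := tmul_mem_prodGr (SetLike.mul_mem_graded ha ha') (SetLike.mul_mem_graded hb hb')
      rw [show i + i' + (j + j') = k + l by omega] at this
      exact Submodule.smul_mem _ _ this
    · rw [mul_zero]; exact Submodule.zero_mem _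
    · intro x y hx hy; rw [mul_add]; exact Submodule.add_mem _ hx hy
    · intro z x hx; rw [mul_smul_comm]; exact Submodule.smul_mem _ _ hx
  · rw [zero_mul]; exact Submodule.zero_mem _
  · intro x y hx hy; rw [add_mul]; exact Submodule.add_mem _ hx hy
  · intro z x hx; rw [smul_mul_assoc]; exact Submodule.smul_mem _ _ hx

end Tmul

variable {A₁ Ω₁ A₂ Ω₂ : Type} [Ring A₁] [Algebra ℂ A₁] [Ring Ω₁]
  [Algebra ℂ Ω₁] [Ring A₂] [Algebra ℂ A₂] [Ring Ω₂] [Algebra ℂ Ω₂]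
  {G₁ : ℕ → Submodule ℂ Ω₁} {G₂ : ℕ → Submodule ℂ Ω₂} [GradedAlgebra G₁] [GradedAlgebra G₂]
  {C₁ : HermCalculus A₁ Ω₁ G₁} {C₂ : HermCalculus A₂ Ω₂ G₂}
  {ι₁ ι₂ : Type} [Fintype ι₁] [DecidableEq ι₁] [Fintype ι₂] [DecidableEq ι₂]

theorem warpedProduct_incl_tmul (ρ : ℕ → A₁ˣ) (x : A₁) (y : A₂) :
    (warpedProduct C₁ C₂ ρ).incl (x ⊗ₜ y) = C₁.incl x ᵍ⊗ₜ[ℂ] C₂.incl y := rfl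

theorem warpedProduct_incl_mem (h₁ : ∀ x, C₁.incl x ∈ G₁ 0) (h₂ : ∀ x, C₂.incl x ∈ G₂ 0)
    (ρ : ℕ → A₁ˣ) (x : A₁ ⊗[ℂ] A₂) : (warpedProduct C₁ C₂ ρ).incl x ∈ prodGr G₁ G₂ 0 := by
  induction x using TensorProduct.induction_on with
  | zero => rw [map_zero]; exact Submodule.zero_mem _
  | tmul x y =>
    rw [warpedProduct_incl_tmul]
    exact tmul_mem_prodGr (i := 0) (j := 0) (h₁ x) (h₂ y)
  | add x y hx hy => rw [map_add]; exact Submodule.add_mem _ hx hy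

theorem warpedProduct_conj_tmul (ρ : ℕ → A₁ˣ) (x : Ω₁) (y : Ω₂) :
    (warpedProduct C₁ C₂ ρ).conj (x ᵍ⊗ₜ[ℂ] y) = C₁.conj x ᵍ⊗ₜ[ℂ] C₂.conj y := rfl

theorem warpedProduct_d_tmul (ρ : ℕ → A₁ˣ) (x : Ω₁) (y : Ω₂) :
    (warpedProduct C₁ C₂ ρ).d (x ᵍ⊗ₜ[ℂ] y) =
      C₁.d x ᵍ⊗ₜ[ℂ] y + gradeSign G₁ C₁.dim x ᵍ⊗ₜ[ℂ] C₂.d y := rfl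

theorem warpedProduct_herm_tmul (ρ : ℕ → A₁ˣ) (x x' : Ω₁) (y y' : Ω₂) :
    (warpedProduct C₁ C₂ ρ).herm (x ᵍ⊗ₜ[ℂ] y) (x' ᵍ⊗ₜ[ℂ] y') =
      ∑ k ∈ Finset.range (C₂.dim + 1), ((((ρ k)⁻¹ : A₁ˣ) : A₁) ^ 2 * C₁.herm x x') ⊗ₜ[ℂ]
        C₂.herm (GradedAlgebra.proj G₂ k y) (GradedAlgebra.proj G₂ k y') := by
  change (∑ k ∈ Finset.range (C₂.dim + 1), _ : _ →ₗ⋆[ℂ] _ →ₗ[ℂ] _) _ _ = _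
  rw [LinearMap.sum_apply, LinearMap.sum_apply]
  rfl

variable [StarRing A₁] [StarRing A₂]

namespace Frame

variable (F₁ : Frame C₁ ι₁) (F₂ : Frame C₂ ι₂)

/-- The coordinates of forms on a product. -/
def coordTmul (i : ι₁ × ι₂) : G₁ ᵍ⊗[ℂ] G₂ →ₗ[ℂ] A₁ ⊗[ℂ] A₂ :=
  TensorProduct.map (F₁.coord i.1) (F₂.coord i.2) ∘ₗ (of ℂ G₁ G₂).symm.toLinearMap

theorem coordTmul_tmul (i : ι₁ × ι₂) (x : Ω₁) (y : Ω₂) :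
    F₁.coordTmul F₂ i (x ᵍ⊗ₜ[ℂ] y) = F₁.coord i.1 x ⊗ₜ F₂.coord i.2 y := rfl

/-- The density of forms on a warped product. -/
def densTmul (u : A₁ˣ) : G₁ ᵍ⊗[ℂ] G₂ →ₗ[ℂ] A₁ ⊗[ℂ] A₂ :=
  TensorProduct.map (LinearMap.mulLeft ℂ ((u⁻¹ : A₁ˣ) : A₁) ∘ₗ F₁.dens) F₂.dens ∘ₗ
    (of ℂ G₁ G₂).symm.toLinearMap

theorem densTmul_tmul (u : A₁ˣ) (x : Ω₁) (y : Ω₂) :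
    F₁.densTmul F₂ u (x ᵍ⊗ₜ[ℂ] y) = (((u⁻¹ : A₁ˣ) : A₁) * F₁.dens x) ⊗ₜ F₂.dens y := rfl

/-- The tensor product of two units. -/
def tmulUnit (u : A₁ˣ) (v : A₂ˣ) : (A₁ ⊗[ℂ] A₂)ˣ where
  val := (u : A₁) ⊗ₜ (v : A₂)
  inv := ((u⁻¹ : A₁ˣ) : A₁) ⊗ₜ ((v⁻¹ : A₂ˣ) : A₂)
  val_inv := by simp [Algebra.TensorProduct.one_def]
  inv_val := by simp [Algebra.TensorProduct.one_def]

theorem coord_proj (k : ℕ) (y : Ω₂) (j : ι₂) :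
    F₂.coord j (GradedAlgebra.proj G₂ k y) = if F₂.deg j = k then F₂.coord j y else 0 := by
  induction y using DirectSum.Decomposition.inductionOn G₂ with
  | zero => simp
  | @homogeneous l x =>
    rw [GradedAlgebra.proj_apply]
    by_cases h : l = k
    · subst h
      rw [DirectSum.decompose_coe, DirectSum.of_eq_same]
      split_ifs with hj
      · rfl
      · exact F₂.coord_eq_zero x.2 hj
    · rw [DirectSum.decompose_of_mem_ne _ x.2 h, map_zero]
      split_ifs with hj
      · exact (F₂.coord_eq_zero x.2 fun e => h (e.symm.trans hj)).symm
      · rfl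
  | add x y hx hy => rw [map_add, map_add, hx, hy, map_add]; split_ifs <;> simp

variable [StarModule ℂ A₁] [StarModule ℂ A₂]

/-- The frame of a warped product. -/
def warped (ρ : ℕ → A₁ˣ) (hρ : ∀ k x, Commute (ρ k : A₁) x) :
    Frame (warpedProduct C₁ C₂ ρ) (ι₁ × ι₂) where
  deg i := F₁.deg i.1 + F₂.deg i.2
  e i := F₁.e i.1 ᵍ⊗ₜ[ℂ] F₂.e i.2
  coord := F₁.coordTmul F₂
  wt i := tmulUnit ((ρ (F₂.deg i.2))⁻¹ ^ 2 * F₁.wt i.1) (F₂.wt i.2)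
  dens := F₁.densTmul F₂ (ρ C₂.dim)
  deg_le i := add_le_add (F₁.deg_le _) (F₂.deg_le _)
  e_mem i := tmul_mem_prodGr (F₁.e_mem _) (F₂.e_mem _)
  mul_mem := prodGr_mul_mem
  incl_mem := warpedProduct_incl_mem F₁.incl_mem F₂.incl_mem ρ
  incl_mul x y := by
    induction x using TensorProduct.induction_on with
    | zero => simp
    | add x y hx hy => rw [add_mul, map_add, hx, hy, map_add, add_mul]
    | tmul x x' =>
      induction y using TensorProduct.induction_on with
      | zero => simp
      | add x y hx hy => rw [mul_add, map_add, hx, hy, map_add, mul_add]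
      | tmul y y' =>
        rw [Algebra.TensorProduct.tmul_mul_tmul]
        simp only [warpedProduct_incl_tmul]
        rw [tmul_mul_tmul_of_left (F₂.incl_mem _), F₁.incl_mul, F₂.incl_mul]
  conj_mem {k ξ} hξ := by
    refine prodGr_induction (P := fun ξ => (warpedProduct C₁ C₂ ρ).conj ξ ∈ prodGr G₁ G₂ k)
      ?_ ?_ ?_ ?_ hξ
    · rintro i j rfl a ha b hb
      exact tmul_mem_prodGr (F₁.conj_mem ha) (F₂.conj_mem hb)
    · rw [map_zero]; exact Submodule.zero_mem _
    · intro x y hx hy; rw [map_add]; exact Submodule.add_mem _ hx hy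
    · intro z x hx; rw [map_smulₛₗ]; exact Submodule.smul_mem _ _ hx
  sum_e ξ := by
    induction ξ using tmul_induction with
    | h a b =>
      conv_rhs => rw [← F₁.sum_e a, ← F₂.sum_e b]
      simp only [coordTmul_tmul, warpedProduct_incl_tmul, tmul_mul_tmul_of_right _ _ (F₁.incl_mem _),
        Fintype.sum_prod_type, tmul, TensorProduct.sum_tmul, TensorProduct.tmul_sum, map_sum]
      exact Finset.sum_comm
    | ha x y hx hy =>
      conv_rhs => rw [← hx, ← hy]
      simp only [map_add, mul_add, Finset.sum_add_distrib]
  coord_e i j x := by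
    induction x using TensorProduct.induction_on with
    | zero => simp
    | add x y hx hy => rw [map_add, mul_add, map_add, hx, hy]; split_ifs <;> simp
    | tmul x y =>
      rw [warpedProduct_incl_tmul, tmul_mul_tmul_of_right _ _ (F₁.incl_mem _), coordTmul_tmul,
        F₁.coord_e, F₂.coord_e]
      by_cases h1 : i.1 = j.1 <;> by_cases h2 : i.2 = j.2 <;> simp [h1, h2, Prod.ext_iff]
  coord_eq_zero {k ξ i} hξ hi := by
    refine prodGr_induction (P := fun ξ => F₁.coordTmul F₂ i ξ = 0) ?_ ?_ ?_ ?_ hξ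
    · rintro k l rfl a ha b hb
      rw [coordTmul_tmul]
      by_cases h1 : F₁.deg i.1 = k
      · rw [F₂.coord_eq_zero hb (by omega), TensorProduct.tmul_zero]
      · rw [F₁.coord_eq_zero ha h1, TensorProduct.zero_tmul]
    · rw [map_zero]
    · intro x y hx hy; rw [map_add, hx, hy, add_zero]
    · intro z x hx; rw [map_smul, hx, smul_zero]
  herm_eq ξ η := by
    induction ξ using tmul_induction with
    | ha x y hx hy =>
      rw [map_add, LinearMap.add_apply, hx, hy]
      simp only [map_add, star_add, add_mul, Finset.sum_add_distrib]
    | h a b =>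
      induction η using tmul_induction with
      | ha x y hx hy =>
        rw [map_add, hx, hy]
        simp only [map_add, mul_add, Finset.sum_add_distrib]
      | h a' b' =>
        rw [warpedProduct_herm_tmul, Fintype.sum_prod_type_right]
        simp only [F₂.herm_eq, F₂.coord_proj, TensorProduct.tmul_sum]
        rw [Finset.sum_comm]
        refine Finset.sum_congr rfl fun j _ => ?_
        rw [Finset.sum_eq_single (F₂.deg j)]
        · rw [F₁.herm_eq, Finset.mul_sum, TensorProduct.sum_tmul]
          refine Finset.sum_congr rfl fun i _ => ?_
          simp only [coordTmul_tmul, TensorProduct.star_tmul, tmulUnit, if_true,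
            Algebra.TensorProduct.tmul_mul_tmul]
          congr 1
          -- Centrality of the warping elements lets `ρ⁻²` move from the front of the Hermitian
          -- product to the squared length in the middle.
          have hc : Commute (((ρ (F₂.deg j))⁻¹ : A₁ˣ) : A₁) (star (F₁.coord i a)) :=
            (hρ _ _).units_inv_left
          rw [Units.val_mul, Units.val_pow_eq_pow_val, ← mul_assoc (star _),
            ← (hc.pow_left 2).eq]
          simp only [mul_assoc]
        · intro k _ hk
          simp [hk.symm]
        · intro h
          exact absurd (Finset.mem_range.2 (Nat.lt_succ_of_le (F₂.deg_le j))) h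
  dens_mul ξ x := by
    induction x using TensorProduct.induction_on with
    | zero => simp
    | add x y hx hy => rw [map_add, mul_add, map_add, hx, hy, mul_add]
    | tmul x y =>
      induction ξ using tmul_induction with
      | ha x y hx hy => rw [add_mul, map_add, hx, hy, map_add, add_mul]
      | h a b =>
        rw [warpedProduct_incl_tmul, tmul_mul_tmul_of_right _ _ (F₁.incl_mem _), densTmul_tmul,
          F₁.dens_mul, F₂.dens_mul, densTmul_tmul, Algebra.TensorProduct.tmul_mul_tmul, mul_assoc]
  dens_vol := by
    change F₁.densTmul F₂ (ρ C₂.dim) ((C₁.vol * C₁.incl (ρ C₂.dim)) ᵍ⊗ₜ[ℂ] C₂.vol) = 1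
    rw [densTmul_tmul, F₁.dens_mul, F₁.dens_vol, F₂.dens_vol, one_mul, Units.inv_mul]
    rfl
  vol_mul_dens {ξ} hξ := by
    refine prodGr_induction (P := fun ξ => (warpedProduct C₁ C₂ ρ).vol *
      (warpedProduct C₁ C₂ ρ).incl (F₁.densTmul F₂ (ρ C₂.dim) ξ) = ξ) ?_ ?_ ?_ ?_ hξ
    · intro i j hij a ha b hb
      by_cases hi : i = C₁.dim
      · have hj : j = C₂.dim := by change i + j = C₁.dim + C₂.dim at hij; omega
        subst hi hj
        rw [densTmul_tmul, warpedProduct_incl_tmul]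
        change (C₁.vol * C₁.incl (ρ C₂.dim)) ᵍ⊗ₜ[ℂ] C₂.vol * _ = _
        rw [tmul_mul_tmul_of_right _ _ (F₁.incl_mem _), F₂.vol_mul_dens hb, mul_assoc,
          ← F₁.incl_mul, Units.mul_inv_cancel_left, F₁.vol_mul_dens ha]
      · change i + j = C₁.dim + C₂.dim at hij
        -- If the degrees add up to the total dimension but are not the two dimensions, one of them
        -- exceeds its dimension, and that factor is zero.
        have h0 : a ᵍ⊗ₜ[ℂ] b = (0 : G₁ ᵍ⊗[ℂ] G₂) := by
          by_cases h : C₁.dim < i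
          · simp [F₁.eq_zero_of_dim_lt h ha, tmul]
          · simp [F₂.eq_zero_of_dim_lt (show C₂.dim < j by omega) hb, tmul]
        rw [h0, map_zero, map_zero, mul_zero]
    · rw [map_zero, map_zero, mul_zero]
    · intro x y hx hy; rw [map_add, map_add, mul_add, hx, hy]
    · intro z x hx; rw [map_smul, map_smul, mul_smul_comm, hx]
  dens_eq_zero {k ξ} hξ hk := by
    refine prodGr_induction (P := fun ξ => F₁.densTmul F₂ (ρ C₂.dim) ξ = 0) ?_ ?_ ?_ ?_ hξ
    · rintro i j rfl a ha b hb
      rw [densTmul_tmul]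
      by_cases h1 : i = C₁.dim
      · have h2 : j ≠ C₂.dim := by rintro rfl; exact hk (by rw [h1]; rfl)
        rw [F₂.dens_eq_zero hb h2, TensorProduct.tmul_zero]
      · rw [F₁.dens_eq_zero ha h1, mul_zero, TensorProduct.zero_tmul]
    · rw [map_zero]
    · intro x y hx hy; rw [map_add, hx, hy, add_zero]
    · intro z x hx; rw [map_smul, hx, smul_zero]

end Frame

end WarpedFrame

end QuantumMeron

namespace QuantumMeron

/-! ### Curvature and the Yang-Mills equations -/

namespace HermCalculus

variable {A Ω : Type} [Ring A] [Algebra ℂ A] [Ring Ω] [Algebra ℂ Ω] {gr : ℕ → Submodule ℂ Ω}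
  {C : HermCalculus A Ω gr} {N : ℕ} {α F F' G : Matrix (Fin N) (Fin N) Ω}

/-- The operator `∇²` evaluated on the standard basis of the free module gives back the columns of
the matrix. -/
theorem IsCurvature.unique (h : C.IsCurvature α F) (h' : C.IsCurvature α F') : F = F' := by
  ext i j
  have := congrFun ((h.sq (Pi.single j 1)).symm.trans (h'.sq (Pi.single j 1))) i
  simpa using this

/-- In `∇²η` the terms containing `dη` cancel because the entries of `α` obey the Leibniz rule of
odd forms. -/
theorem isCurvature_map_d_add_mul (hd : ∀ ξ, C.d (C.d ξ) = 0)
    (hα : ∀ i j η, C.d (α i j * η) = C.d (α i j) * η - α i j * C.d η)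
    (hm : ∀ i j, (α.map C.d + α * α) i j ∈ gr 2) :
    C.IsCurvature α (α.map C.d + α * α) where
  mem := hm
  sq η := by
    have h1 : (fun i => C.d ((α *ᵥ η) i)) =
        α.map C.d *ᵥ η - α *ᵥ (fun i => C.d (η i)) := by
      funext i
      simp only [Matrix.mulVec, dotProduct, map_sum, hα, Pi.sub_apply, Matrix.map_apply,
        Finset.sum_sub_distrib]
    funext i
    have h2 := congrFun h1 i
    simp only [connection, Pi.add_apply, map_add, hd, Matrix.mulVec_add, Matrix.add_mulVec,
      Matrix.mulVec_mulVec, zero_add] at h2 ⊢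
    rw [h2, Pi.sub_apply]
    abel

/-- By the Leibniz rule for the entries of `G`, the derivatives of `η` drop out of the graded
commutator. What remains is a matrix identity between forms. -/
theorem covDeriv_eq_zero {k : ℕ}
    (hG : ∀ i j η, C.d (G i j * η) = C.d (G i j) * η + (-1 : ℂ) ^ k • (G i j * C.d η))
    (h : G.map C.d + α * G = (-1 : ℂ) ^ k • (G * α)) (η : Fin N → Ω) :
    C.covDeriv α k G η = 0 := by
  have h1 : (fun i => C.d ((G *ᵥ η) i)) =
      G.map C.d *ᵥ η + (-1 : ℂ) ^ k • (G *ᵥ (fun i => C.d (η i))) := by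
    funext i
    simp only [Matrix.mulVec, dotProduct, map_sum, hG, Pi.add_apply, Pi.smul_apply,
      Matrix.map_apply, Finset.sum_add_distrib, Finset.smul_sum]
  rw [covDeriv, connection, connection, h1, Matrix.mulVec_add, smul_add, Matrix.mulVec_mulVec,
    Matrix.mulVec_mulVec, ← Matrix.smul_mulVec, ← Matrix.smul_mulVec, ← h, Matrix.add_mulVec,
    Matrix.smul_mulVec]
  abel

end HermCalculus

/-! ### The differential of a warped product -/

section WarpedDifferential

open GradedTensorProduct

/-- The grading operator is a sum truncated at degree `N`. The truncation is harmless when there are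
no nonzero forms above `N`. -/
theorem gradeSign_apply {Ω₁ : Type} [Ring Ω₁] [Algebra ℂ Ω₁] {G₁ : ℕ → Submodule ℂ Ω₁}
    [GradedAlgebra G₁] {N k : ℕ} (hN : ∀ k, N < k → ∀ x ∈ G₁ k, x = 0) {x : Ω₁} (hx : x ∈ G₁ k) :
    gradeSign G₁ N x = (-1 : ℂ) ^ k • x := by
  by_cases hk : N < k
  · rw [hN k hk x hx]; simp
  · simp only [gradeSign, LinearMap.sum_apply, LinearMap.smul_apply, GradedAlgebra.proj_apply]
    rw [Finset.sum_eq_single k, DirectSum.decompose_of_mem_same _ hx]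
    · intro l _ hl
      rw [DirectSum.decompose_of_mem_ne _ hx hl.symm, smul_zero]
    · intro h
      exact absurd (Finset.mem_range.2 (by omega)) h

variable {A₁ Ω₁ A₂ Ω₂ : Type} [Ring A₁] [Algebra ℂ A₁] [Ring Ω₁]
  [Algebra ℂ Ω₁] [Ring A₂] [Algebra ℂ A₂] [Ring Ω₂] [Algebra ℂ Ω₂]
  {G₁ : ℕ → Submodule ℂ Ω₁} {G₂ : ℕ → Submodule ℂ Ω₂} [GradedAlgebra G₁] [GradedAlgebra G₂]
  {C₁ : HermCalculus A₁ Ω₁ G₁} {C₂ : HermCalculus A₂ Ω₂ G₂}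

theorem gsmul_tmul (z : ℂ) (x : Ω₁) (y : Ω₂) :
    ((z • x) ᵍ⊗ₜ[ℂ] y : G₁ ᵍ⊗[ℂ] G₂) = z • x ᵍ⊗ₜ[ℂ] y := by
  rw [tmul, ← TensorProduct.smul_tmul', map_smul]

theorem gtmul_smul (z : ℂ) (x : Ω₁) (y : Ω₂) :
    (x ᵍ⊗ₜ[ℂ] (z • y) : G₁ ᵍ⊗[ℂ] G₂) = z • x ᵍ⊗ₜ[ℂ] y := by
  rw [tmul, TensorProduct.tmul_smul, map_smul]

theorem gtmul_add (x : Ω₁) (y y' : Ω₂) :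
    (x ᵍ⊗ₜ[ℂ] (y + y') : G₁ ᵍ⊗[ℂ] G₂) = x ᵍ⊗ₜ[ℂ] y + x ᵍ⊗ₜ[ℂ] y' := by
  rw [tmul, TensorProduct.tmul_add, map_add]

theorem gzero_tmul (y : Ω₂) : ((0 : Ω₁) ᵍ⊗ₜ[ℂ] y : G₁ ᵍ⊗[ℂ] G₂) = 0 := by
  rw [tmul, TensorProduct.zero_tmul, map_zero]

theorem gtmul_zero (x : Ω₁) : (x ᵍ⊗ₜ[ℂ] (0 : Ω₂) : G₁ ᵍ⊗[ℂ] G₂) = 0 := by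
  rw [tmul, TensorProduct.tmul_zero, map_zero]

theorem warpedProduct_d_tmul_of_mem (hN : ∀ k, C₁.dim < k → ∀ x ∈ G₁ k, x = 0) (ρ : ℕ → A₁ˣ)
    {i : ℕ} {x : Ω₁} (hx : x ∈ G₁ i) (y : Ω₂) :
    (warpedProduct C₁ C₂ ρ).d (x ᵍ⊗ₜ[ℂ] y) =
      C₁.d x ᵍ⊗ₜ[ℂ] y + (-1 : ℂ) ^ i • x ᵍ⊗ₜ[ℂ] C₂.d y := by
  rw [warpedProduct_d_tmul, gradeSign_apply hN hx, gsmul_tmul]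

theorem warpedProduct_d_d (hN : ∀ k, C₁.dim < k → ∀ x ∈ G₁ k, x = 0) (ρ : ℕ → A₁ˣ)
    (hm : ∀ k, ∀ x ∈ G₁ k, C₁.d x ∈ G₁ (k + 1))
    (h₁ : ∀ x, C₁.d (C₁.d x) = 0) (h₂ : ∀ y, C₂.d (C₂.d y) = 0) (ξ : G₁ ᵍ⊗[ℂ] G₂) :
    (warpedProduct C₁ C₂ ρ).d ((warpedProduct C₁ C₂ ρ).d ξ) = 0 := by
  induction ξ using tmul_induction_homogeneous with
  | ha x y hx hy => rw [map_add, map_add, hx, hy, add_zero]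
  | h i x hx y =>
    rw [warpedProduct_d_tmul_of_mem hN ρ hx, map_add, map_smul,
      warpedProduct_d_tmul_of_mem hN ρ hx, warpedProduct_d_tmul_of_mem hN ρ (hm i x hx), h₁, h₂,
      gzero_tmul, gtmul_zero]
    simp [pow_succ]

/-- The Leibniz rule for left multiplication by a form of the second factor is inherited by the
product. It comes down to parities, since `1 ⊗ ζ` picks up a sign when it passes the left factor of
`ξ`. -/
theorem warpedProduct_d_includeRight_mul (hN : ∀ k, C₁.dim < k → ∀ x ∈ G₁ k, x = 0) (ρ : ℕ → A₁ˣ)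
    (hm : ∀ k, ∀ x ∈ G₁ k, C₁.d x ∈ G₁ (k + 1)) (hm₂ : ∀ k, ∀ x ∈ G₂ k, C₂.d x ∈ G₂ (k + 1))
    {l : ℕ} {ζ : Ω₂} (hζ : ζ ∈ G₂ l)
    (h : ∀ η, C₂.d (ζ * η) = C₂.d ζ * η + (-1 : ℂ) ^ l • (ζ * C₂.d η)) (ξ : G₁ ᵍ⊗[ℂ] G₂) :
    (warpedProduct C₁ C₂ ρ).d (1 ᵍ⊗ₜ[ℂ] ζ * ξ) =
      1 ᵍ⊗ₜ[ℂ] C₂.d ζ * ξ + (-1 : ℂ) ^ l • (1 ᵍ⊗ₜ[ℂ] ζ * (warpedProduct C₁ C₂ ρ).d ξ) := by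
  induction ξ using tmul_induction_homogeneous with
  | ha x y hx hy => rw [mul_add, map_add, hx, hy, map_add, mul_add, mul_add, smul_add]; abel
  | h i x hx y =>
    rw [warpedProduct_d_tmul_of_mem hN ρ hx, mul_add, mul_smul_comm, tmul_mul_tmul 1 hζ hx,
      tmul_mul_tmul 1 hζ hx, tmul_mul_tmul 1 (hm₂ l ζ hζ) hx, tmul_mul_tmul 1 hζ (hm i x hx),
      one_mul, one_mul, map_smul, warpedProduct_d_tmul_of_mem hN ρ hx, h, gtmul_add, gtmul_smul]
    simp only [smul_add, smul_smul, ← pow_add]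
    -- The exponents `l i` and `l + l (i + 1)` differ by the even number `2 l`.
    have e1 : (-1 : ℂ) ^ (l * i) = (-1) ^ (l + l * (i + 1)) := by
      rw [show l + l * (i + 1) = 2 * l + l * i by ring, pow_add]; simp
    have e2 : (-1 : ℂ) ^ (l * i + i) = (-1) ^ ((l + 1) * i) := by congr 1; ring
    have e3 : (-1 : ℂ) ^ (l * i + (i + l)) = (-1) ^ (l + (i + l * i)) := by congr 1; ring
    rw [e1, e2, e3]
    abel

/-- The hypothesis `h` expresses that `θ` is closed; this is applied to `r⁻¹ dr`. -/
theorem warpedProduct_d_tmul_one_mul (hN : ∀ k, C₁.dim < k → ∀ x ∈ G₁ k, x = 0) (ρ : ℕ → A₁ˣ)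
    {θ : Ω₁} (hθ : θ ∈ G₁ 1) (h : ∀ x, C₁.d (θ * x) = -(θ * C₁.d x)) (ξ : G₁ ᵍ⊗[ℂ] G₂) :
    (warpedProduct C₁ C₂ ρ).d (θ ᵍ⊗ₜ[ℂ] 1 * ξ) =
      -(θ ᵍ⊗ₜ[ℂ] 1 * (warpedProduct C₁ C₂ ρ).d ξ) := by
  have h1 : (1 : Ω₂) ∈ G₂ 0 := SetLike.one_mem_graded G₂
  induction ξ using tmul_induction_homogeneous with
  | ha x y hx hy => rw [mul_add, map_add, hx, hy, map_add, mul_add]; abel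
  | h i x hx y =>
    rw [warpedProduct_d_tmul_of_mem hN ρ hx, mul_add, mul_smul_comm, tmul_mul_tmul_of_left h1,
      tmul_mul_tmul_of_left h1, tmul_mul_tmul_of_left h1, one_mul, one_mul,
      warpedProduct_d_tmul_of_mem hN ρ (SetLike.mul_mem_graded hθ hx), h]
    rw [← neg_one_smul ℂ (θ * _), gsmul_tmul, neg_add, neg_one_smul, pow_add, pow_one,
      neg_one_mul, neg_smul]

end WarpedDifferential

end QuantumMeron

namespace QuantumMeron

/-! ### The differential of the calculus on `SU_q(2)` -/

namespace SUq

open Ext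

variable (q : Set.Ioo (0 : ℝ) 1)

variable {q} in
theorem induction {P : SUq q → Prop} (hz : ∀ z, P (algebraMap ℂ _ z)) (ha : P (a q))
    (ha' : P (a' q)) (hc : P (c q)) (hc' : P (c' q)) (hm : ∀ x y, P x → P y → P (x * y))
    (hadd : ∀ x y, P x → P y → P (x + y)) (x : SUq q) : P x := by
  obtain ⟨p, rfl⟩ := RingQuot.mkAlgHom_surjective ℂ (SURel (qc q)) x
  induction p using FreeAlgebra.induction with
  | grade0 z => rw [AlgHom.commutes]; exact hz z
  | grade1 x => cases x <;> assumption
  | mul x y hx hy => rw [map_mul]; exact hm _ _ hx hy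
  | add x y hx hy => rw [map_add]; exact hadd _ _ hx hy

variable {q} in
theorem algHom_ext {B : Type} [Ring B] [Algebra ℂ B] {f g : SUq q →ₐ[ℂ] B}
    (ha : f (a q) = g (a q)) (ha' : f (a' q) = g (a' q)) (hc : f (c q) = g (c q))
    (hc' : f (c' q) = g (c' q)) : f = g := by
  refine AlgHom.ext fun x => ?_
  induction x using SUq.induction with
  | hz z => rw [AlgHom.commutes, AlgHom.commutes]
  | ha => exact ha
  | ha' => exact ha'
  | hc => exact hc
  | hc' => exact hc'
  | hm x y hx hy => rw [map_mul, map_mul, hx, hy]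
  | hadd x y hx hy => rw [map_add, map_add, hx, hy]

section lift

variable {q} {B : Type} [Ring B] [Algebra ℂ B] {A A' C C' : B}
    (h1 : A * A' + qc q ^ 2 • (C' * C) = 1) (h2 : A * C' = qc q • (C' * A))
    (h3 : C * A' = qc q • (A' * C)) (h4 : C * C' = C' * C)
    (h5 : A' * A + C' * C = 1) (h6 : C' * A' = qc q • (A' * C'))
    (h7 : A * C = qc q • (C * A))

theorem lift_a : lift A A' C C' h1 h2 h3 h4 h5 h6 h7 (a q) = A :=
  (Presented.lift_mk _ _ _).trans (FreeAlgebra.lift_ι_apply _ _)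
theorem lift_a' : lift A A' C C' h1 h2 h3 h4 h5 h6 h7 (a' q) = A' :=
  (Presented.lift_mk _ _ _).trans (FreeAlgebra.lift_ι_apply _ _)
theorem lift_c : lift A A' C C' h1 h2 h3 h4 h5 h6 h7 (c q) = C :=
  (Presented.lift_mk _ _ _).trans (FreeAlgebra.lift_ι_apply _ _)
theorem lift_c' : lift A A' C C' h1 h2 h3 h4 h5 h6 h7 (c' q) = C' :=
  (Presented.lift_mk _ _ _).trans (FreeAlgebra.lift_ι_apply _ _)

end lift

/-- The counit `a, a* ↦ 1`, `c, c* ↦ 0` is a character. -/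
instance : Nontrivial (SUq q) :=
  (lift (B := ℂ) 1 1 0 0 (by simp) (by simp) (by simp) (by simp) (by simp) (by simp)
    (by simp) : SUq q →ₐ[ℂ] ℂ).toRingHom.domain_nontrivial

theorem scale_a (t : ℂˣ) : scale q t (a q) = (t : ℂ) • a q := lift_a ..
theorem scale_a' (t : ℂˣ) : scale q t (a' q) = ((t⁻¹ : ℂˣ) : ℂ) • a' q := lift_a' ..
theorem scale_c (t : ℂˣ) : scale q t (c q) = (t : ℂ) • c q := lift_c ..
theorem scale_c' (t : ℂˣ) : scale q t (c' q) = ((t⁻¹ : ℂˣ) : ℂ) • c' q := lift_c' ..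

theorem scale_scale (t t' : ℂˣ) (x : SUq q) : scale q t (scale q t' x) = scale q (t * t') x := by
  refine AlgHom.congr_fun (φ₁ := (scale q t).comp (scale q t')) (algHom_ext ?_ ?_ ?_ ?_) x <;>
    simp [scale_a, scale_a', scale_c, scale_c', smul_smul, mul_comm]

theorem scale_one (x : SUq q) : scale q 1 x = x := by
  refine AlgHom.congr_fun (φ₁ := scale q 1) (φ₂ := AlgHom.id ℂ _) (algHom_ext ?_ ?_ ?_ ?_) x <;>
    simp [scale_a, scale_a', scale_c, scale_c']

/-! ### The twisted derivations and the differential of functions -/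

theorem XplusHom_apply (x : SUq q) :
    XplusHom q x = !![x, Xplus q x; 0, scale q (qu q)⁻¹ x] := by
  suffices h : XplusHom q x 0 0 = x ∧ XplusHom q x 1 0 = 0 ∧
      XplusHom q x 1 1 = scale q (qu q)⁻¹ x by
    ext i j
    fin_cases i <;> fin_cases j
    · exact h.1
    · rfl
    · exact h.2.1
    · exact h.2.2
  induction x using SUq.induction with
  | hz z => simp [Matrix.algebraMap_matrix_apply]
  | ha => rw [XplusHom, lift_a, scale_a]; simp [qu]
  | ha' => rw [XplusHom, lift_a', scale_a']; simp [qu]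
  | hc => rw [XplusHom, lift_c, scale_c]; simp [qu]
  | hc' => rw [XplusHom, lift_c', scale_c']; simp [qu]
  | hm x y hx hy => simp [Matrix.mul_apply, Fin.sum_univ_two, hx, hy]
  | hadd x y hx hy => simp [hx, hy]

theorem XminusHom_apply (x : SUq q) :
    XminusHom q x = !![x, Xminus q x; 0, scale q (qu q)⁻¹ x] := by
  suffices h : XminusHom q x 0 0 = x ∧ XminusHom q x 1 0 = 0 ∧
      XminusHom q x 1 1 = scale q (qu q)⁻¹ x by
    ext i j
    fin_cases i <;> fin_cases j
    · exact h.1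
    · rfl
    · exact h.2.1
    · exact h.2.2
  induction x using SUq.induction with
  | hz z => simp [Matrix.algebraMap_matrix_apply]
  | ha => rw [XminusHom, lift_a, scale_a]; simp [qu]
  | ha' => rw [XminusHom, lift_a', scale_a']; simp [qu]
  | hc => rw [XminusHom, lift_c, scale_c]; simp [qu]
  | hc' => rw [XminusHom, lift_c', scale_c']; simp [qu]
  | hm x y hx hy => simp [Matrix.mul_apply, Fin.sum_univ_two, hx, hy]
  | hadd x y hx hy => simp [hx, hy]

/-- This is the upper right entry of the multiplicativity of the triangular matrix representation
`XplusHom`. -/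
theorem Xplus_mul (x y : SUq q) :
    Xplus q (x * y) = Xplus q x * scale q (qu q)⁻¹ y + x * Xplus q y := by
  have h := congrFun (congrFun (map_mul (XplusHom q) x y) 0) 1
  simp only [XplusHom_apply, Matrix.mul_apply, Fin.sum_univ_two] at h
  simpa [add_comm] using h

theorem Xminus_mul (x y : SUq q) :
    Xminus q (x * y) = Xminus q x * scale q (qu q)⁻¹ y + x * Xminus q y := by
  have h := congrFun (congrFun (map_mul (XminusHom q) x y) 0) 1
  simp only [XminusHom_apply, Matrix.mul_apply, Fin.sum_univ_two] at h
  simpa [add_comm] using h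

theorem Xz_apply (x : SUq q) :
    Xz q x = (1 - (qc q)⁻¹ ^ 2)⁻¹ • (x - scale q ((qu q)⁻¹ ^ 2) x) := rfl

theorem Xz_mul (x y : SUq q) :
    Xz q (x * y) = Xz q x * scale q ((qu q)⁻¹ ^ 2) y + x * Xz q y := by
  simp only [Xz_apply, map_mul, smul_mul_assoc, mul_smul_comm, ← smul_add]
  congr 1
  noncomm_ring

theorem d₀_apply (x : SUq q) : d₀ q x = incl (Xminus q x) * ωm q + incl (Xplus q x) * ωp q +
    incl (Xz q x) * ωz q := rfl

theorem tw_zero : (extData q).tw {0} = scale q (qu q) := by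
  simp [ExtData.tw, extData]

theorem tw_one : (extData q).tw {1} = scale q (qu q) := by
  simp [ExtData.tw, extData]

theorem tw_two_apply (x : SUq q) : (extData q).tw {2} x = scale q (qu q ^ 2) x := by
  rw [pow_two, ← scale_scale]
  simp [ExtData.tw, extData, pow_two]

/-- The twists cancel: the derivations `X_±` and `X_z` are twisted by `K²` and `K⁴`, while moving a
function to the left past `ω_∓` and `ω_z` applies exactly these automorphisms. -/
theorem d₀_mul (x y : SUq q) : d₀ q (x * y) = d₀ q x * incl y + incl x * d₀ q y := by
  have hm (z w : SUq q) : (incl (z * scale q (qu q)⁻¹ w) * ωm q : Forms q) =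
      incl z * ωm q * incl w := by
    rw [← incl_mul_incl, mul_assoc, incl_mul_ω, tw_zero, scale_scale, mul_inv_cancel, scale_one,
      mul_assoc]
  have hp (z w : SUq q) : (incl (z * scale q (qu q)⁻¹ w) * ωp q : Forms q) =
      incl z * ωp q * incl w := by
    rw [← incl_mul_incl, mul_assoc, incl_mul_ω, tw_one, scale_scale, mul_inv_cancel, scale_one,
      mul_assoc]
  have hz (z w : SUq q) : (incl (z * scale q ((qu q)⁻¹ ^ 2) w) * ωz q : Forms q) =
      incl z * ωz q * incl w := by
    rw [← incl_mul_incl, mul_assoc, incl_mul_ω, tw_two_apply, scale_scale, ← mul_pow,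
      mul_inv_cancel, one_pow, scale_one, mul_assoc]
  simp only [d₀_apply, Xminus_mul, Xplus_mul, Xz_mul, map_add, add_mul, hm, hp, hz, mul_add]
  simp only [← incl_mul_incl, mul_assoc]
  abel

/-- The denominator of `X_z` vanishes only for `q² = 1`, which `0 < q < 1` excludes. -/
theorem one_sub_qc_ne_zero : 1 - (qc q)⁻¹ ^ 2 ≠ 0 := by
  have h1 := q.2.1
  have h2 := q.2.2
  intro h
  have h3 : (qc q) ^ 2 = 1 := by
    have := qc_ne_zero q
    field_simp at h
    linear_combination h
  rw [qc] at h3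
  have h4 : (q : ℝ) ^ 2 = 1 := by exact_mod_cast h3
  nlinarith

theorem one_sub_smul (t : ℂ) (x : SUq q) : (1 - t) • x = x - t • x := by
  rw [sub_smul, one_smul]

/-! ### The differentials of the generators -/

theorem d₀_a : d₀ q (a q) = incl (a q) * ωz q - qc q • (incl (c' q) * ωp q) := by
  have e := one_sub_qc_ne_zero q
  have h1 : Xminus q (a q) = 0 := by
    change XminusHom q (a q) 0 1 = 0
    rw [XminusHom, lift_a]; rfl
  have h2 : Xplus q (a q) = -(qc q • c' q) := by
    change XplusHom q (a q) 0 1 = _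
    rw [XplusHom, lift_a]; rfl
  have h3 : Xz q (a q) = a q := by
    rw [Xz_apply, scale_a, ← one_sub_smul, smul_smul, ← one_smul ℂ (a q), smul_smul]
    congr 1
    simpa [qu] using inv_mul_cancel₀ e
  rw [d₀_apply, h1, h2, h3]
  simp; abel

theorem d₀_c : d₀ q (c q) = incl (c q) * ωz q + incl (a' q) * ωp q := by
  have e := one_sub_qc_ne_zero q
  have h1 : Xminus q (c q) = 0 := by
    change XminusHom q (c q) 0 1 = 0
    rw [XminusHom, lift_c]; rfl
  have h2 : Xplus q (c q) = a' q := by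
    change XplusHom q (c q) 0 1 = _
    rw [XplusHom, lift_c]; rfl
  have h3 : Xz q (c q) = c q := by
    rw [Xz_apply, scale_c, ← one_sub_smul, smul_smul, ← one_smul ℂ (c q), smul_smul]
    congr 1
    simpa [qu] using inv_mul_cancel₀ e
  rw [d₀_apply, h1, h2, h3]
  simp; abel

theorem d₀_a' : d₀ q (a' q) = incl (c q) * ωm q - qc q ^ 2 • (incl (a' q) * ωz q) := by
  have e := one_sub_qc_ne_zero q
  have h1 : Xminus q (a' q) = c q := by
    change XminusHom q (a' q) 0 1 = _
    rw [XminusHom, lift_a']; rfl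
  have h2 : Xplus q (a' q) = 0 := by
    change XplusHom q (a' q) 0 1 = _
    rw [XplusHom, lift_a']; rfl
  have h3 : Xz q (a' q) = -(qc q ^ 2 • a' q) := by
    have := qc_ne_zero q
    rw [Xz_apply, scale_a', ← one_sub_smul, smul_smul, ← neg_smul]
    congr 1
    rw [inv_mul_eq_iff_eq_mul₀ e]
    simp [qu]
    field_simp
    ring
  rw [d₀_apply, h1, h2, h3]
  simp; abel

theorem d₀_c' : d₀ q (c' q) = -((qc q)⁻¹ • (incl (a q) * ωm q)) -
    qc q ^ 2 • (incl (c' q) * ωz q) := by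
  have e := one_sub_qc_ne_zero q
  have h1 : Xminus q (c' q) = -((qc q)⁻¹ • a q) := by
    change XminusHom q (c' q) 0 1 = _
    rw [XminusHom, lift_c']; rfl
  have h2 : Xplus q (c' q) = 0 := by
    change XplusHom q (c' q) 0 1 = _
    rw [XplusHom, lift_c']; rfl
  have h3 : Xz q (c' q) = -(qc q ^ 2 • c' q) := by
    have := qc_ne_zero q
    rw [Xz_apply, scale_c', ← one_sub_smul, smul_smul, ← neg_smul]
    congr 1
    rw [inv_mul_eq_iff_eq_mul₀ e]
    simp [qu]
    field_simp
    ring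
  rw [d₀_apply, h1, h2, h3]
  simp; abel

end SUq

end QuantumMeron

namespace QuantumMeron

namespace SUq

open Ext

variable (q : Set.Ioo (0 : ℝ) 1)

/-! ### Exchange relations -/

theorem ωm_ωm : ωm q * ωm q = 0 := ω_mul_self 0
theorem ωp_ωp : ωp q * ωp q = 0 := ω_mul_self 1
theorem ωz_ωz : ωz q * ωz q = 0 := ω_mul_self 2
theorem ωp_ωm : ωp q * ωm q = (-(qc q) ^ 2) • (ωm q * ωp q) := ω_mul_ω_comm (by decide)
theorem ωz_ωm : ωz q * ωm q = (-(qc q) ^ 4) • (ωm q * ωz q) := ω_mul_ω_comm (by decide)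
theorem ωz_ωp : ωz q * ωp q = (-(qc q)⁻¹ ^ 4) • (ωp q * ωz q) := ω_mul_ω_comm (by decide)

theorem ωm_ωm_mul (x : Forms q) : ωm q * (ωm q * x) = 0 := by
  rw [← mul_assoc, ωm_ωm, zero_mul]
theorem ωp_ωp_mul (x : Forms q) : ωp q * (ωp q * x) = 0 := by
  rw [← mul_assoc, ωp_ωp, zero_mul]
theorem ωp_ωm_mul (x : Forms q) :
    ωp q * (ωm q * x) = (-(qc q) ^ 2) • (ωm q * (ωp q * x)) := by
  rw [← mul_assoc, ωp_ωm, smul_mul_assoc, mul_assoc]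
theorem ωz_ωm_mul (x : Forms q) :
    ωz q * (ωm q * x) = (-(qc q) ^ 4) • (ωm q * (ωz q * x)) := by
  rw [← mul_assoc, ωz_ωm, smul_mul_assoc, mul_assoc]
theorem ωz_ωp_mul (x : Forms q) :
    ωz q * (ωp q * x) = (-(qc q)⁻¹ ^ 4) • (ωp q * (ωz q * x)) := by
  rw [← mul_assoc, ωz_ωp, smul_mul_assoc, mul_assoc]

theorem ω_mul_incl {t : ℂˣ} {i : Fin 3} {x : SUq q} (h : (extData q).tw {i} x = (t : ℂ) • x) :
    (ω i * incl x : Forms q) = ((t⁻¹ : ℂˣ) : ℂ) • (incl x * ω i) := by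
  rw [incl_mul_ω, h, map_smul, mul_smul_comm, smul_smul, Units.inv_mul, one_smul]

/-- The generators `a` and `c` have weight `t`, and `a*` and `c*` weight `t⁻¹`. -/
theorem tw_generators (i : Fin 3) : ∃ t : ℂˣ, (t : ℂ) = ![qc q, qc q, qc q ^ 2] i ∧
    (extData q).tw {i} (a q) = (t : ℂ) • a q ∧ (extData q).tw {i} (c q) = (t : ℂ) • c q ∧
    (extData q).tw {i} (a' q) = ((t⁻¹ : ℂˣ) : ℂ) • a' q ∧
    (extData q).tw {i} (c' q) = ((t⁻¹ : ℂˣ) : ℂ) • c' q := by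
  fin_cases i
  · refine ⟨qu q, rfl, ?_⟩
    simp only [Fin.zero_eta, tw_zero, scale_a, scale_a', scale_c, scale_c', true_and]
  · refine ⟨qu q, rfl, ?_⟩
    simp only [Fin.mk_one, tw_one, scale_a, scale_a', scale_c, scale_c', true_and]
  · refine ⟨qu q ^ 2, by simp [qu], ?_⟩
    simp only [Fin.reduceFinMk, tw_two_apply, scale_a, scale_a', scale_c, scale_c', true_and]

/-- Commuting a generator past an invariant one-form multiplies it by a scalar. -/
theorem ω_mul_incl_generators (i : Fin 3) :
    ((ω i * incl (a q) : Forms q) = (![qc q, qc q, qc q ^ 2] i)⁻¹ • (incl (a q) * ω i)) ∧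
    ((ω i * incl (c q) : Forms q) = (![qc q, qc q, qc q ^ 2] i)⁻¹ • (incl (c q) * ω i)) ∧
    ((ω i * incl (a' q) : Forms q) = (![qc q, qc q, qc q ^ 2] i) • (incl (a' q) * ω i)) ∧
    ((ω i * incl (c' q) : Forms q) = (![qc q, qc q, qc q ^ 2] i) • (incl (c' q) * ω i)) := by
  obtain ⟨t, ht, h1, h2, h3, h4⟩ := tw_generators q i
  rw [← ht]
  refine ⟨?_, ?_, ?_, ?_⟩
  · simpa using ω_mul_incl q h1
  · simpa using ω_mul_incl q h2
  · simpa using ω_mul_incl q h3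
  · simpa using ω_mul_incl q h4

theorem ωm_a : ωm q * incl (a q) = (qc q)⁻¹ • (incl (a q) * ωm q) :=
  (ω_mul_incl_generators q 0).1
theorem ωm_c : ωm q * incl (c q) = (qc q)⁻¹ • (incl (c q) * ωm q) :=
  (ω_mul_incl_generators q 0).2.1
theorem ωm_a' : ωm q * incl (a' q) = qc q • (incl (a' q) * ωm q) :=
  (ω_mul_incl_generators q 0).2.2.1
theorem ωm_c' : ωm q * incl (c' q) = qc q • (incl (c' q) * ωm q) :=
  (ω_mul_incl_generators q 0).2.2.2
theorem ωp_a : ωp q * incl (a q) = (qc q)⁻¹ • (incl (a q) * ωp q) :=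
  (ω_mul_incl_generators q 1).1
theorem ωp_c : ωp q * incl (c q) = (qc q)⁻¹ • (incl (c q) * ωp q) :=
  (ω_mul_incl_generators q 1).2.1
theorem ωp_a' : ωp q * incl (a' q) = qc q • (incl (a' q) * ωp q) :=
  (ω_mul_incl_generators q 1).2.2.1
theorem ωp_c' : ωp q * incl (c' q) = qc q • (incl (c' q) * ωp q) :=
  (ω_mul_incl_generators q 1).2.2.2
theorem ωz_a : ωz q * incl (a q) = (qc q ^ 2)⁻¹ • (incl (a q) * ωz q) :=
  (ω_mul_incl_generators q 2).1
theorem ωz_c : ωz q * incl (c q) = (qc q ^ 2)⁻¹ • (incl (c q) * ωz q) :=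
  (ω_mul_incl_generators q 2).2.1
theorem ωz_a' : ωz q * incl (a' q) = qc q ^ 2 • (incl (a' q) * ωz q) :=
  (ω_mul_incl_generators q 2).2.2.1
theorem ωz_c' : ωz q * incl (c' q) = qc q ^ 2 • (incl (c' q) * ωz q) :=
  (ω_mul_incl_generators q 2).2.2.2

theorem mul_mul_of_eq_smul {x y : Forms q} {t : ℂ} (h : x * y = t • (y * x)) (w : Forms q) :
    x * (y * w) = t • (y * (x * w)) := by
  rw [← mul_assoc, h, smul_mul_assoc, mul_assoc]

/-! ### The Maurer-Cartan forms -/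

theorem mc_zero : mc q 0 = ((qc q) ^ 2 * (1 + (qc q) ^ 2)) • (ωm q * ωz q) := rfl
theorem mc_one : mc q 1 = -((1 + (qc q)⁻¹ ^ 2) • (ωp q * ωz q)) := rfl
theorem mc_two : mc q 2 = -(ωm q * ωp q) := rfl

theorem mc_mem (i : Fin 3) : mc q i ∈ gr (extData q) 2 := by
  have h (i j : Fin 3) : (ω i * ω j : Forms q) ∈ gr (extData q) 2 :=
    SetLike.mul_mem_graded (ω_mem i) (ω_mem j)
  fin_cases i
  · exact Submodule.smul_mem _ _ (h _ _)
  · exact Submodule.neg_mem _ (Submodule.smul_mem _ _ (h _ _))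
  · exact Submodule.neg_mem _ (h _ _)

/-- Compatibility of the Maurer-Cartan equations with the exchange relations: products of two basic
one-forms are closed. -/
theorem mc_mul_ω (i j : Fin 3) : mc q j * ω i = ω j * mc q i := by
  have hq := qc_ne_zero q
  fin_cases i <;> fin_cases j <;>
    simp only [Fin.zero_eta, Fin.mk_one, Fin.reduceFinMk, mc_zero, mc_one, mc_two, smul_mul_assoc,
      mul_smul_comm, neg_mul, mul_neg, mul_assoc, ωm_ωm, ωp_ωp, ωz_ωz, ωp_ωm, ωz_ωm, ωz_ωp,
      ωm_ωm_mul, ωp_ωp_mul, ωp_ωm_mul, ωz_ωm_mul, ωz_ωp_mul, mul_zero, smul_zero,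
      neg_zero] <;>
    (try match_scalars) <;> field_simp <;> ring

/-- The degree is at least four, and the exterior algebra has three generators. -/
theorem mc_mul_monomial (j : Fin 3) (S : Finset (Fin 3)) (hS : 2 ≤ S.card) :
    mc q j * monomial S 1 = 0 := by
  have h := SetLike.mul_mem_graded (mc_mem q j) (monomial_mem (D := extData q) S 1)
  rwa [gr_eq_bot (by omega), Submodule.mem_bot] at h

/-- The multiplicative step of `mc_mul_tw`, isolated as an identity in an arbitrary ring: `w` stands
for `ω_j`, `m` for its differential, and primes for twisted functions. -/
theorem twisted_leibniz_mul {R : Type} [Ring R] {m w x y dx dy x' y' dx' dy' : R}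
    (hx : m * x' - w * dx' = dx * w + x * m) (hy : m * y' - w * dy' = dy * w + y * m)
    (cx : x * w = w * x') (cy : y * w = w * y') :
    m * (x' * y') - w * (dx' * y' + x' * dy') = (dx * y + x * dy) * w + x * y * m := by
  linear_combination (norm := noncomm_ring) hx * y' + x * hy + cx * dy' - dx * cy

/-- The two sides are the values that the Leibniz rule prescribes for `d` on the two sides of `ω_j
κ^{w j}(x) = x ω_j`. The set of `x` for which they agree is closed under sums and products, which
leaves the four generators. -/
theorem mc_mul_tw (j : Fin 3) (x : SUq q) :
    mc q j * incl ((extData q).tw {j} x) - ω j * d₀ q ((extData q).tw {j} x) =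
      d₀ q x * ω j + incl x * mc q j := by
  have hq := qc_ne_zero q
  induction x using SUq.induction with
  | hz z =>
    -- Applying the Leibniz rule to `1 · 1` shows that constants are closed.
    have h1 : d₀ q (algebraMap ℂ _ z) = 0 := by
      have h := d₀_mul q 1 1
      rw [mul_one, incl_one, mul_one, one_mul] at h
      rw [Algebra.algebraMap_eq_smul_one, map_smul, left_eq_add.1 h, smul_zero]
    rw [AlgHom.commutes, h1, Algebra.algebraMap_eq_smul_one, map_smul, incl_one]
    simp
  | hadd x y hx hy =>
    simp only [map_add, mul_add, add_mul]
    rw [add_sub_add_comm, hx, hy]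
    abel
  | hm x y hx hy =>
    rw [map_mul, d₀_mul, d₀_mul, ← incl_mul_incl, ← incl_mul_incl]
    exact twisted_leibniz_mul hx hy (incl_mul_ω j x) (incl_mul_ω j y)
  | _ =>
    -- Each generator is an eigenvector of the twist, so the identity becomes a comparison of scalar
    -- coefficients after ordering all products.
    obtain ⟨t, ht, h1, h2, h3, h4⟩ := tw_generators q j
    first | rw [h1] | rw [h2] | rw [h3] | rw [h4]
    rw [map_smul, map_smul, mul_smul_comm, mul_smul_comm]
    first | rw [d₀_a] | rw [d₀_c] | rw [d₀_a'] | rw [d₀_c']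
    try rw [Units.val_inv_eq_inv_val]
    rw [ht]
    fin_cases j <;>
    simp only [Fin.zero_eta, Fin.mk_one, Fin.reduceFinMk, mc_zero, mc_one, mc_two, smul_mul_assoc,
      mul_smul_comm, neg_mul, mul_neg, mul_assoc, ωm_ωm, ωp_ωp, ωz_ωz, ωp_ωm, ωz_ωm, ωz_ωp,
      ωm_ωm_mul, ωp_ωp_mul, ωp_ωm_mul, ωz_ωm_mul, ωz_ωp_mul, mul_zero, smul_zero,
      neg_zero, ωm_a, ωm_c, ωm_a', ωm_c', ωp_a, ωp_c, ωp_a', ωp_c', ωz_a, ωz_c, ωz_a', ωz_c',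
      mul_mul_of_eq_smul q (ωm_a q), mul_mul_of_eq_smul q (ωm_c q), mul_mul_of_eq_smul q (ωm_a' q),
      mul_mul_of_eq_smul q (ωm_c' q), mul_mul_of_eq_smul q (ωp_a q), mul_mul_of_eq_smul q (ωp_c q),
      mul_mul_of_eq_smul q (ωp_a' q), mul_mul_of_eq_smul q (ωp_c' q), mul_mul_of_eq_smul q (ωz_a q),
      mul_mul_of_eq_smul q (ωz_c q), mul_mul_of_eq_smul q (ωz_a' q), mul_mul_of_eq_smul q (ωz_c' q),
      mul_add, add_mul, mul_sub, sub_mul, smul_add, smul_sub, smul_neg, Matrix.cons_val] <;>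
    match_scalars <;> field_simp <;> ring

/-! ### Graded Leibniz rules and vanishing of the square of the differential -/

variable (α β γ : ℝ)

theorem d_ω_mul (j : Fin 3) (f : Forms q) : (calculus q α β γ).d (ω j * f) =
    mc q j * f - ω j * (calculus q α β γ).d f :=
  extCalculus_d_ω_mul (mc_mul_ω q) (mc_mul_monomial q) j f

theorem d_incl (x : SUq q) : (calculus q α β γ).d (incl x) = d₀ q x := extCalculus_d_incl x

theorem d_incl_mul (x : SUq q) (f : Forms q) : (calculus q α β γ).d (incl x * f) =
    d₀ q x * f + incl x * (calculus q α β γ).d f :=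
  extCalculus_d_incl_mul (mc_mul_ω q) (mc_mul_monomial q) (d₀_mul q) (mc_mul_tw q) x f

theorem d_one : (calculus q α β γ).d 1 = 0 := by
  have h := d_incl_mul q α β γ 1 1
  rw [incl_one, one_mul, mul_one, one_mul, ← d_incl q α β γ, incl_one] at h
  exact left_eq_add.1 h

theorem d_ω (j : Fin 3) : (calculus q α β γ).d (ω j) = mc q j := by
  have h := d_ω_mul q α β γ j 1
  rwa [mul_one, d_one, mul_zero, sub_zero, mul_one] at h

theorem d_mc_mul (j : Fin 3) (f : Forms q) :
    (calculus q α β γ).d (mc q j * f) = mc q j * (calculus q α β γ).d f := by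
  -- The two Maurer-Cartan terms cancel by `mc_mul_ω`, and each `mc q j` is a multiple of such a
  -- product.
  have h (i j : Fin 3) : (calculus q α β γ).d (ω i * ω j * f) =
      ω i * ω j * (calculus q α β γ).d f := by
    rw [mul_assoc, d_ω_mul, d_ω_mul, mul_sub, ← mul_assoc, ← mul_assoc, mc_mul_ω]
    simp only [mul_assoc]
    abel
  fin_cases j
  · simp only [Fin.zero_eta, mc_zero, smul_mul_assoc, map_smul, h]
  · simp only [Fin.mk_one, mc_one, neg_mul, smul_mul_assoc, map_smul, map_neg, h]
  · simp only [Fin.reduceFinMk, mc_two, neg_mul, map_neg, h]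

theorem d_d₀ (x : SUq q) : (calculus q α β γ).d (d₀ q x) = 0 := by
  have hq := qc_ne_zero q
  induction x using SUq.induction with
  | hz z =>
    rw [← d_incl q α β γ, Algebra.algebraMap_eq_smul_one, map_smul, incl_one, map_smul, d_one]
    simp
  | hadd x y hx hy => rw [map_add, map_add, hx, hy, add_zero]
  | hm x y hx hy =>
    -- This cancels against the term `dx dy` coming from `d(x dy)`; the other contributions vanish
    -- by the induction hypotheses.
    have h : (calculus q α β γ).d (d₀ q x * incl y) = -(d₀ q x * d₀ q y) := by
      have h (z : SUq q) (j : Fin 3) : (calculus q α β γ).d (incl z * ω j * incl y) =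
          (calculus q α β γ).d (incl z * ω j) * incl y - incl z * ω j * d₀ q y := by
        rw [mul_assoc, d_incl_mul, d_ω_mul, d_incl_mul, d_ω, d_incl]
        noncomm_ring
      have h' : (calculus q α β γ).d (d₀ q x * incl y) =
          (calculus q α β γ).d (d₀ q x) * incl y - d₀ q x * d₀ q y := by
        rw [d₀_apply, add_mul, add_mul, map_add, map_add, h, h, h, map_add, map_add]
        noncomm_ring
      rw [h', hx, zero_mul, zero_sub]
    rw [d₀_mul, map_add, h, d_incl_mul, hy, mul_zero, add_zero, neg_add_cancel]
  | _ =>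
    first | rw [d₀_a] | rw [d₀_c] | rw [d₀_a'] | rw [d₀_c']
    simp only [map_add, map_sub, map_neg, map_smul, d_incl_mul, d_ω, d₀_a, d₀_c, d₀_a', d₀_c',
      mc_zero, mc_one, mc_two, smul_mul_assoc,
      mul_smul_comm, neg_mul, mul_neg, mul_assoc, ωm_ωm, ωp_ωp, ωz_ωz, ωp_ωm, ωz_ωm, ωz_ωp,
      mul_zero, smul_zero,
      neg_zero, mul_add, add_mul, mul_sub, sub_mul, smul_add, smul_sub, smul_neg]
    match_scalars <;> field_simp <;> ring

theorem d_d (f : Forms q) : (calculus q α β γ).d ((calculus q α β γ).d f) = 0 :=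
  extCalculus_d_d (mc_mul_ω q) (mc_mul_monomial q) (d_mc_mul q α β γ) (d_d₀ q α β γ) f

theorem d_mem (k : ℕ) (f : Forms q) (hf : f ∈ gr (extData q) k) :
    (calculus q α β γ).d f ∈ gr (extData q) (k + 1) := by
  have h (x : SUq q) (j : Fin 3) : (incl x * ω j : Forms q) ∈ gr (extData q) 1 := by
    rw [incl_mul_ω, ω, ← monomial_eq]
    exact monomial_mem {j} _
  have h' (x : SUq q) : d₀ q x ∈ gr (extData q) 1 :=
    (gr (extData q) 1).add_mem ((gr (extData q) 1).add_mem (h _ _) (h _ _)) (h _ _)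
  exact extCalculus_d_mem (mc_mem q) h' hf

end SUq

end QuantumMeron

namespace QuantumMeron

namespace SUq

open Ext

variable (q : Set.Ioo (0 : ℝ) 1) {α β γ : ℝ}

/-! ### The Hodge operator and the curvature on `SU_q(2)` -/

theorem one_add_qc_ne_zero : 1 + qc q ^ 2 ≠ 0 := by
  intro h
  have h1 : (1 : ℝ) + (q : ℝ) ^ 2 = 0 := by rw [qc] at h; exact_mod_cast h
  nlinarith [sq_nonneg (q : ℝ)]

theorem gram_ne_zero (hα : α ≠ 0) (hβ : β ≠ 0) (hγ : γ ≠ 0) (S : Finset (Fin 3)) :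
    gram q α β γ S ≠ 0 := by
  have h1 := one_add_qc_ne_zero q
  have h2 := qc_ne_zero q
  have hα' : (α : ℂ) ≠ 0 := Complex.ofReal_ne_zero.2 hα
  have hβ' : (β : ℂ) ≠ 0 := Complex.ofReal_ne_zero.2 hβ
  have hγ' : (γ : ℂ) ≠ 0 := Complex.ofReal_ne_zero.2 hγ
  unfold gram
  split_ifs <;> first | assumption | simp [*]

theorem adj_mem (i : Fin 3) :
    (![-ωp q, -ωm q, -ωz q] : Fin 3 → Forms q) i ∈ gr (extData q) 1 := by
  fin_cases i <;> exact Submodule.neg_mem _ (ω_mem _)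

/-- The orthogonal frame of the calculus on `SU_q(2)`. -/
def frame (hα : α ≠ 0) (hβ : β ≠ 0) (hγ : γ ≠ 0) :
    Frame (calculus q α β γ) (Finset (Fin 3)) :=
  extFrame (extData q) (d₀ q) (mc q) (adj_mem q) (gram_ne_zero q hα hβ hγ)

theorem conj_monomial_one (S : Finset (Fin 3)) : (calculus q α β γ).conj (monomial S 1) =
    conjMonomial ![-ωp q, -ωm q, -ωz q] S := by
  change ∑ T, incl (star ((monomial S 1 : Forms q).coef T)) * conjMonomial _ T = _
  rw [Finset.sum_eq_single S]
  · rw [coef_monomial, if_pos rfl, star_one, incl_one, one_mul]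
  · intro T _ h
    rw [coef_monomial, if_neg h, star_zero, map_zero, zero_mul]
  · simp

theorem conj_mp : (calculus q α β γ).conj (ωm q * ωp q) = -(ωm q * ωp q) := by
  rw [ω_mul_ω (by decide), conj_monomial_one, conjMonomial,
    show ({0, 1} : Finset (Fin 3)).sort (· ≤ ·) = [0, 1] by rw [Finset.sort_insert] <;> simp]
  simp [ω_mul_ω]

theorem conj_mz : (calculus q α β γ).conj (ωm q * ωz q) =
    (qc q)⁻¹ ^ 4 • (ωp q * ωz q) := by
  rw [ω_mul_ω (by decide), conj_monomial_one, conjMonomial,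
    show ({0, 2} : Finset (Fin 3)).sort (· ≤ ·) = [0, 2] by rw [Finset.sort_insert] <;> simp]
  simp [ωz_ωp]

theorem conj_pz : (calculus q α β γ).conj (ωp q * ωz q) =
    (qc q) ^ 4 • (ωm q * ωz q) := by
  rw [ω_mul_ω (by decide), conj_monomial_one, conjMonomial,
    show ({1, 2} : Finset (Fin 3)).sort (· ≤ ·) = [1, 2] by rw [Finset.sort_insert] <;> simp]
  simp [ωz_ωm]

/-- The factors are already in increasing order, so no scalar appears. -/
theorem mpz : ωm q * (ωp q * ωz q) = monomial Finset.univ 1 := by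
  rw [ω_mul_ω (by decide)]
  exact (ω_mul_monomial (by decide) 1).trans (by congr 1)

variable (hα : α ≠ 0) (hβ : β ≠ 0) (hγ : γ ≠ 0)

/-- The dual of a two-form is a one-form, and its coefficients are the densities of `ξ* ∧ ω_i`
divided by `(ω_i, ω_i)`. Each basic two-form pairs with a single `ω_j`. Only the squared lengths of
one-forms enter here. -/
theorem hodge_eq {ξ : Forms q} {j : Fin 3} {z : ℂ} (hξ : ξ ∈ gr (extData q) 2)
    (h : ∀ i, (calculus q α β γ).conj ξ * ω i =
      if i = j then z • monomial Finset.univ 1 else 0) :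
    (frame q hα hβ hγ).hodge ξ = (starRingEnd ℂ (z * (gram q α β γ {j})⁻¹)) • ω j := by
  refine (frame q hα hβ hγ).ext_coord fun S => ?_
  by_cases hS : ∃ i, S = {i}
  · obtain ⟨i, rfl⟩ := hS
    rw [Frame.coord_hodge]
    change star (((calculus q α β γ).conj ξ * ω i).coef Finset.univ *
      algebraMap ℂ (SUq q) (gram q α β γ {i})⁻¹) =
        (starRingEnd ℂ (z * (gram q α β γ {j})⁻¹)) • (monomial {j} 1 : Forms q).coef {i}
    rw [h, coef_monomial]
    by_cases hij : i = j
    · subst hij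
      rw [if_pos rfl, if_pos rfl, coef_smul, coef_monomial, if_pos rfl, smul_mul_assoc, one_mul,
        Algebra.algebraMap_eq_smul_one, smul_smul, star_smul, star_one]
      rfl
    · rw [if_neg hij, if_neg (by simpa using hij), coef_zero, zero_mul, star_zero, smul_zero]
  · have h1 : S.card ≠ 1 := fun h => hS (Finset.card_eq_one.1 h)
    rw [(frame q hα hβ hγ).coord_eq_zero
      ((frame q hα hβ hγ).isHodge_hodge.map_mem 2 (Nat.le_succ 2) ξ hξ) h1,
      (frame q hα hβ hγ).coord_eq_zero (Submodule.smul_mem _ _ (ω_mem j)) h1]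

theorem ω_mul_ω_mem (i j : Fin 3) : (ω i * ω j : Forms q) ∈ gr (extData q) 2 :=
  SetLike.mul_mem_graded (ω_mem i) (ω_mem j)

theorem hodge_mp : (frame q hα hβ hγ).hodge (ωm q * ωp q) = -((γ : ℂ)⁻¹ • ωz q) := by
  rw [hodge_eq q hα hβ hγ (j := 2) (z := -1) (ω_mul_ω_mem q 0 1)]
  · simp [gram]
  · intro i
    rw [conj_mp, ← mpz]
    fin_cases i <;> simp [mul_assoc, ωp_ωm, ωp_ωp, ωm_ωm_mul]

theorem hodge_mz : (frame q hα hβ hγ).hodge (ωm q * ωz q) =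
    (qc q ^ 2 * (β : ℂ)⁻¹) • ωm q := by
  have hq := qc_ne_zero q
  have hq' : (starRingEnd ℂ) (qc q) = qc q := Complex.conj_ofReal _
  -- The adjoint contributes `q⁻⁴`, and ordering `ω_+ ω_z ω_-` contributes `(-q⁴)(-q²) = q⁶`;
  -- together they give `q²`.
  rw [hodge_eq q hα hβ hγ (j := 0) (z := qc q ^ 2) (ω_mul_ω_mem q 0 2)]
  · simp [gram, hq']
  · intro i
    rw [conj_mz, ← mpz]
    fin_cases i <;> simp [mul_assoc, ωz_ωm, ωz_ωp, ωz_ωz, ωp_ωm_mul, ωp_ωp_mul, smul_smul]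
    congr 1
    field_simp

theorem hodge_pz : (frame q hα hβ hγ).hodge (ωp q * ωz q) = -((α : ℂ)⁻¹ • ωp q) := by
  have hq := qc_ne_zero q
  rw [hodge_eq q hα hβ hγ (j := 1) (z := -1) (ω_mul_ω_mem q 1 2)]
  · simp [gram]
  · intro i
    rw [conj_pz, ← mpz]
    fin_cases i <;> simp [mul_assoc, ωz_ωm, ωz_ωp, ωz_ωz, ωm_ωm_mul, smul_smul, hq]

/-- The curvature of the potential. -/
def curvature : Matrix (Fin 2) (Fin 2) (Forms q) :=
  (1 / 4 : ℂ) • !![-(ωm q * ωp q), (qc q ^ 2 * (1 + qc q ^ 2)) • (ωm q * ωz q);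
    -((1 + (qc q)⁻¹ ^ 2) • (ωp q * ωz q)), qc q ^ 2 • (ωm q * ωp q)]

/-- With `potential_mul_potential` this expresses flatness of twice the potential: the linear term
is `2F` and the quadratic one `-F`, so the half potential has curvature `F`. -/
theorem map_d_potential : (potential q (1 / 2)).map (calculus q α β γ).d =
    (2 : ℂ) • curvature q := by
  ext1 i j
  fin_cases i <;> fin_cases j <;>
    simp [potential, curvature, d_ω, mc_zero, mc_one, mc_two, smul_smul] <;>
    match_scalars <;> ring

theorem potential_mul_potential :
    potential q (1 / 2) * potential q (1 / 2) = -curvature q := by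
  have hq := qc_ne_zero q
  ext1 i j
  fin_cases i <;> fin_cases j <;>
    simp [potential, curvature, Matrix.mul_apply, Fin.sum_univ_two, smul_smul, ωm_ωm, ωp_ωp,
      ωz_ωz, ωp_ωm, ωz_ωm, ωz_ωp, mul_smul_comm, smul_mul_assoc] <;>
    match_scalars <;> field_simp <;> ring

theorem curvature_eq : (potential q (1 / 2)).map (calculus q α β γ).d +
    potential q (1 / 2) * potential q (1 / 2) = curvature q := by
  rw [map_d_potential, potential_mul_potential, two_smul, add_neg_cancel_right]

theorem curvature_mem (i j : Fin 2) : curvature q i j ∈ gr (extData q) 2 := by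
  refine Submodule.smul_mem _ _ ?_
  fin_cases i <;> fin_cases j
  · exact Submodule.neg_mem _ (ω_mul_ω_mem q 0 1)
  · exact Submodule.smul_mem _ _ (ω_mul_ω_mem q 0 2)
  · exact Submodule.neg_mem _ (Submodule.smul_mem _ _ (ω_mul_ω_mem q 1 2))
  · exact Submodule.smul_mem _ _ (ω_mul_ω_mem q 0 1)

theorem potential_mem (ε : ℂ) (i j : Fin 2) : potential q ε i j ∈ gr (extData q) 1 := by
  refine Submodule.smul_mem _ _ ?_
  fin_cases i <;> fin_cases j
  · exact ω_mem 2
  · exact ω_mem 0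
  · exact ω_mem 1
  · exact Submodule.neg_mem _ (Submodule.smul_mem _ _ (ω_mem 2))

/-- The diagonal entries give the factor `1/γ`, the others `(1 + q⁻²)/α` and `q⁴(1 + q²)/β`. The
hypotheses `h₁` and `h₂` make the three equal. -/
theorem map_hodge_curvature (h₁ : (1 + (q : ℝ)⁻¹ ^ 2) * γ = α) (h₂ : α = (q : ℝ)⁻¹ ^ 6 * β) :
    (curvature q).map (frame q hα hβ hγ).hodge = (1 / (2 * γ) : ℂ) • potential q (1 / 2) := by
  have hq := qc_ne_zero q
  have h1 := one_add_qc_ne_zero q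
  have hγ' : (γ : ℂ) ≠ 0 := Complex.ofReal_ne_zero.2 hγ
  have e1 : (α : ℂ) = (1 + (qc q)⁻¹ ^ 2) * γ := by rw [← h₁, qc]; push_cast; rfl
  have e2 : (β : ℂ) = qc q ^ 6 * ((1 + (qc q)⁻¹ ^ 2) * γ) := by
    rw [← e1, h₂]
    have : (q : ℂ) ≠ 0 := hq
    rw [qc]; push_cast
    field_simp
  have h1' : qc q ^ 2 + 1 ≠ 0 := by rwa [add_comm]
  ext1 i j
  fin_cases i <;> fin_cases j <;>
    simp [potential, curvature, hodge_mp, hodge_mz, hodge_pz, smul_smul, e1, e2] <;>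
    match_scalars <;> field_simp <;> ring

theorem d_potential_mul (ε : ℂ) (i j : Fin 2) (η : Forms q) :
    (calculus q α β γ).d (potential q ε i j * η) =
      (calculus q α β γ).d (potential q ε i j) * η -
        potential q ε i j * (calculus q α β γ).d η := by
  fin_cases i <;> fin_cases j <;>
    simp [potential, smul_mul_assoc, d_ω_mul, d_ω, smul_sub, sub_eq_add_neg] <;>
    abel

theorem isCurvature_curvature : (calculus q α β γ).IsCurvature (potential q (1 / 2))
    (curvature q) := by
  rw [← curvature_eq (α := α) (β := β) (γ := γ)]
  refine HermCalculus.isCurvature_map_d_add_mul (d_d q α β γ) (d_potential_mul q _) fun i j => ?_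
  rw [curvature_eq]
  exact curvature_mem q i j

/-- The identity `dA + 2A² = 0`, to which the Yang-Mills equations on `SU_q(2)` and on the warped
product both reduce. -/
theorem d_add_potential_mul : (potential q (1 / 2)).map (calculus q α β γ).d +
    (potential q (1 / 2) * potential q (1 / 2) + potential q (1 / 2) * potential q (1 / 2)) = 0 := by
  rw [map_d_potential, potential_mul_potential, two_smul]
  abel

theorem solvesYangMills (h₁ : (1 + (q : ℝ)⁻¹ ^ 2) * γ = α) (h₂ : α = (q : ℝ)⁻¹ ^ 6 * β) :
    (calculus q α β γ).SolvesYangMills (frame q hα hβ hγ).hodge (potential q (1 / 2)) := by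
  refine ⟨curvature q, isCurvature_curvature q, ?_⟩
  rw [map_hodge_curvature q hα hβ hγ h₁ h₂]
  -- The dual of the curvature has degree `3 - 2 = 1`, so the graded commutator with `A` is `A² +
  -- A²`.
  refine HermCalculus.covDeriv_eq_zero (k := 1) (fun i j η => ?_) ?_
  · simp only [Matrix.smul_apply, smul_mul_assoc, map_smul, d_potential_mul]
    simp [smul_sub, sub_eq_add_neg]
  · have h := d_add_potential_mul q (α := α) (β := β) (γ := γ)
    have e : ((1 / (2 * γ) : ℂ) • potential q (1 / 2)).map (calculus q α β γ).d =
        (1 / (2 * γ) : ℂ) • (potential q (1 / 2)).map (calculus q α β γ).d := by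
      ext1 i j; simp
    rw [e, mul_smul_comm, smul_mul_assoc, ← smul_add, smul_comm, pow_one, neg_one_smul,
      ← sub_eq_zero, ← smul_sub, sub_neg_eq_add, add_assoc, h, smul_zero]

/-! ### The invariant one-forms -/

/-- The coefficient of `ω_z` is `a* a + c* c = 1`, and those of `ω_+` cancel by the commutation of
`c*` and `a*`. The formulas for `ω_∓` follow in the same way. -/
theorem ωz_eq : ωz q = incl (a' q) * d₀ q (a q) + incl (c' q) * d₀ q (c q) := by
  rw [d₀_a, d₀_c]
  simp only [mul_add, mul_sub, mul_smul_comm, ← mul_assoc, incl_mul_incl, rel6, map_smul,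
    smul_mul_assoc]
  have h : (incl (a' q * a q) * ωz q + incl (c' q * c q) * ωz q : Forms q) = ωz q := by
    rw [← add_mul, ← map_add, rel5, incl_one, one_mul]
  refine h.symm.trans ?_
  abel

theorem ωm_eq : ωm q = incl (c' q) * d₀ q (a' q) - qc q • (incl (a' q) * d₀ q (c' q)) := by
  have hq := qc_ne_zero q
  rw [d₀_a', d₀_c']
  have h : (incl (a' q * a q) * ωm q + incl (c' q * c q) * ωm q : Forms q) = ωm q := by
    rw [← add_mul, ← map_add, rel5, incl_one, one_mul]
  simp only [mul_add, mul_sub, mul_neg, mul_smul_comm, ← mul_assoc, incl_mul_incl, rel6, map_smul,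
    smul_mul_assoc]
  refine h.symm.trans ?_
  match_scalars <;> field_simp <;> ring

theorem ωp_eq : ωp q = incl (a q) * d₀ q (c q) - qc q • (incl (c q) * d₀ q (a q)) := by
  have hq := qc_ne_zero q
  rw [d₀_a, d₀_c]
  have h : (incl (a q * a' q) * ωp q + qc q ^ 2 • (incl (c' q * c q) * ωp q) : Forms q) =
      ωp q := by
    rw [← smul_mul_assoc, ← map_smul, ← add_mul, ← map_add, rel1, incl_one, one_mul]
  simp only [mul_add, mul_sub, mul_neg, mul_smul_comm, ← mul_assoc, incl_mul_incl, rel7, rel4,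
    map_smul, smul_mul_assoc]
  refine h.symm.trans ?_
  match_scalars <;> ring

end SUq

end QuantumMeron

namespace QuantumMeron

/-! ### The identification of `GL_q(1, ℍ)` with the product -/

namespace SUq

variable (q : Set.Ioo (0 : ℝ) 1)

/-- The adjoint as an algebra morphism into the conjugate opposite algebra. -/
def conjHom : SUq q →ₐ[ℂ] ConjOp (SUq q) :=
  Presented.lift (rel := SURel (qc q)) (fun x => ConjOp.op (vals (a' q) (a q) (c' q) (c q) x))
    (conj_rel q)

theorem conjHom_gen (x : SUGen) : conjHom q (Presented.gen (SURel (qc q)) x) =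
    ConjOp.op (vals (a' q) (a q) (c' q) (c q) x) :=
  (Presented.lift_mk _ _ _).trans (FreeAlgebra.lift_ι_apply _ _)

theorem star_a : star (a q) = a' q := congrArg ConjOp.unop (conjHom_gen q .a)
theorem star_a' : star (a' q) = a q := congrArg ConjOp.unop (conjHom_gen q .a')
theorem star_c : star (c q) = c' q := congrArg ConjOp.unop (conjHom_gen q .c)
theorem star_c' : star (c' q) = c q := congrArg ConjOp.unop (conjHom_gen q .c')

end SUq

/-! ### Central elements, relations and the splitting of `GL_q(1, ℍ)` -/

namespace GLq

variable {q : Set.Ioo (0 : ℝ) 1}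

theorem star_gen (x : GLGen) : star (gen q x) = adj q x := by
  change (conjHom q (gen q x)).unop = _
  rw [conjHom_gen, ConjOp.unop_op]

theorem induction {P : GLq q → Prop} (hz : ∀ z, P (algebraMap ℂ _ z)) (hg : ∀ x, P (gen q x))
    (hm : ∀ x y, P x → P y → P (x * y))
    (hadd : ∀ x y, P x → P y → P (x + y)) (x : GLq q) : P x := by
  obtain ⟨p, rfl⟩ := RingQuot.mkAlgHom_surjective ℂ (GLRel (qc q)) x
  induction p using FreeAlgebra.induction with
  | grade0 z => rw [AlgHom.commutes]; exact hz z
  | grade1 x => exact hg x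
  | mul x y hx hy => rw [map_mul]; exact hm _ _ hx hy
  | add x y hx hy => rw [map_add]; exact hadd _ _ hx hy

theorem algHom_ext {B : Type} [Ring B] [Algebra ℂ B] {f g : GLq q →ₐ[ℂ] B}
    (h : ∀ x, f (gen q x) = g (gen q x)) : f = g := by
  refine AlgHom.ext fun x => ?_
  induction x using GLq.induction with
  | hz z => rw [AlgHom.commutes, AlgHom.commutes]
  | hg x => exact h x
  | hm x y hx hy => rw [map_mul, map_mul, hx, hy]
  | hadd x y hx hy => rw [map_add, map_add, hx, hy]

theorem commute_r (x : GLq q) : Commute (r q) x := by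
  induction x using GLq.induction with
  | hz z => exact (Algebra.commutes z _).symm
  | hg x => exact r_comm q x
  | hm x y hx hy => exact hx.mul_right hy
  | hadd x y hx hy => exact hx.add_right hy

theorem commute_ri (x : GLq q) : Commute (ri q) x := by
  induction x using GLq.induction with
  | hz z => exact (Algebra.commutes z _).symm
  | hg x => exact ri_comm q x
  | hm x y hx hy => exact hx.mul_right hy
  | hadd x y hx hy => exact hx.add_right hy

/-- Collects the central factors, so that quadratic relations between the `r⁻¹ x_i` become relations
between the `x_i`. -/
theorem ri_mul_ri_mul (x y : GLq q) : ri q * x * (ri q * y) = ri q ^ 2 * (x * y) := by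
  rw [mul_assoc, ← mul_assoc x, ← (commute_ri x).eq, pow_two]
  simp only [mul_assoc]

theorem r_mul_ri : r q * ri q = 1 := by
  simpa only [map_mul, map_one, FreeAlgebra.lift_ι_apply] using mk_rel (q := q) .r_ri

theorem ri_mul_r : ri q * r q = 1 := by rw [(commute_ri _).eq, r_mul_ri]

theorem x1_mul_x2 : x1 q * x2 q = qc q • (x2 q * x1 q) := by
  simpa only [map_mul, map_smul, FreeAlgebra.lift_ι_apply] using mk_rel (q := q) .x12
theorem x1_mul_x3 : x1 q * x3 q = qc q • (x3 q * x1 q) := by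
  simpa only [map_mul, map_smul, FreeAlgebra.lift_ι_apply] using mk_rel (q := q) .x13
theorem x2_mul_x4 : x2 q * x4 q = qc q • (x4 q * x2 q) := by
  simpa only [map_mul, map_smul, FreeAlgebra.lift_ι_apply] using mk_rel (q := q) .x24
theorem x3_mul_x4 : x3 q * x4 q = qc q • (x4 q * x3 q) := by
  simpa only [map_mul, map_smul, FreeAlgebra.lift_ι_apply] using mk_rel (q := q) .x34
theorem x2_mul_x3 : x2 q * x3 q = x3 q * x2 q := by
  simpa only [map_mul, map_smul, FreeAlgebra.lift_ι_apply] using mk_rel (q := q) .x23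
theorem x1_mul_x4 : x1 q * x4 q = x4 q * x1 q + ((qc q)⁻¹ - qc q) • (x3 q * x2 q) := by
  have h := mk_rel (q := q) .x14
  simp only [map_mul, map_sub, map_smul, FreeAlgebra.lift_ι_apply] at h
  rw [← x2_mul_x3, ← h]; abel
theorem ri_sq_mul_det :
    ri q ^ 2 * (qc q • (x1 q * x4 q) + qc q ^ 2 • (x3 q * x2 q)) = 1 := by
  have h := mk_rel (q := q) .det
  simp only [map_mul, map_add, map_pow, map_one, map_smul, FreeAlgebra.lift_ι_apply] at h
  rw [← x2_mul_x3, ((commute_ri _).pow_left 2).eq, h]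

/-- The radial coordinate as an invertible element. -/
def rUnit : (GLq q)ˣ where
  val := r q
  inv := ri q
  val_inv := r_mul_ri
  inv_val := ri_mul_r

variable (q) in
/-- The embedding `u ↦ r⁻¹ Q` as an algebra morphism. -/
def embedHom : SUq q →ₐ[ℂ] GLq q :=
  SUq.lift (ri q * x1 q) (ri q * (qc q • x4 q)) (ri q * x2 q) (ri q * x3 q)
    (by
      rw [ri_mul_ri_mul, ri_mul_ri_mul, ← mul_smul_comm, ← mul_add, mul_smul_comm, ri_sq_mul_det])
    (by rw [ri_mul_ri_mul, ri_mul_ri_mul, x1_mul_x3, mul_smul_comm])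
    (by
      rw [ri_mul_ri_mul, ri_mul_ri_mul, mul_smul_comm, x2_mul_x4, smul_mul_assoc, mul_smul_comm,
        mul_smul_comm])
    (by rw [ri_mul_ri_mul, ri_mul_ri_mul, x2_mul_x3])
    (by
      have hq := qc_ne_zero q
      rw [ri_mul_ri_mul, ri_mul_ri_mul, ← mul_add, smul_mul_assoc]
      refine Eq.trans (congrArg _ ?_) ri_sq_mul_det
      -- Reordering `x_1 x_4` turns the determinant `q x_1 x_4 + q² x_2 x_3` into `q x_4 x_1 + x_3
      -- x_2`, the expression in the relation `a* a + c* c = 1`.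
      rw [x1_mul_x4]
      match_scalars <;> field_simp
      ring)
    (by
      rw [ri_mul_ri_mul, ri_mul_ri_mul, mul_smul_comm, x3_mul_x4, smul_mul_assoc, mul_smul_comm,
        mul_smul_comm])
    (by rw [ri_mul_ri_mul, ri_mul_ri_mul, x1_mul_x2, mul_smul_comm])

theorem embedHom_a : embedHom q (.a q) = ri q * x1 q := SUq.lift_a ..
theorem embedHom_a' : embedHom q (.a' q) = ri q * (qc q • x4 q) := SUq.lift_a' ..
theorem embedHom_c : embedHom q (.c q) = ri q * x2 q := SUq.lift_c ..
theorem embedHom_c' : embedHom q (.c' q) = ri q * x3 q := SUq.lift_c' ..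

theorem star_qc : star (qc q) = qc q := Complex.conj_ofReal _

variable (q) in
/-- The embedding `u ↦ r⁻¹ Q` as a morphism of star algebras. -/
def embed : SUq q →⋆ₐ[ℂ] GLq q where
  __ := embedHom q
  map_star' x := by
    change embedHom q (star x) = star (embedHom q x)
    induction x using SUq.induction with
    | hz z => simp [Algebra.algebraMap_eq_smul_one]
    | ha =>
      rw [SUq.star_a, embedHom_a, embedHom_a', star_mul, star_gen, star_gen, (commute_ri _).eq]
      rfl
    | ha' =>
      rw [SUq.star_a', embedHom_a, embedHom_a', star_mul, star_smul, star_gen, star_gen,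
        (commute_ri _).eq, star_qc]
      simp [adj, smul_smul, qc_ne_zero q]
    | hc =>
      rw [SUq.star_c, embedHom_c, embedHom_c', star_mul, star_gen, star_gen, (commute_ri _).eq]
      rfl
    | hc' =>
      rw [SUq.star_c', embedHom_c, embedHom_c', star_mul, star_gen, star_gen, (commute_ri _).eq]
      rfl
    | hm x y hx hy => rw [star_mul, map_mul, map_mul, hx, hy, star_mul]
    | hadd x y hx hy => rw [star_add, map_add, map_add, hx, hy, star_add]

variable (q) in
/-- The embedding of the radial algebra. -/
def radialHom : Radial →ₐ[ℂ] GLq q :=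
  AddMonoidAlgebra.lift ℂ (GLq q) ℤ
    ((Units.coeHom (GLq q)).comp (zpowersHom (GLq q)ˣ rUnit))

theorem radialHom_T (n : ℤ) :
    radialHom q (LaurentPolynomial.T n) = ((rUnit ^ n : (GLq q)ˣ) : GLq q) := by
  rw [radialHom, LaurentPolynomial.T, AddMonoidAlgebra.lift_single]
  simp

/-- The images of the generators under `Q ↦ r ⊗ u`. -/
def splitVals (q : Set.Ioo (0 : ℝ) 1) : GLGen → Radial ⊗[ℂ] SUq q
  | .x1 => (Radial.r : Radial) ⊗ₜ .a q
  | .x2 => (Radial.r : Radial) ⊗ₜ .c q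
  | .x3 => (Radial.r : Radial) ⊗ₜ .c' q
  | .x4 => (qc q)⁻¹ • ((Radial.r : Radial) ⊗ₜ .a' q)
  | .r => (Radial.r : Radial) ⊗ₜ 1
  | .ri => ((Radial.r⁻¹ : Radialˣ) : Radial) ⊗ₜ 1

theorem tmul_one_comm {A : Type} [Ring A] [Algebra ℂ A] (p : Radial) (x : Radial ⊗[ℂ] A) :
    p ⊗ₜ 1 * x = x * p ⊗ₜ 1 := by
  induction x using TensorProduct.induction_on with
  | zero => simp
  | tmul x y => simp [mul_comm]
  | add x y hx hy => rw [mul_add, add_mul, hx, hy]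

variable (q) in
/-- The morphism `Q ↦ r ⊗ u`. -/
def splitHom : GLq q →ₐ[ℂ] Radial ⊗[ℂ] SUq q :=
  Presented.lift (rel := GLRel (qc q)) (splitVals q) (by
    have hq := qc_ne_zero q
    intro x y h
    cases h <;> simp only [map_add, map_sub, map_mul, map_smul, map_one, map_pow,
      FreeAlgebra.lift_ι_apply]
    · simp only [splitVals, Algebra.TensorProduct.tmul_mul_tmul, SUq.rel7, TensorProduct.tmul_smul]
    · simp only [splitVals, Algebra.TensorProduct.tmul_mul_tmul, SUq.rel2, TensorProduct.tmul_smul]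
    · simp only [splitVals, Algebra.TensorProduct.tmul_mul_tmul, SUq.rel3, TensorProduct.tmul_smul,
        mul_smul_comm, smul_mul_assoc]
      exact smul_comm _ _ _
    · simp only [splitVals, Algebra.TensorProduct.tmul_mul_tmul, SUq.rel6, TensorProduct.tmul_smul,
        mul_smul_comm, smul_mul_assoc]
      exact smul_comm _ _ _
    · simp only [splitVals, Algebra.TensorProduct.tmul_mul_tmul, SUq.rel4]
    · simp only [splitVals, Algebra.TensorProduct.tmul_mul_tmul, mul_smul_comm, smul_mul_assoc,
        SUq.nf1, SUq.nf5, SUq.rel4, TensorProduct.tmul_sub, TensorProduct.tmul_smul]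
      match_scalars <;> field_simp <;> ring
    · exact tmul_one_comm _ _
    · exact tmul_one_comm _ _
    · simp only [splitVals, Algebra.TensorProduct.tmul_mul_tmul, Units.mul_inv, mul_one]
      rfl
    · simp only [splitVals, Algebra.TensorProduct.tmul_mul_tmul, mul_smul_comm, smul_mul_assoc,
        Algebra.TensorProduct.tmul_pow, ← TensorProduct.tmul_smul, ← TensorProduct.tmul_add,
        smul_smul, mul_inv_cancel₀ hq, one_smul, SUq.rel4, SUq.rel1]
      rw [one_pow, mul_one, ← pow_two, ← Units.val_pow_eq_pow_val, ← Units.val_pow_eq_pow_val,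
        inv_pow, Units.mul_inv]
      rfl)

theorem splitHom_gen (x : GLGen) : splitHom q (gen q x) = splitVals q x :=
  (Presented.lift_mk _ _ _).trans (FreeAlgebra.lift_ι_apply _ _)

/-- The factors `r⁻¹` and `r` cancel on each generator. This identity gives one half of the inverse
property, the injectivity of the embedding, and the compatibility with pull-back. -/
theorem splitHom_comp_embedHom : (splitHom q).comp (embedHom q) =
    Algebra.TensorProduct.includeRight := by
  have hq := qc_ne_zero q
  refine SUq.algHom_ext ?_ ?_ ?_ ?_
  · simp [embedHom_a, splitHom_gen, splitVals]
  · rw [AlgHom.comp_apply, embedHom_a', map_mul, map_smul, splitHom_gen, splitHom_gen, splitVals,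
      splitVals, smul_smul, mul_inv_cancel₀ hq, one_smul]
    simp
  · simp [embedHom_c, splitHom_gen, splitVals]
  · simp [embedHom_c', splitHom_gen, splitVals]

theorem splitHom_comp_radialHom : (splitHom q).comp (radialHom q) =
    Algebra.TensorProduct.includeLeft := by
  apply AddMonoidAlgebra.algHom_ext'
  · apply MonoidHom.ext_mint
    change splitHom q (radialHom q (LaurentPolynomial.T 1)) = Radial.r.val ⊗ₜ 1
    rw [radialHom_T, zpow_one]
    exact splitHom_gen .r
  · exact Subsingleton.elim _ _

variable (q) in
/-- The inverse of the splitting. -/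
def mergeHom : Radial ⊗[ℂ] SUq q →ₐ[ℂ] GLq q :=
  Algebra.TensorProduct.lift (radialHom q) (embedHom q) (fun x y => by
    induction x using LaurentPolynomial.induction_on' with
    | add p p' h h' => rw [map_add]; exact h.add_left h'
    | C_mul_T n z =>
      rw [map_mul, radialHom_T]
      have hc : radialHom q (LaurentPolynomial.C z) = algebraMap ℂ _ z :=
        (radialHom q).commutes z
      rw [hc]
      refine Commute.mul_left (Algebra.commutes _ _) ?_
      exact Commute.units_zpow_left (u := rUnit) (commute_r _) n)

variable (q) in
/-- The splitting `Q ↦ r ⊗ u` as an isomorphism of algebras. -/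
def splitEquiv : GLq q ≃ₐ[ℂ] Radial ⊗[ℂ] SUq q :=
  AlgEquiv.ofAlgHom (splitHom q) (mergeHom q)
    (by
      -- A morphism out of the tensor product is determined by its restrictions to the two factors.
      refine Algebra.TensorProduct.ext ?_ ?_
      · refine Eq.trans (AlgHom.ext fun x => ?_) splitHom_comp_radialHom
        simp [mergeHom]
      · refine Eq.trans (AlgHom.ext fun x => ?_) splitHom_comp_embedHom
        simp [mergeHom])
    (by
      have hq := qc_ne_zero q
      have hr : radialHom q Radial.r.val = r q := by
        refine (radialHom_T 1).trans ?_
        rw [zpow_one]; rfl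
      have hri : radialHom q (Radial.r⁻¹ : Radialˣ).val = ri q := by
        refine (radialHom_T (-1)).trans ?_
        rw [zpow_neg_one]; rfl
      have hx (x : GLq q) : r q * (ri q * x) = x := by rw [← mul_assoc, r_mul_ri, one_mul]
      refine GLq.algHom_ext fun x => ?_
      cases x <;> simp [splitHom_gen, splitVals, mergeHom, hr, hri, embedHom_a, embedHom_a',
        embedHom_c, embedHom_c', hx, smul_smul, hq])

theorem star_radial_r : star (Radial.r.val) = Radial.r.val := by
  change AddMonoidAlgebra.mapRingHom ℤ (starRingEnd ℂ) (AddMonoidAlgebra.single 1 1) = _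
  rw [AddMonoidAlgebra.mapRingHom_single, map_one]
  rfl

theorem star_radial_r_inv : star ((Radial.r⁻¹ : Radialˣ).val) = (Radial.r⁻¹ : Radialˣ).val := by
  change AddMonoidAlgebra.mapRingHom ℤ (starRingEnd ℂ) (AddMonoidAlgebra.single (-1) 1) = _
  rw [AddMonoidAlgebra.mapRingHom_single, map_one]
  rfl

variable (q) in
/-- The splitting `Q ↦ r ⊗ u` as an isomorphism of star algebras. -/
def split : GLq q ≃⋆ₐ[ℂ] Radial ⊗[ℂ] SUq q :=
  StarAlgEquiv.ofAlgEquiv (splitEquiv q) (fun x => by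
    change splitHom q (star x) = star (splitHom q x)
    have hq := qc_ne_zero q
    have hs : star (qc q)⁻¹ = (qc q)⁻¹ := by rw [star_inv₀, star_qc]
    induction x using GLq.induction with
    | hz z => simp [Algebra.algebraMap_eq_smul_one]
    | hg x =>
      rw [star_gen, splitHom_gen]
      cases x <;> simp only [adj, map_smul, splitHom_gen, splitVals, star_smul, hs,
        TensorProduct.star_tmul, star_radial_r, star_radial_r_inv, SUq.star_a, SUq.star_a',
        SUq.star_c, SUq.star_c', star_one, smul_smul, mul_inv_cancel₀ hq, one_smul]
    | hm x y hx hy => rw [star_mul, map_mul, map_mul, hx, hy, star_mul]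
    | hadd x y hx hy => rw [star_add, map_add, map_add, hx, hy, star_add])

theorem split_gen (x : GLGen) : split q (gen q x) = splitVals q x := splitHom_gen x

theorem split_embed (x : SUq q) : split q (embed q x) = 1 ⊗ₜ x :=
  AlgHom.congr_fun splitHom_comp_embedHom x

theorem embed_injective : Function.Injective (embed q) := by
  have h : Function.Injective (Algebra.TensorProduct.includeRight : SUq q →ₐ[ℂ] Radial ⊗[ℂ] SUq q) :=
    Algebra.TensorProduct.includeRight_injective (FaithfulSMul.algebraMap_injective ℂ Radial)
  intro x y hxy
  apply h
  have := congrArg (split q) hxy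
  rwa [split_embed, split_embed] at this

end GLq

end QuantumMeron

namespace QuantumMeron

open Ext GradedTensorProduct

/-! ### The radial calculus -/

namespace Radial

theorem d_incl (x : Radial) : calculus.d (incl x) = dr * incl (deriv x) := extCalculus_d_incl x

theorem dr_mul_dr : dr * dr = 0 := ω_mul_self 0

theorem d_dr_mul (f : Forms) : calculus.d (dr * f) = -(dr * calculus.d f) := by
  refine (extCalculus_d_ω_mul (by simp) (by simp) 0 f).trans ?_
  rw [Pi.zero_apply, zero_mul, zero_sub]
  rfl

/-- Every differential in the one-dimensional calculus is a multiple of `dr`, and `dr ∧ dr = 0`. -/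
theorem dr_mul_d (f : Forms) : dr * calculus.d f = 0 := by
  induction f using Ext.induction with
  | h0 x => rw [d_incl, ← mul_assoc, dr_mul_dr, zero_mul]
  | ha f g hf hg => rw [map_add, mul_add, hf, hg, add_zero]
  | hω i f _ =>
    obtain rfl : i = 0 := Subsingleton.elim _ _
    rw [d_dr_mul, mul_neg, ← mul_assoc, dr_mul_dr, zero_mul, neg_zero]

theorem d_dr_mul_eq_zero (f : Forms) : calculus.d (dr * f) = 0 := by
  rw [d_dr_mul, dr_mul_d, neg_zero]

theorem d_one : calculus.d 1 = 0 := by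
  rw [← incl_one, d_incl]
  have : deriv 1 = 0 := by
    change deriv (AddMonoidAlgebra.single 0 1) = 0
    rw [deriv, LinearMap.coe_mk, AddHom.coe_mk, AddMonoidAlgebra.coeff_single,
      Finsupp.sum_single_index] <;> simp
  rw [this, map_zero, mul_zero]

theorem d_d (f : Forms) : calculus.d (calculus.d f) = 0 := by
  induction f using Ext.induction with
  | h0 x => rw [d_incl, d_dr_mul_eq_zero]
  | ha f g hf hg => rw [map_add, map_add, hf, hg, add_zero]
  | hω i f _ =>
    obtain rfl : i = 0 := Subsingleton.elim _ _
    rw [d_dr_mul_eq_zero, map_zero]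

theorem d_mem (k : ℕ) (f : Forms) (hf : f ∈ gr extData k) : calculus.d f ∈ gr extData (k + 1) :=
  extCalculus_d_mem (fun _ => Submodule.zero_mem _)
    (fun _ => SetLike.mul_mem_graded (i := 1) (j := 0) (ω_mem (D := extData) 0) (incl_mem _)) hf

theorem eq_zero_of_mem (k : ℕ) (hk : calculus.dim < k) (f : Forms) (hf : f ∈ gr extData k) :
    f = 0 := by
  rwa [gr_eq_bot (show 1 < k from hk), Submodule.mem_bot] at hf

/-- The orthogonal frame `1`, `dr`. -/
def frame : Frame calculus (Finset (Fin 1)) :=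
  extFrame extData _ _ (fun i => by rw [Matrix.cons_val_fin_one]; exact ω_mem 0)
    (fun _ => one_ne_zero)

/-- The closed one-form `r⁻¹ dr`. -/
def θ : Forms := dr * incl ((r⁻¹ : Radialˣ) : Radial)

theorem incl_mul_dr (x : Radial) : incl x * dr = dr * incl x := by
  rw [incl_mul_ω]
  congr 2

theorem θ_mem : θ ∈ gr extData 1 :=
  SetLike.mul_mem_graded (i := 1) (j := 0) (ω_mem (D := extData) 0) (incl_mem _)

/-- Both sides vanish, since no two-forms exist on the radial line. -/
theorem d_θ_mul (f : Forms) : calculus.d (θ * f) = -(θ * calculus.d f) := by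
  have h : θ * calculus.d f = 0 := by
    rw [θ, ← incl_mul_dr, mul_assoc, dr_mul_d, mul_zero]
  rw [h, neg_zero, θ, mul_assoc, d_dr_mul_eq_zero]

theorem conj_one : calculus.conj 1 = 1 := by
  change ∑ T, incl (star ((1 : Forms).coef T)) * conjMonomial _ T = _
  rw [Finset.sum_eq_single ∅]
  · simp [coef_one, conjMonomial, incl_one]
  · intro T _ h
    simp [coef_one, h]
  · simp

end Radial

/-! ### The warped product -/

variable (q : Set.Ioo (0 : ℝ) 1) {α β γ : ℝ}

theorem prod_incl_one_tmul (x : SUq q) : (prodCalculus q α β γ).incl (1 ⊗ₜ x) =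
    pullback q (incl x) := rfl

theorem prod_d_pullback (ξ : SUq.Forms q) : (prodCalculus q α β γ).d (pullback q ξ) =
    pullback q ((SUq.calculus q α β γ).d ξ) := by
  have h : (1 : Radial.Forms) ∈ gr Radial.extData 0 := SetLike.one_mem_graded (gr Radial.extData)
  refine (warpedProduct_d_tmul_of_mem Radial.eq_zero_of_mem _ h ξ).trans ?_
  rw [Radial.d_one, gzero_tmul, zero_add, pow_zero, one_smul]
  rfl

theorem prod_d_d (ξ : ProdForms q) :
    (prodCalculus q α β γ).d ((prodCalculus q α β γ).d ξ) = 0 :=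
  warpedProduct_d_d Radial.eq_zero_of_mem _ Radial.d_mem Radial.d_d (SUq.d_d q α β γ) ξ

theorem prod_d_pullback_mul {ζ : SUq.Forms q} (hζ : ζ ∈ gr (SUq.extData q) 1)
    (h : ∀ η, (SUq.calculus q α β γ).d (ζ * η) =
      (SUq.calculus q α β γ).d ζ * η - ζ * (SUq.calculus q α β γ).d η) (ξ : ProdForms q) :
    (prodCalculus q α β γ).d (pullback q ζ * ξ) =
      pullback q ((SUq.calculus q α β γ).d ζ) * ξ -
        pullback q ζ * (prodCalculus q α β γ).d ξ := by
  refine (warpedProduct_d_includeRight_mul Radial.eq_zero_of_mem _ Radial.d_mem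
    (SUq.d_mem q α β γ) hζ (fun η => ?_) ξ).trans ?_
  · rw [h, pow_one, neg_one_smul, sub_eq_add_neg]
  · rw [pow_one, neg_one_smul, ← sub_eq_add_neg]
    rfl

/-- The one-form `r⁻¹ dr` on the product. -/
def radialForm : ProdForms q := Radial.θ ᵍ⊗ₜ[ℂ] 1

theorem prod_d_radialForm_mul (ξ : ProdForms q) : (prodCalculus q α β γ).d (radialForm q * ξ) =
    -(radialForm q * (prodCalculus q α β γ).d ξ) :=
  warpedProduct_d_tmul_one_mul Radial.eq_zero_of_mem _ Radial.θ_mem Radial.d_θ_mul ξ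

theorem radialForm_mul_pullback (ζ : SUq.Forms q) :
    radialForm q * pullback q ζ = Radial.θ ᵍ⊗ₜ[ℂ] ζ := by
  have h : (1 : SUq.Forms q) ∈ gr (SUq.extData q) 0 := SetLike.one_mem_graded (gr (SUq.extData q))
  refine (tmul_mul_tmul_of_left h _ _).trans ?_
  rw [mul_one, one_mul]

/-- One-forms from different factors of a graded tensor product anticommute. -/
theorem pullback_mul_radialForm {ζ : SUq.Forms q} (hζ : ζ ∈ gr (SUq.extData q) 1) :
    pullback q ζ * radialForm q = -(radialForm q * pullback q ζ) := by
  rw [radialForm_mul_pullback]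
  refine (tmul_mul_tmul _ hζ Radial.θ_mem _).trans ?_
  rw [one_mul, one_mul, mul_one, pow_one, neg_one_smul]

variable (hα : α ≠ 0) (hβ : β ≠ 0) (hγ : γ ≠ 0)

/-- The orthogonal frame of the warped product. -/
def prodFrame : Frame (prodCalculus q α β γ) (Finset (Fin 1) × Finset (Fin 3)) :=
  Radial.frame.warped (SUq.frame q hα hβ hγ) (fun k => Radial.r ^ k) (fun _ _ => Commute.all _ _)

theorem star_r_inv_pow : star ((Radial.r⁻¹ : Radialˣ) : Radial) = (Radial.r⁻¹ : Radialˣ) :=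
  GLq.star_radial_r_inv

/-- Comparison of coordinates on `ω_S ⊗ ω_T`. The density of `ω_S ⊗ (ξ* ∧ ω_T)` requires `ω_S = dr`
and reproduces the density on `SU_q(2)`, so only the power of `r` has to be tracked. -/
theorem hodge_pullback {ξ : SUq.Forms q} (hξ : ξ ∈ gr (SUq.extData q) 2) :
    (prodFrame q hα hβ hγ).hodge (pullback q ξ) =
      radialForm q * pullback q ((SUq.frame q hα hβ hγ).hodge ξ) := by
  rw [radialForm_mul_pullback]
  refine (prodFrame q hα hβ hγ).ext_coord fun i => ?_
  obtain ⟨S, T⟩ := i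
  have hS : (prodCalculus q α β γ).conj (pullback q ξ) * (prodFrame q hα hβ hγ).e (S, T) =
      (monomial S 1 : Radial.Forms) ᵍ⊗ₜ[ℂ]
        ((SUq.calculus q α β γ).conj ξ * monomial T 1) := by
    have h1 : (prodCalculus q α β γ).conj (pullback q ξ) =
        1 ᵍ⊗ₜ[ℂ] (SUq.calculus q α β γ).conj ξ := by
      refine (warpedProduct_conj_tmul _ _ _).trans ?_
      rw [Radial.conj_one]
    rw [h1]
    refine (tmul_mul_tmul 1 ((SUq.frame q hα hβ hγ).conj_mem hξ)
      (monomial_mem (D := Radial.extData) S 1) _).trans ?_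
    -- The sign is `((-1)²)^{|S|} = 1`, because `ξ*` has even degree.
    rw [one_mul, pow_mul]
    simp
    rfl
  have hd : (prodFrame q hα hβ hγ).dens ((prodCalculus q α β γ).conj (pullback q ξ) *
      (prodFrame q hα hβ hγ).e (S, T)) = ((((Radial.r ^ 3)⁻¹ : Radialˣ) : Radial) *
        (monomial S 1 : Radial.Forms).coef Finset.univ) ⊗ₜ
          (SUq.frame q hα hβ hγ).dens ((SUq.calculus q α β γ).conj ξ *
            (SUq.frame q hα hβ hγ).e T) := by
    rw [hS]; rfl
  have hw : (((prodFrame q hα hβ hγ).wt (S, T))⁻¹ : (Radial ⊗[ℂ] SUq q)ˣ).val =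
      ((((Radial.r ^ T.card)⁻¹ ^ 2 * Radial.frame.wt S)⁻¹ : Radialˣ) : Radial) ⊗ₜ
        (((SUq.frame q hα hβ hγ).wt T)⁻¹ : (SUq q)ˣ).val := rfl
  have h1 : Radial.frame.wt S = 1 := by
    ext1
    change algebraMap ℂ Radial ((1 : Finset (Fin 1) → ℂ) S) = 1
    simp
  have hc : (prodFrame q hα hβ hγ).coord (S, T)
      (Radial.θ ᵍ⊗ₜ[ℂ] (SUq.frame q hα hβ hγ).hodge ξ) =
        Radial.θ.coef S ⊗ₜ (SUq.frame q hα hβ hγ).coord T ((SUq.frame q hα hβ hγ).hodge ξ) := rfl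
  rw [Frame.coord_hodge, hd, hw, h1, mul_one, hc, Algebra.TensorProduct.tmul_mul_tmul,
    TensorProduct.star_tmul, ← Frame.coord_hodge]
  by_cases hT : T.card = 1
  · congr 1
    rw [hT, Radial.θ, Radial.dr, ω, ← monomial_eq, coef_monomial, coef_monomial]
    by_cases hS : S = {0}
    · subst hS
      rw [if_pos rfl, if_pos (show Finset.univ = {(0 : Fin 1)} from rfl),
        mul_one, ← Units.val_mul]
      -- The first factor comes from the volume form; the second is the inverse of the warping
      -- factor `r⁻²` of one-forms on `SU_q(2)`.
      have e : (Radial.r ^ 3)⁻¹ * ((Radial.r ^ 1)⁻¹ ^ 2)⁻¹ = (Radial.r⁻¹ : Radialˣ) := by group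
      rw [e, star_r_inv_pow]
    · rw [if_neg hS, if_neg, mul_zero, zero_mul, star_zero]
      intro h
      apply hS
      rw [← h]
      rfl
  · have h0 : (SUq.frame q hα hβ hγ).coord T ((SUq.frame q hα hβ hγ).hodge ξ) = 0 :=
      (SUq.frame q hα hβ hγ).coord_eq_zero
        ((SUq.frame q hα hβ hγ).isHodge_hodge.map_mem 2 (Nat.le_succ 2) ξ hξ) hT
    rw [h0, TensorProduct.tmul_zero, TensorProduct.tmul_zero]

/-! ### The quantum meron -/

/-- The gauge potential of the quantum meron. -/
def meron : Matrix (Fin 2) (Fin 2) (ProdForms q) := (SUq.potential q (1 / 2)).map (pullback q)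

theorem prod_d_meron_mul (i j : Fin 2) (η : ProdForms q) :
    (prodCalculus q α β γ).d (meron q i j * η) =
      (prodCalculus q α β γ).d (meron q i j) * η -
        meron q i j * (prodCalculus q α β γ).d η := by
  rw [meron, Matrix.map_apply, prod_d_pullback]
  exact prod_d_pullback_mul q (SUq.potential_mem q _ i j) (SUq.d_potential_mul q _ i j) η

theorem meron_curvature_eq : (meron q).map (prodCalculus q α β γ).d + meron q * meron q =
    (SUq.curvature q).map (pullback q) := by
  rw [← SUq.curvature_eq q (α := α) (β := β) (γ := γ)]
  ext1 i j
  simp [meron, Matrix.mul_apply, prod_d_pullback]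

theorem isCurvature_meron : (prodCalculus q α β γ).IsCurvature (meron q)
    ((SUq.curvature q).map (pullback q)) := by
  rw [← meron_curvature_eq q (α := α) (β := β) (γ := γ)]
  refine HermCalculus.isCurvature_map_d_add_mul (prod_d_d q) (prod_d_meron_mul q) fun i j => ?_
  rw [meron_curvature_eq]
  have h : (1 : Radial.Forms) ∈ gr Radial.extData 0 := SetLike.one_mem_graded (gr Radial.extData)
  exact tmul_mem_prodGr (i := 0) (j := 2) h (SUq.curvature_mem q i j)

theorem map_hodge_meron (h₁ : (1 + (q : ℝ)⁻¹ ^ 2) * γ = α) (h₂ : α = (q : ℝ)⁻¹ ^ 6 * β) :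
    ((SUq.curvature q).map (pullback q)).map (prodFrame q hα hβ hγ).hodge =
      (1 / (2 * γ) : ℂ) • (meron q).map (radialForm q * ·) := by
  ext1 i j
  have h := congrFun (congrFun (SUq.map_hodge_curvature q hα hβ hγ h₁ h₂) i) j
  rw [Matrix.map_apply] at h
  rw [Matrix.map_apply, Matrix.map_apply, hodge_pullback q hα hβ hγ (SUq.curvature_mem q i j), h]
  simp [meron]

theorem d_meron_add : (meron q).map (prodCalculus q α β γ).d +
    (meron q * meron q + meron q * meron q) = 0 := by
  have h := congrArg (fun M => M.map (pullback q)) (SUq.d_add_potential_mul q (α := α) (β := β)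
    (γ := γ))
  refine Eq.trans ?_ (h.trans ?_)
  · ext1 i j
    simp [meron, Matrix.mul_apply, prod_d_pullback]
  · ext1 i j
    simp

theorem prod_solvesYangMills (h₁ : (1 + (q : ℝ)⁻¹ ^ 2) * γ = α) (h₂ : α = (q : ℝ)⁻¹ ^ 6 * β) :
    (prodCalculus q α β γ).SolvesYangMills (prodFrame q hα hβ hγ).hodge (meron q) := by
  refine ⟨_, isCurvature_meron q, ?_⟩
  rw [map_hodge_meron q hα hβ hγ h₁ h₂]
  have hd (i j : Fin 2) : (prodCalculus q α β γ).d (radialForm q * meron q i j) =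
      -(radialForm q * (prodCalculus q α β γ).d (meron q i j)) := prod_d_radialForm_mul q _
  -- In total dimension four the dual of the curvature is again a two-form, so the graded commutator
  -- is an ordinary one.
  refine HermCalculus.covDeriv_eq_zero (k := 2) (fun i j η => ?_) ?_
  · simp only [Matrix.smul_apply, Matrix.map_apply, smul_mul_assoc, map_smul, mul_assoc,
      prod_d_radialForm_mul, prod_d_meron_mul]
    rw [neg_one_sq, one_smul, ← smul_add]
    congr 1
    noncomm_ring
  · have e : ((1 / (2 * γ) : ℂ) • (meron q).map (radialForm q * ·)).map
        (prodCalculus q α β γ).d = -((1 / (2 * γ) : ℂ) •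
          ((meron q).map (prodCalculus q α β γ).d).map (radialForm q * ·)) := by
      ext1 i j
      simp [hd]
    -- Moving `θ` to the left past `A` costs a sign, so `AθA - θAA = -2 θA²`. Together with `d(θA) =
    -- -θ dA` this gives `-θ(dA + 2A²)`.
    have e1 : meron q * (meron q).map (radialForm q * ·) =
        -((meron q * meron q).map (radialForm q * ·)) := by
      ext1 i j
      simp only [Matrix.mul_apply, Matrix.map_apply, Matrix.neg_apply, Finset.mul_sum,
        ← Finset.sum_neg_distrib]
      refine Finset.sum_congr rfl fun k _ => ?_
      have hk : meron q i k * radialForm q = -(radialForm q * meron q i k) :=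
        pullback_mul_radialForm q (SUq.potential_mem q _ i k)
      rw [← mul_assoc, hk, neg_mul, mul_assoc]
    have e2 : (meron q).map (radialForm q * ·) * meron q =
        (meron q * meron q).map (radialForm q * ·) := by
      ext1 i j
      simp only [Matrix.mul_apply, Matrix.map_apply, Finset.mul_sum, mul_assoc]
    have e3 : ((meron q).map (prodCalculus q α β γ).d).map (radialForm q * ·) +
        ((meron q * meron q).map (radialForm q * ·) +
          (meron q * meron q).map (radialForm q * ·)) = 0 := by
      have h := congrArg (fun M => M.map (radialForm q * ·)) (d_meron_add q (α := α) (β := β)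
        (γ := γ))
      refine Eq.trans ?_ (h.trans ?_)
      · ext1 i j
        simp only [Matrix.map_apply, Matrix.add_apply, mul_add]
      · ext1 i j
        simp
    rw [e, mul_smul_comm, smul_mul_assoc, e1, e2, neg_one_sq, one_smul, ← sub_eq_zero,
      smul_neg, ← neg_add, ← smul_add, ← neg_add', ← smul_add, add_assoc, e3, smul_zero, neg_zero]

theorem map_hodge_ne_smul (h₁ : (1 + (q : ℝ)⁻¹ ^ 2) * γ = α) (h₂ : α = (q : ℝ)⁻¹ ^ 6 * β) (z : ℂ) :
    ((SUq.curvature q).map (pullback q)).map (prodFrame q hα hβ hγ).hodge ≠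
      z • (SUq.curvature q).map (pullback q) := by
  intro h
  rw [map_hodge_meron q hα hβ hγ h₁ h₂] at h
  have h := congrFun (congrFun h 0) 0
  simp only [Matrix.smul_apply, Matrix.map_apply, meron, radialForm_mul_pullback] at h
  have hγ' : (γ : ℂ) ≠ 0 := Complex.ofReal_ne_zero.2 hγ
  have key (S : Finset (Fin 1)) (T : Finset (Fin 3)) :
      (1 / (2 * γ) : ℂ) • (Radial.θ.coef S ⊗ₜ[ℂ] (SUq.potential q (1 / 2) 0 0).coef T) =
        z • ((1 : Radial.Forms).coef S ⊗ₜ[ℂ] (SUq.curvature q 0 0).coef T) := by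
    have := congrArg ((prodFrame q hα hβ hγ).coord (S, T)) h
    rw [map_smul, map_smul] at this
    exact this
  -- The coefficient of `dr ⊗ ω_z` in the upper left entry is a nonzero multiple of `r⁻¹ ⊗ 1` for
  -- `⋆F`, and is zero for `F`.
  have k := key {0} {2}
  have hθ : Radial.θ.coef {0} = ((Radial.r⁻¹ : Radialˣ) : Radial) := by
    rw [Radial.θ, Radial.dr, ω, ← monomial_eq, coef_monomial, if_pos rfl]
  have hA : (SUq.potential q (1 / 2) 0 0).coef {2} = (1 / 2 : ℂ) • (1 : SUq q) := by
    change (1 / 2 : ℂ) • (monomial {2} 1 : SUq.Forms q).coef {2} = _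
    rw [coef_monomial, if_pos rfl]
  rw [hθ, hA, coef_one, if_neg (Finset.singleton_ne_empty _), TensorProduct.zero_tmul, smul_zero,
    TensorProduct.tmul_smul, smul_smul] at k
  have k' := (smul_eq_zero.1 k).resolve_left (by simp [hγ'])
  -- Multiplying by the invertible `r ⊗ 1` reduces the contradiction to `1 ⊗ 1 ≠ 0`.
  have hu := congrArg (fun x => (Radial.r : Radial) ⊗ₜ[ℂ] (1 : SUq q) * x) k'
  simp only [Algebra.TensorProduct.tmul_mul_tmul, Units.mul_inv, mul_one, mul_zero] at hu
  have hinj : Function.Injective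
      (Algebra.TensorProduct.includeRight : SUq q →ₐ[ℂ] Radial ⊗[ℂ] SUq q) :=
    Algebra.TensorProduct.includeRight_injective (FaithfulSMul.algebraMap_injective ℂ Radial)
  exact one_ne_zero (hinj (hu.trans (map_zero _).symm))

theorem meron_eq (hα : α ≠ 0) (hβ : β ≠ 0) (hγ : γ ≠ 0) (f D : GLq q → ProdForms q)
    (hf : ∀ x, f x = (prodCalculus q α β γ).incl (GLq.split q x))
    (hD : ∀ x, D x = (prodCalculus q α β γ).d (f x)) :
    meron q = (1 / 2 : ℂ) •
      !![f (.ri q) * (qc q • (f (.x4 q) * D (.ri q * .x1 q)) + f (.x3 q) * D (.ri q * .x2 q)),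
        f (.ri q) * (f (.x3 q) * D (.ri q * (qc q • .x4 q)) -
          qc q ^ 2 • (f (.x4 q) * D (.ri q * .x3 q)));
        f (.ri q) * (f (.x1 q) * D (.ri q * .x2 q) - qc q • (f (.x2 q) * D (.ri q * .x1 q))),
        f (.ri q) * -(qc q ^ 2 • (qc q • (f (.x4 q) * D (.ri q * .x1 q)) +
          f (.x3 q) * D (.ri q * .x2 q)))] := by
  have hq := qc_ne_zero q
  have hmul (x y : Radial ⊗[ℂ] SUq q) : (prodCalculus q α β γ).incl (x * y) =
      (prodCalculus q α β γ).incl x * (prodCalculus q α β γ).incl y :=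
    (prodFrame q hα hβ hγ).incl_mul x y
  have hfe (x : SUq q) : f (GLq.embed q x) = pullback q (incl x) := by
    rw [hf, GLq.split_embed, prod_incl_one_tmul]
  have hDe (x : SUq q) : D (GLq.embed q x) = pullback q (SUq.d₀ q x) := by
    rw [hD, hfe, prod_d_pullback, SUq.d_incl]
  -- The prefactor `r⁻¹` is absorbed into the coefficients `x_i`, which become the entries of `r⁻¹
  -- Q`, that is images of the generators of `SU_q(2)`.
  have hri (x : GLq q) (y : ProdForms q) : f (.ri q) * (f x * y) = f (.ri q * x) * y := by
    rw [← mul_assoc, hf, hf, hf, map_mul, hmul]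
  have ha : GLq.ri q * GLq.x1 q = GLq.embed q (.a q) := GLq.embedHom_a.symm
  have ha' : GLq.ri q * (qc q • GLq.x4 q) = GLq.embed q (.a' q) := GLq.embedHom_a'.symm
  have hc : GLq.ri q * GLq.x2 q = GLq.embed q (.c q) := GLq.embedHom_c.symm
  have hc' : GLq.ri q * GLq.x3 q = GLq.embed q (.c' q) := GLq.embedHom_c'.symm
  -- The entry of `Q` that corresponds to `a*` is `q x_4`, hence the factor `q⁻¹`.
  have h4 : f (.ri q * .x4 q) = (qc q)⁻¹ • pullback q (incl (.a' q)) := by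
    rw [← hfe, ← ha', hf, hf, mul_smul_comm, map_smul, map_smul, smul_smul, inv_mul_cancel₀ hq,
      one_smul]
  have e1 : f (.ri q) * (qc q • (f (.x4 q) * D (.ri q * .x1 q)) +
      f (.x3 q) * D (.ri q * .x2 q)) = pullback q (SUq.ωz q) := by
    rw [SUq.ωz_eq, map_add, map_mul, map_mul, mul_add, mul_smul_comm, hri, h4, hri, ha, hc, hc',
      hfe, hDe, hDe, smul_mul_assoc, smul_smul, mul_inv_cancel₀ hq, one_smul]
  have e2 : f (.ri q) * (f (.x3 q) * D (.ri q * (qc q • .x4 q)) -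
      qc q ^ 2 • (f (.x4 q) * D (.ri q * .x3 q))) = pullback q (SUq.ωm q) := by
    rw [SUq.ωm_eq, map_sub, map_smul, map_mul, map_mul, mul_sub, mul_smul_comm (qc q ^ 2), hri, hri, h4,
      hc', ha', hfe, hDe, hDe, smul_mul_assoc, smul_smul, pow_two, mul_assoc, mul_inv_cancel₀ hq,
      mul_one]
  have e3 : f (.ri q) * (f (.x1 q) * D (.ri q * .x2 q) -
      qc q • (f (.x2 q) * D (.ri q * .x1 q))) = pullback q (SUq.ωp q) := by
    rw [SUq.ωp_eq, map_sub, map_smul, map_mul, map_mul, mul_sub, mul_smul_comm, hri, hri, ha, hc,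
      hfe, hfe, hDe, hDe]
  rw [mul_neg, mul_smul_comm (qc q ^ 2), e1, e2, e3]
  ext1 i j
  fin_cases i <;> fin_cases j <;> simp [meron, SUq.potential, smul_smul]

end QuantumMeron

theorem mainTheorem4 (q : Set.Ioo (0 : ℝ) 1) (α β γ : ℝ) (hα : α ≠ 0)
    (hγ : (1 + (q : ℝ)⁻¹ ^ 2) * γ = α) (hβ : α = (q : ℝ)⁻¹ ^ 6 * β) :
    -- the solution on `SU_q(2)`
    (∃ s, (QuantumMeron.SUq.calculus q α β γ).IsHodge s ∧
      (∀ s', (QuantumMeron.SUq.calculus q α β γ).IsHodge s' → s' = s) ∧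
      (QuantumMeron.SUq.calculus q α β γ).SolvesYangMills s
        (QuantumMeron.SUq.potential q (1 / 2))) ∧
    -- the embedding `i`, and the identification `Φ` of `GL_q(1, ℍ)` with the warped product
    ∃ (i : QuantumMeron.SUq q →⋆ₐ[ℂ] QuantumMeron.GLq q)
      (Φ : QuantumMeron.GLq q ≃⋆ₐ[ℂ] QuantumMeron.Radial ⊗[ℂ] QuantumMeron.SUq q),
      -- `i(u) = r⁻¹ Q`
      (i (.a q) = .ri q * .x1 q ∧ i (.c q) = .ri q * .x2 q ∧
        i (.c' q) = .ri q * .x3 q ∧ i (.a' q) = .ri q * (QuantumMeron.qc q • .x4 q)) ∧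
      Function.Injective i ∧
      -- `Φ(r) = r ⊗ 1`, and `Φ(Q) = r ⊗ u`
      (Φ (.r q) = (QuantumMeron.Radial.r : QuantumMeron.Radial) ⊗ₜ[ℂ] 1 ∧
        Φ (.ri q) = ((QuantumMeron.Radial.r⁻¹ : QuantumMeron.Radialˣ) :
          QuantumMeron.Radial) ⊗ₜ[ℂ] 1 ∧
        Φ (.x1 q) = (QuantumMeron.Radial.r : QuantumMeron.Radial) ⊗ₜ[ℂ] .a q ∧
        Φ (.x2 q) = (QuantumMeron.Radial.r : QuantumMeron.Radial) ⊗ₜ[ℂ] .c q ∧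
        Φ (.x3 q) = (QuantumMeron.Radial.r : QuantumMeron.Radial) ⊗ₜ[ℂ] .c' q ∧
        Φ (QuantumMeron.qc q • .x4 q) =
          (QuantumMeron.Radial.r : QuantumMeron.Radial) ⊗ₜ[ℂ] .a' q) ∧
      -- the pull-back of forms extends `i` and commutes with the differentials
      (∀ x, QuantumMeron.pullback q ((QuantumMeron.SUq.calculus q α β γ).incl x) =
        (QuantumMeron.prodCalculus q α β γ).incl (Φ (i x))) ∧
      (∀ ξ, QuantumMeron.pullback q ((QuantumMeron.SUq.calculus q α β γ).d ξ) =
        (QuantumMeron.prodCalculus q α β γ).d (QuantumMeron.pullback q ξ)) ∧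
      -- the explicit form of the pulled back connection, where `f x` is `x` as a form of degree
      -- zero and `D x` is its differential
      (∀ f D : QuantumMeron.GLq q → QuantumMeron.ProdForms q,
        (∀ x, f x = (QuantumMeron.prodCalculus q α β γ).incl (Φ x)) →
        (∀ x, D x = (QuantumMeron.prodCalculus q α β γ).d (f x)) →
        (QuantumMeron.SUq.potential q (1 / 2)).map (QuantumMeron.pullback q) =
          (1 / 2 : ℂ) •
            !![f (.ri q) * (QuantumMeron.qc q • (f (.x4 q) * D (.ri q * .x1 q)) +
                  f (.x3 q) * D (.ri q * .x2 q)),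
              f (.ri q) * (f (.x3 q) * D (.ri q * (QuantumMeron.qc q • .x4 q)) -
                  QuantumMeron.qc q ^ 2 • (f (.x4 q) * D (.ri q * .x3 q)));
              f (.ri q) * (f (.x1 q) * D (.ri q * .x2 q) -
                  QuantumMeron.qc q • (f (.x2 q) * D (.ri q * .x1 q))),
              f (.ri q) * -(QuantumMeron.qc q ^ 2 •
                (QuantumMeron.qc q • (f (.x4 q) * D (.ri q * .x1 q)) +
                  f (.x3 q) * D (.ri q * .x2 q)))]) ∧
      -- it solves the Yang-Mills equations, and its curvature is not an eigenvector of the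
      -- Hodge duality operator; in particular it is neither self-dual nor anti-self-dual
      ∃ s, (QuantumMeron.prodCalculus q α β γ).IsHodge s ∧
        (∀ s', (QuantumMeron.prodCalculus q α β γ).IsHodge s' → s' = s) ∧
        (QuantumMeron.prodCalculus q α β γ).SolvesYangMills s
          ((QuantumMeron.SUq.potential q (1 / 2)).map (QuantumMeron.pullback q)) ∧
        ∀ F, (QuantumMeron.prodCalculus q α β γ).IsCurvature
            ((QuantumMeron.SUq.potential q (1 / 2)).map (QuantumMeron.pullback q)) F →
          ∀ z : ℂ, F.map s ≠ z • F := by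
  have hγ0 : γ ≠ 0 := by
    rintro rfl
    exact hα (by rw [← hγ, mul_zero])
  have hβ0 : β ≠ 0 := by
    rintro rfl
    exact hα (by rw [hβ, mul_zero])
  refine ⟨⟨(QuantumMeron.SUq.frame q hα hβ0 hγ0).hodge,
      (QuantumMeron.SUq.frame q hα hβ0 hγ0).isHodge_hodge, fun s' h =>
        (QuantumMeron.SUq.frame q hα hβ0 hγ0).hodge_unique
          (QuantumMeron.SUq.frame q hα hβ0 hγ0).isHodge_hodge h,
      QuantumMeron.SUq.solvesYangMills q hα hβ0 hγ0 hγ hβ⟩,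
    QuantumMeron.GLq.embed q, QuantumMeron.GLq.split q,
    ⟨QuantumMeron.GLq.embedHom_a, QuantumMeron.GLq.embedHom_c, QuantumMeron.GLq.embedHom_c',
      QuantumMeron.GLq.embedHom_a'⟩,
    QuantumMeron.GLq.embed_injective,
    ⟨QuantumMeron.GLq.split_gen .r, QuantumMeron.GLq.split_gen .ri,
      QuantumMeron.GLq.split_gen .x1, QuantumMeron.GLq.split_gen .x2,
      QuantumMeron.GLq.split_gen .x3, ?_⟩,
    fun x => ?_, fun ξ => (QuantumMeron.prod_d_pullback q ξ).symm,
    fun f D hf hD => QuantumMeron.meron_eq q hα hβ0 hγ0 f D hf hD,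
    ⟨(QuantumMeron.prodFrame q hα hβ0 hγ0).hodge,
      (QuantumMeron.prodFrame q hα hβ0 hγ0).isHodge_hodge, fun s' h =>
        (QuantumMeron.prodFrame q hα hβ0 hγ0).hodge_unique
          (QuantumMeron.prodFrame q hα hβ0 hγ0).isHodge_hodge h,
      QuantumMeron.prod_solvesYangMills q hα hβ0 hγ0 hγ hβ, fun F hF z => ?_⟩⟩
  · rw [map_smul]
    exact (congrArg (QuantumMeron.qc q • ·) (QuantumMeron.GLq.split_gen .x4)).trans
      (smul_inv_smul₀ (QuantumMeron.qc_ne_zero q) _)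
  · rw [QuantumMeron.GLq.split_embed]
    rfl
  -- Uniqueness of the curvature reduces an arbitrary `F` to the explicit pulled back one.
  · rw [hF.unique (QuantumMeron.isCurvature_meron q)]
    exact QuantumMeron.map_hodge_ne_smul q hα hβ0 hγ0 hγ hβ z
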